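/- Let $G=(V,E)$ be a finite simple undirected graph and let $S\subseteq V\times V$ be a set of terminal pairs. A Steiner forest of $(G,S)$ is a subgraph $F$ of $G$ such that, for every $(s,t)\in S$, the vertices $s$ and $t$ belong to the same connected component of $F$. The problem Steiner Forest asks, given $G$, $S$ and an integer $k$, whether $(G,S)$ has a Steiner forest $F$ with $|E(F)|\le k$. A $2$-deletion set of $G$ is a set $T\subseteq V$ such that every connected component of $G-T$ has at most two vertices. Steiner Forest is polynomial-time solvable for graphs with a $2$-deletion set of size at most $2$. That is, there is a deterministic algorithm (a program of a random access machine with addition and subtraction at unit cost) and a polynomial $p$ such that, for every instance $(G,S,k)$ for which $G$ has a $2$-deletion set of size at most $2$, the algorithm, given only a binary encoding of $(G,S,k)$ of length $\ell$ (the adjacency matrix of $G$, the matrix of $S$, and $k$ in binary), halts after at most $p(\ell)$ steps and correctly decides whether $(G,S)$ has a Steiner forest with at most $k$ edges. -/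

import Mathlib

namespace SteinerForest

/-! ### Random access machines with a step count -/

/-- Programs of a random access machine in structured form.  The machine has registers
`R[0], R[1], …` (of which a program mentions only finitely many, by fixed index) and a memory
`M[0], M[1], …` that is addressed indirectly.  All cells hold natural numbers.  The arithmetic
consists of addition and truncated subtraction only (no multiplication), so that with unit cost per
instruction the machine is polynomially equivalent to a Turing machine. -/
inductive Prog : Type
  /-- do nothing -/
  | skip : Prog
  /-- `R[d] := c` -/
  | const (d c : ℕ) : Prog
  /-- `R[d] := R[a]` -/
  | copy (d a : ℕ) : Prog
  /-- `R[d] := R[a] + R[b]` -/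
  | plus (d a b : ℕ) : Prog
  /-- `R[d] := R[a] - R[b]`, truncated at `0` -/
  | minus (d a b : ℕ) : Prog
  /-- `R[d] := M[R[a]]` -/
  | load (d a : ℕ) : Prog
  /-- `M[R[a]] := R[b]` -/
  | store (a b : ℕ) : Prog
  /-- first `p`, then `q` -/
  | seq (p q : Prog) : Prog
  /-- if `R[a] ≠ 0` then `p` else `q` -/
  | ite (a : ℕ) (p q : Prog) : Prog
  /-- while `R[a] ≠ 0` do `p` -/
  | loop (a : ℕ) (p : Prog) : Prog

/-- The contents of the registers and of the memory. -/
structure State : Type where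
  reg : ℕ → ℕ
  mem : ℕ → ℕ

/-- `R[d] := x`. -/
def State.setReg (s : State) (d x : ℕ) : State :=
  { s with reg := Function.update s.reg d x }

/-- `M[i] := x`. -/
def State.setMem (s : State) (i x : ℕ) : State :=
  { s with mem := Function.update s.mem i x }

/-- `Exec p s t s'`: the program `p`, started in the state `s`, halts after exactly `t` steps in the
state `s'`.  Every elementary instruction and every evaluation of the test of a conditional or of a
loop is one step. -/
inductive Exec : Prog → State → ℕ → State → Prop
  | skip (s : State) : Exec .skip s 1 s
  | const (s : State) (d c : ℕ) : Exec (.const d c) s 1 (s.setReg d c)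
  | copy (s : State) (d a : ℕ) : Exec (.copy d a) s 1 (s.setReg d (s.reg a))
  | plus (s : State) (d a b : ℕ) : Exec (.plus d a b) s 1 (s.setReg d (s.reg a + s.reg b))
  | minus (s : State) (d a b : ℕ) : Exec (.minus d a b) s 1 (s.setReg d (s.reg a - s.reg b))
  | load (s : State) (d a : ℕ) : Exec (.load d a) s 1 (s.setReg d (s.mem (s.reg a)))
  | store (s : State) (a b : ℕ) : Exec (.store a b) s 1 (s.setMem (s.reg a) (s.reg b))
  | seq {p q : Prog} {s s' s'' : State} {t t' : ℕ} (hp : Exec p s t s') (hq : Exec q s' t' s'') :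
      Exec (.seq p q) s (t + t') s''
  | ite_true {a : ℕ} {p q : Prog} {s s' : State} {t : ℕ} (ha : s.reg a ≠ 0) (hp : Exec p s t s') :
      Exec (.ite a p q) s (t + 1) s'
  | ite_false {a : ℕ} {p q : Prog} {s s' : State} {t : ℕ} (ha : s.reg a = 0) (hq : Exec q s t s') :
      Exec (.ite a p q) s (t + 1) s'
  | loop_done {a : ℕ} {p : Prog} {s : State} (ha : s.reg a = 0) : Exec (.loop a p) s 1 s
  | loop_step {a : ℕ} {p : Prog} {s s' s'' : State} {t t' : ℕ} (ha : s.reg a ≠ 0)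
      (hp : Exec p s t s') (hl : Exec (.loop a p) s' t' s'') :
      Exec (.loop a p) s (t + t' + 1) s''

/-- The initial state on the input word `w`: `R[0]` holds the length of `w`, the cell `M[i]` holds
the `i`-th bit of `w`, and everything else is `0`. -/
def initState (w : List Bool) : State where
  reg i := if i = 0 then w.length else 0
  mem i := (w.getD i false).toNat

/-- The decision problem with instances `α`, encoded as binary words by `enc`, and yes-instances
`Yes`, is solvable in polynomial time on the instances that satisfy `Class`: one program, on each
such instance, halts after a number of steps that is polynomial in the length of the encoding, with
the answer (`1` for yes, `0` for no) in `R[0]`. -/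
def PolyTimeSolvableOn {α : Type} (enc : α → List Bool) (Class Yes : α → Prop) : Prop :=
  ∃ (prog : Prog) (bound : Polynomial ℕ), ∀ x : α, Class x →
    ∃ (t : ℕ) (s : State), Exec prog (initState (enc x)) t s ∧
      t ≤ bound.eval (enc x).length ∧
      (Yes x → s.reg 0 = 1) ∧ (¬ Yes x → s.reg 0 = 0)

/-! ### Steiner forests and deletion sets -/

/-- A subgraph `F` of `G` is a Steiner forest for the set `S` of terminal pairs if the two vertices
of each pair lie in the same connected component of `F`. -/
def IsSteinerForest {V : Type} {G : SimpleGraph V} (S : Finset (V × V)) (F : G.Subgraph) : Prop :=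
  ∀ p ∈ S, ∃ (hs : p.1 ∈ F.verts) (ht : p.2 ∈ F.verts), F.coe.Reachable ⟨p.1, hs⟩ ⟨p.2, ht⟩

/-- `T` is a `c`-deletion set of `G` if each connected component of `G - T` has at most `c`
vertices. -/
def IsDeletionSet {V : Type} (G : SimpleGraph V) (c : ℕ) (T : Finset V) : Prop :=
  ∀ C : (G.induce {v | v ∉ T}).ConnectedComponent, C.supp.encard ≤ c

/-- An instance of the Steiner Forest problem: a finite graph, a set of terminal pairs, and an
integer. -/
structure Inst : Type where
  n : ℕ
  G : SimpleGraph (Fin n)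
  S : Finset (Fin n × Fin n)
  k : ℤ

/-- The question of the Steiner Forest problem: is there a Steiner forest with at most `k` edges? -/
def Inst.Yes (I : Inst) : Prop :=
  ∃ F : I.G.Subgraph, IsSteinerForest I.S F ∧ (F.edgeSet.ncard : ℤ) ≤ I.k

open Classical in
/-- The `n × n` Boolean matrix of a relation on `Fin n`, row by row. -/
noncomputable def matrixBits {n : ℕ} (r : Fin n → Fin n → Prop) : List Bool :=
  (List.finRange n).flatMap fun i => (List.finRange n).map fun j => decide (r i j)

/-- The encoding of an instance as a binary word: `n` ones and a zero, the adjacency matrix, the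
matrix of the set of terminal pairs, the sign of `k`, and `|k|` in binary. -/
noncomputable def Inst.encode (I : Inst) : List Bool :=
  List.replicate I.n true ++ [false] ++ matrixBits I.G.Adj ++
    matrixBits (fun i j => (i, j) ∈ I.S) ++ [decide (I.k < 0)] ++ I.k.natAbs.bits

end SteinerForest

/-!
Let `{u, v}` be the deletion set, so that every component of `G - {u, v}` is a vertex or a pair of
mates.  A vertex has to be connected to `u` or `v` if it forms a terminal pair with a vertex other
than its mate, or with its mate if the latter forms another such pair.  Charge every vertex that a
Steiner forest connects to `u` or `v` with the first edge of a path there through its own component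
of `G - {u, v}`, and every other terminal pair of mates with its edge.  These edges are different,
and conversely such edges form a Steiner forest.

If `u` and `v` lie in the same component, then one edge of a path `u, a, b, v` remains uncharged,
and a minimum is found by trying all `a` and `b`.  Otherwise each vertex that has to be connected to
`u` or `v` has to choose a side.  Impossible choices are arcs of large capacity, and a choice that
requires the mate as an additional vertex is an arc of capacity one, so the number of additional
vertices is the capacity of a minimum cut between `u` and `v`.

The algorithm is written in a language of array programs whose only loops run as often as the input
is long, so that compiled programs halt in polynomial time.
-/

namespace SteinerForest

open Finset

/-! ### A language of array programs -/

/-- Expressions over array variables and scalar variables; `size` is the length of the input, which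
also bounds the range of every sum. -/
inductive Exp : Type
  | var (x : ℕ) : Exp
  | num (c : ℕ) : Exp
  | size : Exp
  | add (a b : Exp) : Exp
  | sub (a b : Exp) : Exp
  | cond (c a b : Exp) : Exp
  | arr (k : ℕ) (i j : Exp) : Exp
  | sum (x : ℕ) (e : Exp) : Exp

/-- The contents of the two-dimensional arrays: `A k i j` is the entry `(i, j)` of the array `k`. -/
abbrev Arrays := ℕ → ℕ → ℕ → ℕ

/-- The value of an expression, for inputs of length `N`. -/
def Exp.eval (N : ℕ) (A : Arrays) : Exp → (ℕ → ℕ) → ℕ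
  | .var x, v => v x
  | .num c, _ => c
  | .size, _ => N
  | .add a b, v => a.eval N A v + b.eval N A v
  | .sub a b, v => a.eval N A v - b.eval N A v
  | .cond c a b, v => if c.eval N A v ≠ 0 then a.eval N A v else b.eval N A v
  | .arr k i j, v => A k (i.eval N A v) (j.eval N A v)
  | .sum x e, v => ∑ i ∈ range N, e.eval N A (Function.update v x i)

/-- The arrays that an expression reads. -/
def Exp.reads : Exp → Finset ℕ
  | .var _ => ∅
  | .num _ => ∅
  | .size => ∅
  | .add a b => a.reads ∪ b.reads
  | .sub a b => a.reads ∪ b.reads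
  | .cond c a b => c.reads ∪ (a.reads ∪ b.reads)
  | .arr k i j => insert k (i.reads ∪ j.reads)
  | .sum _ e => e.reads

theorem Exp.eval_congr {N : ℕ} {A B : Arrays} {e : Exp} (h : ∀ k ∈ e.reads, A k = B k)
    (v : ℕ → ℕ) : e.eval N A v = e.eval N B v := by
  induction e generalizing v <;> simp_all [eval, reads]

/-- Array programs: `tab k e` fills the array `k` with the values of `e` as a function of the
variables `0` and `1`, and `rep p` runs `p` as often as the input is long. -/
inductive Stm : Type
  | tab (k : ℕ) (e : Exp) : Stm
  | seq (p q : Stm) : Stm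
  | rep (p : Stm) : Stm

/-- The valuation `0 ↦ i, 1 ↦ j`. -/
def env (i j : ℕ) : ℕ → ℕ := Function.update (Function.update 0 0 i) 1 j

/-- The effect of an array program, for inputs of length `N`. -/
def Stm.run (N : ℕ) : Stm → Arrays → Arrays
  | .tab k e, A => Function.update A k fun i j => if i < N ∧ j < N then e.eval N A (env i j) else 0
  | .seq p q, A => q.run N (p.run N A)
  | .rep p, A => (p.run N)^[N] A

/-- No array is read while it is being filled. -/
def Stm.WF : Stm → Prop
  | .tab k e => k ∉ e.reads
  | .seq p q => p.WF ∧ q.WF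
  | .rep p => p.WF

instance Stm.decidableWF : (p : Stm) → Decidable p.WF
  | .tab k e => inferInstanceAs (Decidable (k ∉ e.reads))
  | .seq p q => @instDecidableAnd _ _ p.decidableWF q.decidableWF
  | .rep p => p.decidableWF

/-! ### The random access machine as a stack machine -/

theorem State.setReg_reg (s : State) (d x r : ℕ) :
    (s.setReg d x).reg r = if r = d then x else s.reg r :=
  Function.update_apply s.reg d x r

/-- What the registers and the memory stand for while compiled code runs: a valuation of the
variables, a stack of intermediate results with its top first, and the arrays. -/
structure Config : Type where
  var : ℕ → ℕ
  stack : List ℕ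
  arr : Arrays

/-- The register of a variable.  The register `0` is left to the length of the input. -/
abbrev varReg (x : ℕ) : ℕ := 2 * x + 1

/-- The register of the stack cell that has `d` cells below it. -/
abbrev stackReg (d : ℕ) : ℕ := 2 * d + 2

/-- The registers hold the stack. -/
def StackRep (reg : ℕ → ℕ) : List ℕ → Prop
  | [] => True
  | a :: σ => reg (stackReg σ.length) = a ∧ StackRep reg σ

/-- The memory holds the arrays, row by row and one after the other; they vanish outside of the
range of their indices. -/
structure ArraysRep (N : ℕ) (A : Arrays) (mem : ℕ → ℕ) : Prop where
  mem_eq : ∀ {k i j}, i < N → j < N → mem ((k * N + i) * N + j) = A k i j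
  eq_zero : ∀ {k i j}, ¬ (i < N ∧ j < N) → A k i j = 0

/-- The machine state `s` stands for the configuration `c`. -/
structure Config.Rep (N : ℕ) (c : Config) (s : State) : Prop where
  size : s.reg 0 = N
  var : ∀ x, s.reg (varReg x) = c.var x
  stack : StackRep s.reg c.stack
  arr : ArraysRep N c.arr s.mem

/-- Started in the configuration `c`, the program `p` halts after at most `B` steps in the
configuration `c'`. -/
def Reaches (N : ℕ) (p : Prog) (B : ℕ) (c c' : Config) : Prop :=
  ∀ s, c.Rep N s → ∃ t ≤ B, ∃ final, Exec p s t final ∧ c'.Rep N final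

/-- Replace the entry `(i, j)` of the array `k` by `x`. -/
def Arrays.set (A : Arrays) (k i j x : ℕ) : Arrays :=
  fun l a b => if l = k ∧ a = i ∧ b = j then x else A l a b

theorem address_injective {N k l i i' j j' : ℕ} (hi : i < N) (hi' : i' < N) (hj : j < N)
    (hj' : j' < N) (h : (k * N + i) * N + j = (l * N + i') * N + j') :
    k = l ∧ i = i' ∧ j = j' := by
  have digits {a b x y : ℕ} (hx : x < N) (hy : y < N) (hxy : a * N + x = b * N + y) :
      a = b ∧ x = y := by
    have hdiv (c z : ℕ) (hz : z < N) : (c * N + z) / N = c := by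
      rw [mul_comm, Nat.mul_add_div (by omega), Nat.div_eq_of_lt hz, add_zero]
    obtain rfl : a = b := by rw [← hdiv a x hx, hxy, hdiv b y hy]
    exact ⟨rfl, by omega⟩
  obtain ⟨hrow, rfl⟩ := digits hj hj' h
  obtain ⟨rfl, rfl⟩ := digits hi hi' hrow
  exact ⟨rfl, rfl, rfl⟩

theorem ArraysRep.set {N : ℕ} {A : Arrays} {mem : ℕ → ℕ} {k i j : ℕ} (h : ArraysRep N A mem)
    (hi : i < N) (hj : j < N) (x : ℕ) :
    ArraysRep N (A.set k i j x) (Function.update mem ((k * N + i) * N + j) x) := by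
  refine ⟨fun {l a b} ha hb => ?_, fun {l a b} hab => ?_⟩
  · rw [Arrays.set, Function.update_apply, h.mem_eq ha hb]
    refine if_congr ⟨address_injective ha hi hb hj, ?_⟩ rfl rfl
    rintro ⟨rfl, rfl, rfl⟩
    rfl
  · rw [Arrays.set, if_neg (by rintro ⟨-, rfl, rfl⟩; exact hab ⟨hi, hj⟩), h.eq_zero hab]

section Reg

variable {reg : ℕ → ℕ} {σ : List ℕ}

theorem StackRep.of_append {τ : List ℕ} (h : StackRep reg (τ ++ σ)) : StackRep reg σ := by
  induction τ with
  | nil => exact h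
  | cons a τ ih => exact ih h.2

theorem StackRep.update_of_forall_ne {r : ℕ} (hr : ∀ d < σ.length, r ≠ stackReg d)
    (h : StackRep reg σ) (x : ℕ) : StackRep (Function.update reg r x) σ := by
  induction σ with
  | nil => trivial
  | cons a σ ih =>
    refine ⟨?_, ih (fun d hd => hr d (Nat.lt_succ_of_lt hd)) h.2⟩
    rw [Function.update_of_ne (hr _ (Nat.lt_succ_self _)).symm, h.1]

theorem StackRep.replace {τ : List ℕ} {a : ℕ} (h : StackRep reg (τ ++ a :: σ)) (x : ℕ) :
    StackRep (Function.update reg (stackReg σ.length) x) (τ ++ x :: σ) := by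
  induction τ with
  | nil => exact ⟨Function.update_self .., h.2.update_of_forall_ne (by grind) x⟩
  | cons b τ ih =>
    have hlen : (τ ++ x :: σ).length = (τ ++ a :: σ).length := by simp
    have hne : stackReg (τ ++ a :: σ).length ≠ stackReg σ.length := by
      grind
    exact ⟨(congrArg _ (congrArg stackReg hlen)).trans ((Function.update_of_ne hne ..).trans h.1),
      ih h.2⟩

end Reg

section Reaches

variable {N : ℕ} {v : ℕ → ℕ} {σ τ : List ℕ} {A : Arrays} {s : State} {p q : Prog} {B C : ℕ}
  {c c' c'' : Config}

theorem Config.Rep.of_append (h : Config.Rep N ⟨v, τ ++ σ, A⟩ s) : Config.Rep N ⟨v, σ, A⟩ s :=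
  ⟨h.size, h.var, h.stack.of_append, h.arr⟩

theorem Config.Rep.replace {a : ℕ} (h : Config.Rep N ⟨v, τ ++ a :: σ, A⟩ s) (x : ℕ) :
    Config.Rep N ⟨v, τ ++ x :: σ, A⟩ (s.setReg (stackReg σ.length) x) where
  size := by rw [State.setReg_reg, if_neg (by grind), h.size]
  var y := by rw [State.setReg_reg, if_neg (by grind), h.var y]
  stack := h.stack.replace x
  arr := h.arr

theorem Config.Rep.push (h : Config.Rep N ⟨v, τ ++ σ, A⟩ s) (x : ℕ) :
    Config.Rep N ⟨v, x :: σ, A⟩ (s.setReg (stackReg σ.length) x) where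
  size := by rw [State.setReg_reg, if_neg (by grind), h.size]
  var y := by rw [State.setReg_reg, if_neg (by grind), h.var y]
  stack := ⟨Function.update_self .., h.stack.of_append.update_of_forall_ne (by grind) x⟩
  arr := h.arr

theorem Config.Rep.setVar (h : Config.Rep N ⟨v, τ ++ σ, A⟩ s) (x y : ℕ) :
    Config.Rep N ⟨Function.update v x y, σ, A⟩ (s.setReg (varReg x) y) where
  size := by rw [State.setReg_reg, if_neg (by grind), h.size]
  var z := by
    have hz : varReg z = varReg x ↔ z = x := by grind
    simp only [State.setReg_reg, h.var z, Function.update_apply, hz]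
  stack := h.stack.of_append.update_of_forall_ne (by grind) y
  arr := h.arr

theorem Reaches.mono (h : Reaches N p B c c') (hBC : B ≤ C) : Reaches N p C c c' := fun s hs =>
  let ⟨t, ht, h'⟩ := h s hs
  ⟨t, ht.trans hBC, h'⟩

theorem Reaches.seq (hp : Reaches N p B c c') (hq : Reaches N q C c' c'') :
    Reaches N (.seq p q) (B + C) c c'' := fun s hs =>
  let ⟨t, ht, s', h, hs'⟩ := hp s hs
  let ⟨t', ht', s'', h', hs''⟩ := hq s' hs'
  ⟨t + t', Nat.add_le_add ht ht', s'', .seq h h', hs''⟩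

theorem Reaches.ite {a : ℕ} (hp : a ≠ 0 → Reaches N p B ⟨v, σ, A⟩ c)
    (hq : a = 0 → Reaches N q C ⟨v, σ, A⟩ c) :
    Reaches N (.ite (stackReg σ.length) p q) (B + C + 1) ⟨v, a :: σ, A⟩ c := fun s hs => by
  have ha : s.reg (stackReg σ.length) = a := hs.stack.1
  have hs' : Config.Rep N ⟨v, σ, A⟩ s := hs.of_append (τ := [a])
  by_cases h : a = 0
  · obtain ⟨t, ht, s', hx, hs'⟩ := hq h s hs'
    exact ⟨t + 1, by omega, s', .ite_false (ha.trans h) hx, hs'⟩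
  · obtain ⟨t, ht, s', hx, hs'⟩ := hp h s hs'
    exact ⟨t + 1, by omega, s', .ite_true (by rwa [ha]) hx, hs'⟩

theorem reaches_num (k : ℕ) :
    Reaches N (.const (stackReg σ.length) k) 1 ⟨v, σ, A⟩ ⟨v, k :: σ, A⟩ := fun _ hs =>
  ⟨1, le_rfl, _, .const .., hs.push (τ := []) k⟩

theorem reaches_size : Reaches N (.copy (stackReg σ.length) 0) 1 ⟨v, σ, A⟩ ⟨v, N :: σ, A⟩ :=
  fun s hs => ⟨1, le_rfl, _, .copy .., hs.size ▸ hs.push (τ := []) (s.reg 0)⟩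

theorem reaches_var (x : ℕ) :
    Reaches N (.copy (stackReg σ.length) (varReg x)) 1 ⟨v, σ, A⟩ ⟨v, v x :: σ, A⟩ := fun s hs =>
  ⟨1, le_rfl, _, .copy .., hs.var x ▸ hs.push (τ := []) (s.reg (varReg x))⟩

theorem reaches_add {a b : ℕ} :
    Reaches N (.plus (stackReg σ.length) (stackReg σ.length) (stackReg (σ.length + 1))) 1
      ⟨v, b :: a :: σ, A⟩ ⟨v, (a + b) :: σ, A⟩ := fun s hs => by
  obtain ⟨rfl, rfl, -⟩ := hs.stack
  exact ⟨1, le_rfl, _, .plus .., hs.push (τ := [_, _]) _⟩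

theorem reaches_sub {a b : ℕ} :
    Reaches N (.minus (stackReg σ.length) (stackReg σ.length) (stackReg (σ.length + 1))) 1
      ⟨v, b :: a :: σ, A⟩ ⟨v, (a - b) :: σ, A⟩ := fun s hs => by
  obtain ⟨rfl, rfl, -⟩ := hs.stack
  exact ⟨1, le_rfl, _, .minus .., hs.push (τ := [_, _]) _⟩

theorem reaches_addFourth {a b m n : ℕ} :
    Reaches N (.plus (stackReg σ.length) (stackReg σ.length) (stackReg (σ.length + 3))) 1
      ⟨v, b :: n :: m :: a :: σ, A⟩ ⟨v, n :: m :: (a + b) :: σ, A⟩ := fun s hs => by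
  obtain ⟨rfl, -, -, rfl, -⟩ := hs.stack
  exact ⟨1, le_rfl, _, .plus .., (hs.of_append (τ := [_])).replace (τ := [_, _]) _⟩

theorem reaches_load {k i j : ℕ} (hi : i < N) (hj : j < N) :
    Reaches N (.load (stackReg σ.length) (stackReg σ.length)) 1
      ⟨v, ((k * N + i) * N + j) :: σ, A⟩ ⟨v, A k i j :: σ, A⟩ := fun s hs => by
  have h := hs.push (τ := [_]) (s.mem (s.reg (stackReg σ.length)))
  rw [show s.reg (stackReg σ.length) = _ from hs.stack.1, hs.arr.mem_eq hi hj] at h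
  exact ⟨1, le_rfl, _, .load .., by rwa [hs.stack.1, hs.arr.mem_eq hi hj]⟩

theorem reaches_store {k i j x : ℕ} (hi : i < N) (hj : j < N) :
    Reaches N (.store (stackReg σ.length) (stackReg (σ.length + 1))) 1
      ⟨v, x :: ((k * N + i) * N + j) :: σ, A⟩ ⟨v, σ, A.set k i j x⟩ := fun s hs => by
  refine ⟨1, le_rfl, _, .store .., hs.size, hs.var, hs.stack.2.2, ?_⟩
  rw [show s.reg (stackReg (σ.length + 1)) = x from hs.stack.1, hs.stack.2.1]
  exact hs.arr.set hi hj x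

theorem reaches_pop {a : ℕ} (x : ℕ) :
    Reaches N (.copy (varReg x) (stackReg σ.length)) 1
      ⟨v, a :: σ, A⟩ ⟨Function.update v x a, σ, A⟩ := fun _ hs =>
  ⟨1, le_rfl, _, .copy .., hs.stack.1 ▸ hs.setVar (τ := [_]) x _⟩

theorem reaches_clear (x : ℕ) :
    Reaches N (.const (varReg x) 0) 1 ⟨v, σ, A⟩ ⟨Function.update v x 0, σ, A⟩ := fun _ hs =>
  ⟨1, le_rfl, _, .const .., hs.setVar (τ := []) x 0⟩

/-! ### Compilation -/

local infixr:65 ";;" => Prog.seq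

/-- Add one to a variable.  Here and below, the argument `d` of a piece of code is the height of the
stack when it starts. -/
def succCode (x d : ℕ) : Prog :=
  .const (stackReg d) 1 ;; .plus (varReg x) (varReg x) (stackReg d)

theorem reaches_succCode (x : ℕ) :
    Reaches N (succCode x σ.length) 2 ⟨v, σ, A⟩ ⟨Function.update v x (v x + 1), σ, A⟩ :=
  (reaches_num 1).seq fun _ hs =>
    ⟨1, le_rfl, _, .plus .., hs.stack.1 ▸ hs.var x ▸ hs.setVar (τ := [_]) x _⟩

/-- Run `p` as often as the input is long, with the counter on top of the stack. -/
def repCode (p : ℕ → Prog) (d : ℕ) : Prog :=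
  .copy (stackReg d) 0 ;; .loop (stackReg d) (p (d + 1) ;; .const (stackReg (d + 1)) 1 ;;
    .minus (stackReg d) (stackReg d) (stackReg (d + 1)))

theorem reaches_repCode {d : ℕ} {p : ℕ → Prog} {c : ℕ → Config}
    (hd : ∀ i, (c i).stack.length = d)
    (hp : ∀ i < N, ∀ n, Reaches N (p (d + 1)) B ⟨(c i).var, n :: (c i).stack, (c i).arr⟩
      ⟨(c (i + 1)).var, n :: (c (i + 1)).stack, (c (i + 1)).arr⟩) :
    Reaches N (repCode p d) (N * (B + 3) + 2) (c 0) (c N) := by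
  have loop : ∀ n i, i + n = N → Reaches N (.loop (stackReg d) (p (d + 1) ;;
      .const (stackReg (d + 1)) 1 ;; .minus (stackReg d) (stackReg d) (stackReg (d + 1))))
      (n * (B + 3) + 1) ⟨(c i).var, n :: (c i).stack, (c i).arr⟩ (c N) := by
    intro n
    induction n with
    | zero =>
      rintro i rfl s hs
      exact ⟨1, by omega, s, .loop_done (hd i ▸ hs.stack.1), hs.of_append (τ := [_])⟩
    | succ n ih =>
      intro i hi s hs
      have decr : Reaches N (.const (stackReg (d + 1)) 1 ;;
          .minus (stackReg d) (stackReg d) (stackReg (d + 1))) 2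
          ⟨(c (i + 1)).var, (n + 1) :: (c (i + 1)).stack, (c (i + 1)).arr⟩
          ⟨(c (i + 1)).var, n :: (c (i + 1)).stack, (c (i + 1)).arr⟩ := by
        rw [← hd (i + 1)]
        exact (reaches_num (σ := (n + 1) :: _) 1).seq reaches_sub
      obtain ⟨t, ht, s', hx, hs'⟩ := (hp i (by omega) (n + 1)).seq decr s hs
      obtain ⟨t', ht', s'', hx', hs''⟩ := ih (i + 1) (by omega) s' hs'
      have hne : s.reg (stackReg d) ≠ 0 := by
        rw [← hd i, hs.stack.1]
        omega
      exact ⟨t + t' + 1, by linarith, s'', .loop_step hne hx hx', hs''⟩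
  refine ((hd 0 ▸ reaches_size).seq (loop N 0 (zero_add N))).mono ?_
  omega

/-- Multiply the top of the stack by the length of the input. -/
def mulSizeCode (d : ℕ) : Prog :=
  .const (stackReg (d + 1)) 0 ;;
    repCode (fun _ => .plus (stackReg (d + 1)) (stackReg (d + 1)) (stackReg d)) (d + 2) ;;
    .copy (stackReg d) (stackReg (d + 1))

theorem reaches_mulSizeCode {a : ℕ} :
    Reaches N (mulSizeCode σ.length) (N * 4 + 4) ⟨v, a :: σ, A⟩ ⟨v, (a * N) :: σ, A⟩ := by
  have loop := reaches_repCode (N := N) (B := 1) (c := fun i => ⟨v, (a * i) :: a :: σ, A⟩)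
    (p := fun _ => .plus (stackReg (σ.length + 1)) (stackReg (σ.length + 1)) (stackReg σ.length))
    (fun _ => rfl) fun i _ n s hs => by
      obtain ⟨-, hprod, hfac, -⟩ := hs.stack
      refine ⟨1, le_rfl, _, .plus .., ?_⟩
      rw [hfac, show s.reg (stackReg (σ.length + 1)) = a * i from hprod]
      exact hs.replace (τ := [n]) (σ := a :: σ) (a * i + a)
  have move : Reaches N (.copy (stackReg σ.length) (stackReg (σ.length + 1))) 1
      ⟨v, (a * N) :: a :: σ, A⟩ ⟨v, (a * N) :: σ, A⟩ := fun _ hs =>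
    ⟨1, le_rfl, _, .copy .., hs.stack.1 ▸ hs.push (τ := [_, _]) _⟩
  exact ((reaches_num (σ := a :: σ) 0).seq (loop.seq move)).mono (by omega)

/-- The code `p` pushes the number `x` onto the stack in at most `B` steps. -/
def Pushes (N : ℕ) (p : ℕ → Prog) (B : ℕ) (v : ℕ → ℕ) (A : Arrays) (x : ℕ) : Prop :=
  ∀ σ : List ℕ, Reaches N (p σ.length) B ⟨v, σ, A⟩ ⟨v, x :: σ, A⟩

/-- Push the address of the entry `(i, j)` of the array `k`, where `p` pushes `i` and `q` pushes
`j`. -/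
def addressCode (k : ℕ) (p q : ℕ → Prog) (d : ℕ) : Prog :=
  .const (stackReg d) k ;; mulSizeCode d ;;
    p (d + 1) ;; .plus (stackReg d) (stackReg d) (stackReg (d + 1)) ;; mulSizeCode d ;;
    q (d + 1) ;; .plus (stackReg d) (stackReg d) (stackReg (d + 1))

theorem pushes_addressCode {p q : ℕ → Prog} {i j : ℕ} (k : ℕ) (hp : Pushes N p B v A i)
    (hq : Pushes N q C v A j) :
    Pushes N (addressCode k p q) (B + C + N * 8 + 11) v A ((k * N + i) * N + j) := fun σ =>
  ((reaches_num k).seq <| reaches_mulSizeCode.seq <| (hp (_ :: σ)).seq <| reaches_add.seq <|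
    reaches_mulSizeCode.seq <| (hq (_ :: σ)).seq reaches_add).mono (by omega)

/-- Push the entry `(i, j)` of the array `k`, where `p` pushes `i` and `q` pushes `j`, or `0` if an
index is out of range. -/
def arrCode (k : ℕ) (p q : ℕ → Prog) (d : ℕ) : Prog :=
  .copy (stackReg d) 0 ;; p (d + 1) ;; .minus (stackReg d) (stackReg d) (stackReg (d + 1)) ;;
    .ite (stackReg d)
      (.copy (stackReg d) 0 ;; q (d + 1) ;;
        .minus (stackReg d) (stackReg d) (stackReg (d + 1)) ;;
        .ite (stackReg d)
          (addressCode k p q d ;; .load (stackReg d) (stackReg d))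
          (.const (stackReg d) 0))
      (.const (stackReg d) 0)

/-- Push the sum over `x` of the numbers that `e` pushes, and restore the value of `x`. -/
def sumCode (x : ℕ) (e : ℕ → Prog) (d : ℕ) : Prog :=
  .const (stackReg d) 0 ;; .copy (stackReg (d + 1)) (varReg x) ;; .const (varReg x) 0 ;;
    repCode (fun _ => e (d + 3) ;; .plus (stackReg d) (stackReg d) (stackReg (d + 3)) ;;
      succCode x (d + 3)) (d + 2) ;;
    .copy (varReg x) (stackReg (d + 1))

/-- The code of an expression, which pushes its value onto the stack. -/
def Exp.code : Exp → ℕ → Prog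
  | .var x, d => .copy (stackReg d) (varReg x)
  | .num c, d => .const (stackReg d) c
  | .size, d => .copy (stackReg d) 0
  | .add a b, d =>
    a.code d ;; b.code (d + 1) ;; .plus (stackReg d) (stackReg d) (stackReg (d + 1))
  | .sub a b, d =>
    a.code d ;; b.code (d + 1) ;; .minus (stackReg d) (stackReg d) (stackReg (d + 1))
  | .cond c a b, d => c.code d ;; .ite (stackReg d) (a.code d) (b.code d)
  | .arr k i j, d => arrCode k i.code j.code d
  | .sum x e, d => sumCode x e.code d

/-- Fill the entry of the array `k` whose indices are the variables `0` and `1`, and move on to the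
next entry of its row. -/
def tabEntryCode (k : ℕ) (e : Exp) (d : ℕ) : Prog :=
  addressCode k (Exp.var 0).code (Exp.var 1).code d ;; e.code (d + 1) ;;
    .store (stackReg d) (stackReg (d + 1)) ;; succCode 1 d

/-- Fill the row of the array `k` whose index is the variable `0`, and move on to the next row. -/
def tabRowCode (k : ℕ) (e : Exp) (d : ℕ) : Prog :=
  repCode (tabEntryCode k e) d ;; .const (varReg 1) 0 ;; succCode 0 d

/-- The code of an array program. -/
def Stm.code : Stm → ℕ → Prog
  | .tab k e, d =>
    repCode (tabRowCode k e) d ;; .const (varReg 0) 0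
  | .seq p q, d => p.code d ;; q.code d
  | .rep p, d => repCode p.code d

theorem pushes_arr {p q : ℕ → Prog} {i j : ℕ} (k : ℕ) (hp : Pushes N p B v A i)
    (hq : Pushes N q C v A j) :
    Pushes N (arrCode k p q) (2 * B + 2 * C + N * 8 + 20) v A (A k i j) := by
  intro σ s hs
  suffices Reaches N (arrCode k p q σ.length) (2 * B + 2 * C + N * 8 + 20) ⟨v, σ, A⟩
    ⟨v, A k i j :: σ, A⟩ from this s hs
  have zero (h : ¬ (i < N ∧ j < N)) :
      Reaches N (.const (stackReg σ.length) 0) 1 ⟨v, σ, A⟩ ⟨v, A k i j :: σ, A⟩ := by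
    rw [show A k i j = 0 from hs.arr.eq_zero h]
    exact reaches_num 0
  refine (reaches_size.seq <| (hp (_ :: σ)).seq <| reaches_sub.seq <| .ite (fun hi =>
    reaches_size.seq <| (hq (_ :: σ)).seq <| reaches_sub.seq <| .ite (fun hj =>
      (pushes_addressCode k hp hq σ).seq <| reaches_load (by omega) (by omega))
      fun hj => zero (by omega)) fun hi => zero (by omega)).mono (by omega)

theorem pushes_sum {e : ℕ → Prog} {f : ℕ → ℕ} (x : ℕ)
    (he : ∀ i, Pushes N e B (Function.update v x i) A (f i)) :
    Pushes N (sumCode x e) (N * (B + 6) + 6) v A (∑ i ∈ range N, f i) := by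
  intro σ
  have loop := reaches_repCode (N := N) (B := B + 3) (d := σ.length + 2)
    (c := fun i => ⟨Function.update v x i, v x :: (∑ j ∈ range i, f j) :: σ, A⟩)
    (p := fun _ => e (σ.length + 3) ;;
      .plus (stackReg σ.length) (stackReg σ.length) (stackReg (σ.length + 3)) ;;
      succCode x (σ.length + 3))
    (fun _ => rfl) fun i _ n => by
      have incr := reaches_succCode (N := N) (v := Function.update v x i) (A := A)
        (σ := n :: v x :: (∑ j ∈ range i, f j + f i) :: σ) x
      rw [Function.update_self, Function.update_idem] at incr
      simpa only [sum_range_succ, List.length_cons] using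
        (he i (n :: v x :: (∑ j ∈ range i, f j) :: σ)).seq (reaches_addFourth.seq incr)
  have restore := reaches_pop (N := N) (v := Function.update v x N) (A := A) (a := v x)
    (σ := (∑ j ∈ range N, f j) :: σ) x
  rw [Function.update_idem, Function.update_eq_self] at restore
  exact ((reaches_num 0).seq <| (reaches_var x).seq <| (reaches_clear x).seq <|
    loop.seq restore).mono (by lia)

theorem Exp.exists_pushes_code (e : Exp) : ∃ B : Polynomial ℕ, ∀ N v A,
    Pushes N e.code (B.eval N) v A (e.eval N A v) := by
  induction e with
  | var x => exact ⟨1, fun N v A σ => by simpa [eval, code] using reaches_var x⟩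
  | num c => exact ⟨1, fun N v A σ => by simpa [eval, code] using reaches_num c⟩
  | size => exact ⟨1, fun N v A σ => by simpa [eval, code] using reaches_size⟩
  | add a b iha ihb =>
    obtain ⟨⟨B, ha⟩, C, hb⟩ := And.intro iha ihb
    exact ⟨B + (C + 1), fun N v A σ => by
      simpa [eval, code] using (ha N v A σ).seq ((hb N v A (_ :: σ)).seq reaches_add)⟩
  | sub a b iha ihb =>
    obtain ⟨⟨B, ha⟩, C, hb⟩ := And.intro iha ihb
    exact ⟨B + (C + 1), fun N v A σ => by
      simpa [eval, code] using (ha N v A σ).seq ((hb N v A (_ :: σ)).seq reaches_sub)⟩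
  | cond c a b ihc iha ihb =>
    obtain ⟨⟨B, hc⟩, ⟨C, ha⟩, D, hb⟩ := And.intro ihc (And.intro iha ihb)
    refine ⟨B + (C + D + 1), fun N v A σ => ?_⟩
    have branch := Reaches.ite (a := c.eval N A v)
      (c := ⟨v, (if c.eval N A v ≠ 0 then a.eval N A v else b.eval N A v) :: σ, A⟩)
      (fun h => by simpa only [if_pos h] using ha N v A σ)
      (fun h => by simpa only [h, ne_eq, not_true_eq_false, if_false] using hb N v A σ)
    simpa [eval, code] using (hc N v A σ).seq branch
  | arr k i j ihi ihj =>
    obtain ⟨⟨B, hi⟩, C, hj⟩ := And.intro ihi ihj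
    exact ⟨2 * B + 2 * C + .X * 8 + 20, fun N v A => by
      simpa [eval, code] using pushes_arr k (hi N v A) (hj N v A)⟩
  | sum x e ih =>
    obtain ⟨B, he⟩ := ih
    exact ⟨.X * (B + 6) + 6, fun N v A => by
      simpa [eval, code] using pushes_sum x fun i => he N (Function.update v x i) A⟩

/-- The arrays while the entry `(i, j)` of the array `k` is about to be filled. -/
def partialTab (N : ℕ) (A : Arrays) (k : ℕ) (e : Exp) (i j : ℕ) : Arrays :=
  Function.update A k fun a b =>
    if a < N ∧ b < N then if a < i ∨ a = i ∧ b < j then e.eval N A (env a b) else A k a b else 0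

theorem partialTab_zero {mem : ℕ → ℕ} (hA : ArraysRep N A mem) (k : ℕ) (e : Exp) :
    partialTab N A k e 0 0 = A := by
  refine Function.update_eq_self_iff.2 (funext₂ fun a b => ?_)
  by_cases h : a < N ∧ b < N
  · simp [h]
  · simp [h, hA.eq_zero h]

theorem partialTab_row_end (k : ℕ) (e : Exp) (i : ℕ) :
    partialTab N A k e i N = partialTab N A k e (i + 1) 0 := by
  refine congrArg _ (funext₂ fun a b => ite_congr rfl (fun h => ?_) fun _ => rfl)
  exact if_congr (by omega) rfl rfl

theorem partialTab_end (k : ℕ) (e : Exp) :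
    partialTab N A k e N 0 = (Stm.tab k e).run N A := by
  refine congrArg _ (funext₂ fun a b => ite_congr rfl (fun h => ?_) fun _ => rfl)
  exact if_pos (.inl h.1)

theorem partialTab_set {k i j : ℕ} (hi : i < N) (hj : j < N) (e : Exp) :
    (partialTab N A k e i j).set k i j (e.eval N A (env i j)) = partialTab N A k e i (j + 1) := by
  funext l a b
  rcases eq_or_ne l k with rfl | hl
  · simp only [Arrays.set, partialTab, Function.update_self]
    grind
  · simp only [Arrays.set, partialTab, Function.update_of_ne hl, hl, false_and, if_false]

theorem Exp.eval_partialTab {k : ℕ} {e : Exp} (he : k ∉ e.reads) (i j : ℕ) :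
    e.eval N (partialTab N A k e i j) v = e.eval N A v :=
  eval_congr (fun _ hl => Function.update_of_ne (ne_of_mem_of_not_mem hl he) ..) v

theorem reaches_tabEntry {k i j : ℕ} {e : Exp} (he : k ∉ e.reads) (hi : i < N) (hj : j < N)
    (hB : Pushes N e.code B (env i j) (partialTab N A k e i j)
      (e.eval N (partialTab N A k e i j) (env i j))) :
    Reaches N (tabEntryCode k e σ.length) (B + N * 8 + 16)
      ⟨env i j, σ, partialTab N A k e i j⟩ ⟨env i (j + 1), σ, partialTab N A k e i (j + 1)⟩ := by
  rw [Exp.eval_partialTab he] at hB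
  have address : Pushes N (addressCode k (Exp.var 0).code (Exp.var 1).code) (1 + 1 + N * 8 + 11)
      (env i j) (partialTab N A k e i j) ((k * N + i) * N + j) :=
    pushes_addressCode k (fun _ => reaches_var 0) fun _ => reaches_var 1
  have store := reaches_store (v := env i j) (σ := σ) (A := partialTab N A k e i j) (k := k)
    (x := e.eval N A (env i j)) hi hj
  have incr : Reaches N (succCode 1 σ.length) 2 ⟨env i j, σ, partialTab N A k e i (j + 1)⟩
      ⟨env i (j + 1), σ, partialTab N A k e i (j + 1)⟩ := by
    simpa [env] using reaches_succCode (v := env i j) 1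
  rw [partialTab_set hi hj] at store
  exact ((address σ).seq <| (hB (_ :: σ)).seq <| store.seq incr).mono (by omega)

theorem reaches_tabRow {k i : ℕ} {e : Exp} (he : k ∉ e.reads) (hi : i < N)
    (hB : ∀ v A, Pushes N e.code B v A (e.eval N A v)) :
    Reaches N (tabRowCode k e σ.length) (N * (B + N * 8 + 19) + 5)
      ⟨env i 0, σ, partialTab N A k e i 0⟩ ⟨env (i + 1) 0, σ, partialTab N A k e (i + 1) 0⟩ := by
  have row := reaches_repCode (N := N) (c := fun j => ⟨env i j, σ, partialTab N A k e i j⟩)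
    (fun _ => rfl) fun j hj n => reaches_tabEntry (σ := n :: σ) he hi hj (hB _ _)
  have reset : Reaches N (.const (varReg 1) 0) 1 ⟨env i N, σ, partialTab N A k e i N⟩
      ⟨env i 0, σ, partialTab N A k e i N⟩ := by
    simpa [env] using reaches_clear (v := env i N) 1
  have incr : Reaches N (succCode 0 σ.length) 2 ⟨env i 0, σ, partialTab N A k e i N⟩
      ⟨env (i + 1) 0, σ, partialTab N A k e i N⟩ := by
    simpa [env, Function.update_comm] using reaches_succCode (v := env i 0) 0
  rw [← partialTab_row_end]
  exact (row.seq <| reset.seq incr).mono (by lia)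

theorem reaches_tab {k : ℕ} {e : Exp} (he : k ∉ e.reads)
    (hB : ∀ v A, Pushes N e.code B v A (e.eval N A v)) :
    Reaches N ((Stm.tab k e).code σ.length) (N * (N * (B + N * 8 + 19) + 8) + 3)
      ⟨0, σ, A⟩ ⟨0, σ, (Stm.tab k e).run N A⟩ := by
  intro s hs
  have rows := reaches_repCode (N := N) (c := fun i => ⟨env i 0, σ, partialTab N A k e i 0⟩)
    (fun _ => rfl) fun i hi n => reaches_tabRow (σ := n :: σ) he hi hB
  have reset : Reaches N (.const (varReg 0) 0) 1 ⟨env N 0, σ, partialTab N A k e N 0⟩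
      ⟨0, σ, partialTab N A k e N 0⟩ := by
    simpa [env, Function.update_comm] using reaches_clear (v := env N 0) 0
  have total := (rows.seq reset).mono (C := N * (N * (B + N * 8 + 19) + 8) + 3) (by lia)
  have env_zero : env 0 0 = 0 := by simp [env]
  rw [partialTab_end, partialTab_zero hs.arr, env_zero] at total
  exact total s hs

theorem Stm.exists_reaches_code (p : Stm) (hp : p.WF) : ∃ B : Polynomial ℕ, ∀ N σ A,
    Reaches N (p.code σ.length) (B.eval N) ⟨0, σ, A⟩ ⟨0, σ, p.run N A⟩ := by
  induction p with
  | tab k e =>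
    obtain ⟨B, hB⟩ := e.exists_pushes_code
    exact ⟨.X * (.X * (B + .X * 8 + 19) + 8) + 3, fun N σ A => by
      simpa using reaches_tab hp (hB N)⟩
  | seq p q ihp ihq =>
    obtain ⟨⟨B, hB⟩, C, hC⟩ := And.intro (ihp hp.1) (ihq hp.2)
    exact ⟨B + C, fun N σ A => by simpa [run, code] using (hB N σ A).seq (hC N σ _)⟩
  | rep p ih =>
    obtain ⟨B, hB⟩ := ih hp
    refine ⟨.X * (B + 3) + 2, fun N σ A => ?_⟩
    have loop := reaches_repCode (N := N) (c := fun i => ⟨0, σ, (p.run N)^[i] A⟩)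
      (fun _ => rfl) fun i _ n => Function.iterate_succ_apply' (p.run N) i A ▸ hB N (n :: σ) _
    simpa [run, code] using loop

end Reaches

/-- The arrays that hold the input word, in the row `0` of the array `0`. -/
def inputArrays (w : List Bool) : Arrays := fun k i j =>
  if k = 0 ∧ i = 0 then (w.getD j false).toNat else 0

theorem arraysRep_inputArrays (w : List Bool) :
    ArraysRep w.length (inputArrays w) (initState w).mem where
  mem_eq {k i j} hi _ := by
    by_cases hk : k = 0 ∧ i = 0
    · obtain ⟨rfl, rfl⟩ := hk
      simp [inputArrays, initState]
    · have hrow : 1 ≤ k * w.length + i := by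
        rcases Nat.eq_zero_or_pos i with rfl | h
        · exact Nat.mul_pos (by omega) hi
        · omega
      have hlen := Nat.mul_le_mul_right w.length hrow
      have hout : w.length ≤ (k * w.length + i) * w.length + j := by omega
      simp only [inputArrays, hk, if_false, initState, List.getD_eq_default _ _ hout,
        Bool.toNat_false]
  eq_zero {k i j} h := by
    by_cases hk : k = 0 ∧ i = 0
    · have hj : w.length ≤ j := by
        have := hk.2
        omega
      rw [inputArrays, if_pos hk, List.getD_eq_default _ _ hj, Bool.toNat_false]
    · exact if_neg hk

theorem config_rep_initState (w : List Bool) :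
    Config.Rep w.length ⟨0, [], inputArrays w⟩ (initState w) where
  size := rfl
  var x := by simp [initState, varReg]
  stack := trivial
  arr := arraysRep_inputArrays w

theorem PolyTimeSolvableOn.of_stm {α : Type} {enc : α → List Bool} {Class Yes : α → Prop}
    (p : Stm) (hp : p.WF) (k : ℕ)
    (h : ∀ x, Class x → (Yes x → p.run (enc x).length (inputArrays (enc x)) k 0 0 = 1) ∧
      (¬ Yes x → p.run (enc x).length (inputArrays (enc x)) k 0 0 = 0)) :
    PolyTimeSolvableOn enc Class Yes := by
  obtain ⟨B, hB⟩ := p.exists_reaches_code hp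
  obtain ⟨C, hC⟩ := (Exp.arr k (.num 0) (.num 0)).exists_pushes_code
  refine ⟨.seq (.seq (p.code 0) ((Exp.arr k (.num 0) (.num 0)).code 0)) (.copy 0 (stackReg 0)),
    B + C + 1, fun x hx => ?_⟩
  obtain ⟨t, ht, s, hs, hrep⟩ :=
    ((hB _ [] _).seq (hC _ _ _ [])) _ (config_rep_initState (enc x))
  have answer : (s.setReg 0 (s.reg (stackReg 0))).reg 0 =
      p.run (enc x).length (inputArrays (enc x)) k 0 0 := by
    rw [State.setReg_reg, if_pos rfl]
    exact hrep.stack.1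
  refine ⟨t + 1, _, .seq hs (.copy ..), ?_, ?_⟩
  · simpa using ht
  · simpa only [answer] using h x hx

/-! ### Truth values, cardinalities and minima as numbers -/

open Classical in
/-- The truth value of a proposition as a number. -/
noncomputable def truth (p : Prop) : ℕ := if p then 1 else 0

theorem truth_of {p : Prop} (h : p) : truth p = 1 := if_pos h

theorem truth_of_not {p : Prop} (h : ¬ p) : truth p = 0 := if_neg h

@[simp] theorem truth_eq_zero {p : Prop} : truth p = 0 ↔ ¬ p := by
  by_cases h : p <;> simp [truth, h]

@[simp high] theorem truth_ne_zero {p : Prop} : truth p ≠ 0 ↔ p := truth_eq_zero.not_left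

theorem truth_eq_ite (p : Prop) [Decidable p] : truth p = if p then 1 else 0 := by
  by_cases h : p <;> simp [truth, h]

open Classical in
/-- The number of elements of `range N` with the property `Q`. -/
noncomputable def count (N : ℕ) (Q : ℕ → Prop) : ℕ := #{x ∈ range N | Q x}

theorem sum_truth (N : ℕ) (Q : ℕ → Prop) : ∑ x ∈ range N, truth (Q x) = count N Q := by
  classical
  simp only [count, card_filter, truth_eq_ite]

/-- The least number below `N` with the property `Q`, and `N` if there is none. -/
noncomputable def leastBelow (N : ℕ) (Q : ℕ → Prop) : ℕ := sInf {x | Q x ∨ x = N}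

section LeastBelow

variable {N m : ℕ} {Q : ℕ → Prop}

theorem leastBelow_le : leastBelow N Q ≤ N := Nat.sInf_le (.inr rfl)

theorem not_of_lt_leastBelow (h : m < leastBelow N Q) : ¬ Q m := fun hm =>
  Nat.notMem_of_lt_sInf h (.inl hm)

theorem leastBelow_spec (h : leastBelow N Q < N) : Q (leastBelow N Q) :=
  (Nat.sInf_mem (s := {x | Q x ∨ x = N}) ⟨N, .inr rfl⟩).resolve_right h.ne

theorem leastBelow_lt_iff : leastBelow N Q < N ↔ ∃ x < N, Q x :=
  ⟨fun h => ⟨_, h, leastBelow_spec h⟩, fun ⟨_, hx, hQ⟩ => (Nat.sInf_le (.inl hQ)).trans_lt hx⟩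

theorem leastBelow_eq (hm : m < N) (hQ : Q m) (hmin : ∀ x < m, ¬ Q x) : leastBelow N Q = m :=
  (Nat.sInf_le (.inl hQ)).antisymm <| le_of_not_gt fun h =>
    hmin _ h (leastBelow_spec (h.trans hm))

theorem sum_truth_forall_not (N : ℕ) (Q : ℕ → Prop) :
    ∑ x ∈ range N, truth (∀ y < N, y ≤ x → ¬ Q y) = leastBelow N Q := by
  classical
  have prefix_iff {x : ℕ} : (x < N ∧ ∀ y < N, y ≤ x → ¬ Q y) ↔ x < leastBelow N Q := by
    refine ⟨fun ⟨hx, h⟩ => lt_of_not_ge fun hle => ?_, fun hx => ⟨hx.trans_le leastBelow_le,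
      fun y _ hyx => not_of_lt_leastBelow (hyx.trans_lt hx)⟩⟩
    exact h _ (hle.trans_lt hx) hle (leastBelow_spec (hle.trans_lt hx))
  have hfilter : {x ∈ range N | ∀ y < N, y ≤ x → ¬ Q y} = range (leastBelow N Q) := by
    ext x
    rw [mem_filter, mem_range, mem_range, prefix_iff]
  simp only [truth_eq_ite, ← card_filter, hfilter, card_range]

end LeastBelow

/-! ### Minimum cuts -/

/-- The capacity of the cut `X` in the network on `range N` with the arc capacities `c`. -/
def cutCap (N : ℕ) (c : ℕ → ℕ → ℕ) (X : Finset ℕ) : ℕ := ∑ i ∈ X, ∑ j ∈ range N \ X, c i j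

/-- The vertex set `X` separates the source `s` from the sink `t` in a network on `range N`. -/
structure IsCut (N s t : ℕ) (X : Finset ℕ) : Prop where
  subset : X ⊆ range N
  source_mem : s ∈ X
  sink_notMem : t ∉ X

/-- The number `m` is the minimum capacity of a cut between `s` and `t`. -/
def IsMinCut (N s t : ℕ) (c : ℕ → ℕ → ℕ) (m : ℕ) : Prop :=
  IsLeast (cutCap N c '' {X | IsCut N s t X}) m

theorem cutCap_add (N : ℕ) (c d : ℕ → ℕ → ℕ) (X : Finset ℕ) :
    cutCap N (fun i j => c i j + d i j) X = cutCap N c X + cutCap N d X := by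
  simp only [cutCap, sum_add_distrib]

theorem cutCap_single {N a b : ℕ} (hb : b < N) (X : Finset ℕ) :
    cutCap N (fun i j => if i = a ∧ j = b then 1 else 0) X = if a ∈ X ∧ b ∉ X then 1 else 0 := by
  simp only [cutCap, ite_and, sum_ite_irrel, sum_ite_eq', mem_sdiff, mem_range, hb, true_and,
    sum_const_zero]

/-- The capacities after one unit of flow has been sent along the arc `(p, q)`. -/
def residual (c : ℕ → ℕ → ℕ) (p q : ℕ) : ℕ → ℕ → ℕ := fun i j =>
  c i j + (if i = q ∧ j = p then 1 else 0) - (if i = p ∧ j = q then 1 else 0)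

theorem cutCap_residual {N p q : ℕ} {c : ℕ → ℕ → ℕ} (hp : p < N) (hq : q < N) (hc : c p q ≠ 0)
    (X : Finset ℕ) :
    cutCap N (residual c p q) X + (if p ∈ X then 1 else 0) =
      cutCap N c X + if q ∈ X then 1 else 0 := by
  have hsub : (fun i j => residual c p q i j + if i = p ∧ j = q then 1 else 0) =
      fun i j => c i j + if i = q ∧ j = p then 1 else 0 := by
    funext i j
    grind [residual]
  have hcap := congrArg (cutCap N · X) hsub
  simp only [cutCap_add, cutCap_single hp, cutCap_single hq] at hcap
  grind

/-- The state of the augmenting path algorithm: residual capacities, lower bounds for the distances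
from the source, the position of a token that travels against the arcs from the sink to the source
and takes one unit of flow along, and the number of its travels. -/
@[ext] structure Flow : Type where
  cap : ℕ → ℕ → ℕ
  lab : ℕ → ℕ
  pos : ℕ
  cnt : ℕ

namespace Flow

/-- The vertex from which the token is to be reached by an arc that increases the label, or `N` if
there is none. -/
noncomputable def pred (N : ℕ) (f : Flow) : ℕ :=
  leastBelow N fun p => f.cap p f.pos ≠ 0 ∧ f.lab p < f.lab f.pos

/-- Take the token back to the sink. -/
def restart (t : ℕ) (f : Flow) : Flow := { f with pos := t, cnt := f.cnt + 1 }

/-- Move the token to `p`. -/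
def push (p : ℕ) (f : Flow) : Flow := { f with cap := residual f.cap p f.pos, pos := p }

/-- Increase the label of the position of the token. -/
def relabel (f : Flow) : Flow := { f with lab := Function.update f.lab f.pos (f.lab f.pos + 1) }

/-- One step of the algorithm. -/
noncomputable def step (N s t : ℕ) (f : Flow) : Flow :=
  if f.pos = s then f.restart t
  else if f.pred N < N then f.push (f.pred N)
  else if f.lab f.pos < N then f.relabel
  else f

/-- The invariant of the algorithm, started with the capacities `c`.  The token carries one unit of
flow with it. -/
structure Inv (N s t : ℕ) (c : ℕ → ℕ → ℕ) (f : Flow) : Prop where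
  pos_lt : f.pos < N
  lab_source : f.lab s = 0
  lab_le : ∀ x < N, f.lab x ≤ N
  lab_le_succ : ∀ p < N, ∀ x < N, f.cap p x ≠ 0 → f.lab x ≤ f.lab p + 1
  cut : ∀ X ⊆ range N, s ∈ X →
    cutCap N f.cap X + (if f.pos ∈ X then 1 else 0) + (if t ∈ X then 0 else f.cnt) =
      cutCap N c X + if t ∈ X then 1 else 0

/-- The algorithm has come to a halt. -/
def Done (N s : ℕ) (f : Flow) : Prop := f.pos ≠ s ∧ f.lab f.pos = N

/-- A quantity that decreases in every step. -/
def measure (N s : ℕ) (f : Flow) : ℕ :=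
  (N + 1) * (cutCap N f.cap {s} + if f.pos = s then 1 else 0) +
    2 * ∑ x ∈ range N, (N - f.lab x) + f.lab f.pos

variable {N s t p : ℕ} {c : ℕ → ℕ → ℕ} {f : Flow}

theorem Inv.restart (hf : f.Inv N s t c) (ht : t < N) (hpos : f.pos = s) :
    (f.restart t).Inv N s t c where
  pos_lt := ht
  lab_source := hf.lab_source
  lab_le := hf.lab_le
  lab_le_succ := hf.lab_le_succ
  cut X hX hs := by
    have := hf.cut X hX hs
    grind [Flow.restart]

theorem Inv.measure_restart_lt (hf : f.Inv N s t c) (ht : t < N) (hst : s ≠ t)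
    (hpos : f.pos = s) : (f.restart t).measure N s < f.measure N s := by
  have hlab : f.lab t ≤ N := hf.lab_le t ht
  simp only [measure, Flow.restart, hpos, hst.symm, hf.lab_source, if_true, if_false]
  linarith

theorem Inv.push (hf : f.Inv N s t c) (hp : p < N) (hcap : f.cap p f.pos ≠ 0)
    (hlab : f.lab p < f.lab f.pos) : (f.push p).Inv N s t c where
  pos_lt := hp
  lab_source := hf.lab_source
  lab_le := hf.lab_le
  lab_le_succ a ha x hx h := by
    have hle := hf.lab_le_succ a ha x hx
    simp only [Flow.push, residual] at h ⊢
    split_ifs at h <;> grind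
  cut X hX hs := by
    have hinv := hf.cut X hX hs
    have hres := cutCap_residual hp hf.pos_lt hcap X
    simp only [Flow.push]
    grind

theorem Inv.measure_push_lt (hf : f.Inv N s t c) (hp : p < N) (hcap : f.cap p f.pos ≠ 0)
    (hlab : f.lab p < f.lab f.pos) : (f.push p).measure N s < f.measure N s := by
  have hres : cutCap N (residual f.cap p f.pos) {s} + (if p = s then 1 else 0) =
      cutCap N f.cap {s} + if f.pos = s then 1 else 0 := by
    simpa using cutCap_residual hp hf.pos_lt hcap {s}
  calc (f.push p).measure N s
      = (N + 1) * (cutCap N (residual f.cap p f.pos) {s} + if p = s then 1 else 0) +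
          2 * ∑ x ∈ range N, (N - f.lab x) + f.lab p := rfl
    _ = (N + 1) * (cutCap N f.cap {s} + if f.pos = s then 1 else 0) +
          2 * ∑ x ∈ range N, (N - f.lab x) + f.lab p := by rw [hres]
    _ < f.measure N s := Nat.add_lt_add_left hlab _

theorem Inv.relabel (hf : f.Inv N s t c) (hpos : f.pos ≠ s) (hlab : f.lab f.pos < N)
    (hmin : ∀ p < N, f.cap p f.pos ≠ 0 → f.lab f.pos ≤ f.lab p) : f.relabel.Inv N s t c where
  pos_lt := hf.pos_lt
  lab_source := by simp [Flow.relabel, hpos.symm, hf.lab_source]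
  lab_le x hx := by
    have := hf.lab_le x hx
    simp only [Flow.relabel, Function.update_apply]
    grind
  lab_le_succ p hp x hx h := by
    have := hf.lab_le_succ p hp x hx h
    have := hmin p hp
    simp only [Flow.relabel, Function.update_apply] at h ⊢
    grind
  cut := hf.cut

theorem Inv.measure_relabel_lt (hf : f.Inv N s t c) (hlab : f.lab f.pos < N) :
    f.relabel.measure N s < f.measure N s := by
  have hsum : ∑ x ∈ range N, (N - f.relabel.lab x) < ∑ x ∈ range N, (N - f.lab x) := by
    refine sum_lt_sum (fun x _ => ?_) ⟨f.pos, mem_range.2 hf.pos_lt, ?_⟩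
    · simp only [Flow.relabel, Function.update_apply]
      grind
    · simp only [Flow.relabel, Function.update_self]
      omega
  have hlab' : f.relabel.lab f.pos = f.lab f.pos + 1 := Function.update_self ..
  simp only [measure]
  rw [show f.relabel.pos = f.pos from rfl, show f.relabel.cap = f.cap from rfl, hlab']
  omega

theorem Inv.step (ht : t < N) (hst : s ≠ t) (hf : f.Inv N s t c) :
    (f.step N s t).Inv N s t c ∧
      (f.Done N s ∧ f.step N s t = f ∨ (f.step N s t).measure N s < f.measure N s) := by
  unfold Flow.step
  split_ifs with hpos hpred hlab
  · exact ⟨hf.restart ht hpos, .inr (hf.measure_restart_lt ht hst hpos)⟩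
  · obtain ⟨hcap, hlt⟩ := leastBelow_spec hpred
    exact ⟨hf.push hpred hcap hlt, .inr (hf.measure_push_lt hpred hcap hlt)⟩
  · have hmin : ∀ p < N, f.cap p f.pos ≠ 0 → f.lab f.pos ≤ f.lab p := fun p hp hcap =>
      le_of_not_gt fun hlt => hpred (leastBelow_lt_iff.2 ⟨p, hp, hcap, hlt⟩)
    exact ⟨hf.relabel hpos hlab hmin, .inr (hf.measure_relabel_lt hlab)⟩
  · exact ⟨hf, .inl ⟨⟨hpos, (hf.lab_le _ hf.pos_lt).antisymm (not_lt.1 hlab)⟩, rfl⟩⟩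

theorem Inv.iterate_step (ht : t < N) (hst : s ≠ t) (m : ℕ) (hf : f.Inv N s t c)
    (hm : f.measure N s < m) :
    ((Flow.step N s t)^[m] f).Inv N s t c ∧ ((Flow.step N s t)^[m] f).Done N s := by
  induction m generalizing f with
  | zero => omega
  | succ m ih =>
    rw [Function.iterate_succ_apply]
    obtain ⟨hf', ⟨hdone, hfix⟩ | hlt⟩ := hf.step ht hst
    · rw [hfix, Function.iterate_fixed hfix]
      exact ⟨hf, hdone⟩
    · exact ih hf' (by omega)

/-- There are more values up to `N` than vertices. -/
theorem exists_le_forall_lab_ne (N : ℕ) (f : Flow) : ∃ g ≤ N, ∀ x < N, f.lab x ≠ g := by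
  have hcard : #((range N).image f.lab) < #(range (N + 1)) := by
    rw [card_range, Nat.lt_succ_iff]
    exact card_image_le.trans_eq (card_range N)
  obtain ⟨g, hg, hgN⟩ := exists_mem_notMem_of_card_lt_card hcard
  exact ⟨g, Nat.lt_succ_iff.1 (mem_range.1 hg), fun x hx h =>
    hgN (mem_image.2 ⟨x, mem_range.2 hx, h⟩)⟩

/-- No arc with a positive residual capacity jumps over a gap in the labels, so that the vertices
below a gap form a cut without residual capacity. -/
theorem Inv.exists_cutCap_eq_zero (hs : s < N) (hf : f.Inv N s t c) (hd : f.Done N s) :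
    ∃ X ⊆ range N, s ∈ X ∧ f.pos ∉ X ∧ cutCap N f.cap X = 0 := by
  obtain ⟨g, hgN, hg⟩ := exists_le_forall_lab_ne N f
  have hgs := hg s hs
  rw [hf.lab_source] at hgs
  refine ⟨{x ∈ range N | f.lab x < g}, filter_subset _ _, ?_, ?_, ?_⟩
  · rw [mem_filter, hf.lab_source]
    exact ⟨mem_range.2 hs, Nat.pos_of_ne_zero hgs.symm⟩
  · rw [mem_filter, hd.2]
    omega
  · refine sum_eq_zero fun i hi => sum_eq_zero fun j hj => ?_
    simp only [mem_filter, mem_sdiff, mem_range, not_and] at hi hj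
    by_contra hne
    have := hf.lab_le_succ i hi.1 j hj.1 hne
    have := hg j hj.1
    have := hj.2 hj.1
    omega

theorem Inv.isMinCut (hs : s < N) (hf : f.Inv N s t c) (hd : f.Done N s) :
    IsMinCut N s t c f.cnt := by
  constructor
  · obtain ⟨X, hX, hsX, hposX, hzero⟩ := hf.exists_cutCap_eq_zero hs hd
    have hcut := hf.cut X hX hsX
    rw [hzero, if_neg hposX] at hcut
    by_cases htX : t ∈ X
    · simp only [htX, if_true] at hcut
      omega
    · simp only [htX, if_false] at hcut
      exact ⟨X, ⟨hX, hsX, htX⟩, by omega⟩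
  · rintro _ ⟨X, ⟨hX, hsX, htX⟩, rfl⟩
    have hcut := hf.cut X hX hsX
    simp only [htX, if_false] at hcut
    omega

/-- The initial state of the algorithm. -/
def init (t : ℕ) (c : ℕ → ℕ → ℕ) : Flow := ⟨c, 0, t, 0⟩

theorem inv_init (ht : t < N) : (init t c).Inv N s t c where
  pos_lt := ht
  lab_source := rfl
  lab_le _ _ := Nat.zero_le _
  lab_le_succ _ _ _ _ _ := Nat.zero_le _
  cut X _ _ := by by_cases htX : t ∈ X <;> simp [init, htX]

theorem measure_init_lt (hs : s < N) (ht : t < N) (hst : s ≠ t)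
    (hc : ∀ i < N, ∀ j < N, c i j ≤ N) : (init t c).measure N s < N ^ 5 := by
  have hcut : cutCap N c {s} ≤ N * N := by
    rw [cutCap, sum_singleton]
    calc ∑ j ∈ range N \ {s}, c s j ≤ ∑ j ∈ range N, c s j := sum_le_sum_of_subset sdiff_subset
      _ ≤ ∑ _j ∈ range N, N := sum_le_sum fun j hj => hc s hs j (mem_range.1 hj)
      _ = N * N := by simp
  have hN : 2 ≤ N := by omega
  calc (init t c).measure N s = (N + 1) * cutCap N c {s} + 2 * (N * N) := by
        simp [measure, init, hst.symm]
    _ ≤ (N + 1) * (N * N) + 2 * (N * N) := by gcongr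
    _ = (N + 3) * N ^ 2 := by ring
    _ < N ^ 3 * N ^ 2 := by
        gcongr
        nlinarith [Nat.mul_le_mul hN hN]
    _ = N ^ 5 := by ring

theorem isMinCut_iterate_step (hs : s < N) (ht : t < N) (hst : s ≠ t)
    (hc : ∀ i < N, ∀ j < N, c i j ≤ N) :
    IsMinCut N s t c ((Flow.step N s t)^[N ^ 5] (init t c)).cnt :=
  let ⟨hinv, hdone⟩ := (inv_init ht).iterate_step ht hst (N ^ 5) (measure_init_lt hs ht hst hc)
  hinv.isMinCut hs hdone

end Flow

/-! ### Steiner forests and deletion sets -/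

/-- An instance of Steiner Forest without budget on the vertices below `N`, together with a
2-deletion set `{u, v}` of its graph.  That the components of `G - {u, v}` have at most two vertices
is encoded by `adj_unique`. -/
structure DeletionInst : Type where
  N : ℕ
  G : SimpleGraph ℕ
  P : ℕ → ℕ → Prop
  u : ℕ
  v : ℕ
  u_ne_v : u ≠ v
  u_lt : u < N
  v_lt : v < N
  adj_lt : ∀ x y, G.Adj x y → x < N
  pair_symm : ∀ x y, P x y → P y x
  pair_ne : ∀ x y, P x y → x ≠ y
  pair_lt : ∀ x y, P x y → x < N
  adj_unique : ∀ x y z, x ≠ u ∧ x ≠ v → y ≠ u ∧ y ≠ v → z ≠ u ∧ z ≠ v →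
    G.Adj x y → G.Adj x z → y = z

namespace DeletionInst

variable (S : DeletionInst)

/-- The Steiner forests of an instance. -/
structure IsForest (H : SimpleGraph ℕ) : Prop where
  le : H ≤ S.G
  reachable : ∀ x y, S.P x y → H.Reachable x y

/-- The vertices of `G - {u, v}`. -/
def Inner (x : ℕ) : Prop := x ≠ S.u ∧ x ≠ S.v

/-- `x` and `y` form a component of `G - {u, v}`. -/
def Mate (x y : ℕ) : Prop := S.Inner x ∧ S.Inner y ∧ S.G.Adj x y

/-- The mate of a vertex, and a junk value if there is none. -/
noncomputable def mate (x : ℕ) : ℕ := sInf {y | S.Mate x y}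

/-- `x` is paired with a vertex other than its mate. -/
def Outer (x : ℕ) : Prop := ∃ y, S.P x y ∧ ¬ S.Mate x y

/-- `x` has to be connected to `u` or `v` in every Steiner forest. -/
def Req (x : ℕ) : Prop :=
  S.Inner x ∧ (S.Outer x ∨ ∃ y, S.Mate x y ∧ S.P x y ∧ S.Outer y)

/-- `x` and `y` are paired mates that need not be connected to `u` or `v`. -/
def Detached (x y : ℕ) : Prop := S.P x y ∧ S.Mate x y ∧ ¬ S.Req x

/-- `x` is the smaller vertex of a detached pair. -/
def InnerPair (x : ℕ) : Prop := ∃ y, x < y ∧ S.Detached x y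

/-- `x` is connected to `w` by a path of `H` with inner vertices in the component of `x` in
`G - {u, v}`. -/
def AnchoredTo (H : SimpleGraph ℕ) (w x : ℕ) : Prop :=
  S.Inner x ∧ (H.Adj x w ∨ ∃ y, S.Mate x y ∧ H.Adj x y ∧ H.Adj y w)

/-- `x` is connected to `u` or `v` as in `AnchoredTo`. -/
def Anchored (H : SimpleGraph ℕ) (x : ℕ) : Prop :=
  S.AnchoredTo H S.u x ∨ S.AnchoredTo H S.v x

/-- A vertex to which `parentEdge` assigns an edge of its own: it is anchored or the smaller vertex
of an edge of `H - {u, v}`. -/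
def Charged (H : SimpleGraph ℕ) (x : ℕ) : Prop :=
  S.Anchored H x ∨ ∃ y, x < y ∧ S.Mate x y ∧ H.Adj x y

open Classical in
/-- The first edge on the way from `x` to `u` or `v`, or to the mate of `x`. -/
noncomputable def parentEdge (H : SimpleGraph ℕ) (x : ℕ) : Sym2 ℕ :=
  if H.Adj x S.u then s(x, S.u) else if H.Adj x S.v then s(x, S.v) else s(x, S.mate x)

variable {S} {H : SimpleGraph ℕ} {x y z w : ℕ}

theorem Mate.symm (h : S.Mate x y) : S.Mate y x := ⟨h.2.1, h.1, h.2.2.symm⟩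

theorem Mate.lt (h : S.Mate x y) : x < S.N := S.adj_lt _ _ h.2.2

theorem Mate.unique (hy : S.Mate x y) (hz : S.Mate x z) : y = z :=
  S.adj_unique x y z hy.1 hy.2.1 hz.2.1 hy.2.2 hz.2.2

theorem Mate.mate_eq (h : S.Mate x y) : S.mate x = y := by
  have hset : {z | S.Mate x z} = {y} :=
    Set.eq_singleton_iff_unique_mem.2 ⟨h, fun _ hz => hz.unique h⟩
  rw [mate, hset, csInf_singleton]

theorem Mate.req (h : S.Mate x y) (hp : S.P x y) (hx : S.Req x) : S.Req y := by
  obtain ⟨-, hx | ⟨z, hz, -, hout⟩⟩ := hx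
  · exact ⟨h.2.1, .inr ⟨x, h.symm, S.pair_symm _ _ hp, hx⟩⟩
  · exact ⟨h.2.1, .inl (h.unique hz ▸ hout)⟩

theorem Req.lt (h : S.Req x) : x < S.N := by
  obtain ⟨-, ⟨y, hp, -⟩ | ⟨y, -, hp, -⟩⟩ := h <;> exact S.pair_lt _ _ hp

theorem Detached.symm (h : S.Detached x y) : S.Detached y x :=
  have hp := S.pair_symm _ _ h.1
  ⟨hp, h.2.1.symm, fun hy => h.2.2 (h.2.1.symm.req hp hy)⟩

theorem eq_or_eq_or_req_of_pair (hp : S.P x y) (h : ¬ S.Detached x y) :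
    x = S.u ∨ x = S.v ∨ S.Req x := by
  by_cases hx : S.Inner x
  · by_cases hm : S.Mate x y
    · exact .inr (.inr (by_contra fun hr => h ⟨hp, hm, hr⟩))
    · exact .inr (.inr ⟨hx, .inl ⟨y, hp, hm⟩⟩)
  · rw [Inner] at hx
    tauto

theorem AnchoredTo.reachable (h : S.AnchoredTo H w x) : H.Reachable x w := by
  obtain ⟨-, h | ⟨y, -, hxy, hyw⟩⟩ := h
  · exact h.reachable
  · exact hxy.reachable.trans hyw.reachable

theorem AnchoredTo.mono (hH : H ≤ S.G) (h : S.AnchoredTo H w x) : S.AnchoredTo S.G w x :=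
  ⟨h.1, h.2.imp (@hH _ _) fun ⟨y, hm, hxy, hyw⟩ => ⟨y, hm, hH hxy, hH hyw⟩⟩

theorem AnchoredTo.of_adj (hm : S.Mate x y) (hxy : H.Adj x y) (h : S.AnchoredTo H w x) :
    S.AnchoredTo H w y := by
  obtain ⟨-, h | ⟨z, hz, -, h⟩⟩ := h
  · exact ⟨hm.2.1, .inr ⟨x, hm.symm, hxy.symm, h⟩⟩
  · exact ⟨hm.2.1, .inl (hz.unique hm ▸ h)⟩

theorem Anchored.mono (hH : H ≤ S.G) (h : S.Anchored H x) : S.Anchored S.G x :=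
  h.imp (.mono hH) (.mono hH)

theorem Anchored.of_adj (hm : S.Mate x y) (hxy : H.Adj x y) (h : S.Anchored H x) :
    S.Anchored H y :=
  h.imp (.of_adj hm hxy) (.of_adj hm hxy)

theorem mem_of_reachable {Y : Set ℕ} (hY : ∀ x y, x ∈ Y → H.Adj x y → y ∈ Y)
    (h : H.Reachable x y) (hx : x ∈ Y) : y ∈ Y := by
  obtain ⟨walk⟩ := h
  induction walk with
  | nil => exact hx
  | cons hadj _ ih => exact ih (hY _ _ hx hadj)

theorem mate_of_adj_of_not_anchored (hH : H ≤ S.G) (hx : S.Inner x) (hanc : ¬ S.Anchored H x)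
    (hxy : H.Adj x y) : S.Mate x y := by
  refine ⟨hx, ⟨?_, ?_⟩, hH hxy⟩
  · rintro rfl
    exact hanc (.inl ⟨hx, .inl hxy⟩)
  · rintro rfl
    exact hanc (.inr ⟨hx, .inl hxy⟩)

theorem eq_or_adj_of_not_anchored (hH : H ≤ S.G) (hx : S.Inner x) (hanc : ¬ S.Anchored H x)
    (h : H.Reachable x y) : y = x ∨ S.Mate x y ∧ H.Adj x y := by
  refine mem_of_reachable (Y := {y | y = x ∨ S.Mate x y ∧ H.Adj x y}) ?_ h (.inl rfl)
  rintro y z (rfl | ⟨hm, hxy⟩) hyz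
  · exact .inr ⟨mate_of_adj_of_not_anchored hH hx hanc hyz, hyz⟩
  · have hyanc : ¬ S.Anchored H y := fun hy => hanc (hy.of_adj hm.symm hxy.symm)
    exact .inl ((mate_of_adj_of_not_anchored hH hm.2.1 hyanc hyz).unique hm.symm)

theorem Req.anchored (hH : S.IsForest H) (hx : S.Req x) : S.Anchored H x := by
  by_contra hanc
  obtain ⟨hin, ⟨y, hp, hm⟩ | ⟨y, hm, hp, z, hpz, hmz⟩⟩ := hx
  · obtain rfl | ⟨hm', -⟩ := eq_or_adj_of_not_anchored hH.le hin hanc (hH.reachable _ _ hp)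
    · exact S.pair_ne _ _ hp rfl
    · exact hm hm'
  · have hxz := (hH.reachable _ _ hp).trans (hH.reachable _ _ hpz)
    obtain rfl | ⟨hm', -⟩ := eq_or_adj_of_not_anchored hH.le hin hanc hxz
    · exact hmz hm.symm
    · exact S.pair_ne _ _ hpz (hm.unique hm')

theorem Mate.adj_or_anchored (hH : S.IsForest H) (hm : S.Mate x y) (hp : S.P x y) :
    H.Adj x y ∨ S.Anchored H x := by
  by_contra! ⟨hxy, hanc⟩
  obtain rfl | ⟨-, hadj⟩ := eq_or_adj_of_not_anchored hH.le hm.1 hanc (hH.reachable _ _ hp)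
  · exact hm.2.2.ne rfl
  · exact hxy hadj

theorem Mate.anchored (hH : S.IsForest H) (hm : S.Mate x y) (hp : S.P x y)
    (hx : S.Anchored H x) : S.Anchored H y := by
  obtain hyx | hy := hm.symm.adj_or_anchored hH (S.pair_symm _ _ hp)
  · exact hx.of_adj hm hyx.symm
  · exact hy

/-! ### A lower bound for the number of edges -/

theorem Charged.inner (h : S.Charged H x) : S.Inner x := by
  obtain (h | h) | ⟨y, -, hm, -⟩ := h
  exacts [h.1, h.1, hm.1]

theorem Charged.parentEdge_cases (h : S.Charged H x) :
    S.parentEdge H x = s(x, S.u) ∧ H.Adj x S.u ∨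
      S.parentEdge H x = s(x, S.v) ∧ H.Adj x S.v ∧ ¬ H.Adj x S.u ∨
      ∃ y, S.parentEdge H x = s(x, y) ∧ S.Mate x y ∧ H.Adj x y ∧
        (H.Adj y S.u ∨ H.Adj y S.v ∨ x < y) ∧ ¬ H.Adj x S.u ∧ ¬ H.Adj x S.v := by
  by_cases hu : H.Adj x S.u
  · exact .inl ⟨if_pos hu, hu⟩
  by_cases hv : H.Adj x S.v
  · exact .inr (.inl ⟨by rw [parentEdge, if_neg hu, if_pos hv], hv, hu⟩)
  obtain ⟨y, hm, hxy, hy⟩ : ∃ y, S.Mate x y ∧ H.Adj x y ∧ (H.Adj y S.u ∨ H.Adj y S.v ∨ x < y) := by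
    obtain (⟨-, h | ⟨y, hm, hxy, hy⟩⟩ | ⟨-, h | ⟨y, hm, hxy, hy⟩⟩) | ⟨y, hlt, hm, hxy⟩ := h
    exacts [absurd h hu, ⟨y, hm, hxy, .inl hy⟩, absurd h hv, ⟨y, hm, hxy, .inr (.inl hy)⟩,
      ⟨y, hm, hxy, .inr (.inr hlt)⟩]
  exact .inr (.inr ⟨y, by rw [parentEdge, if_neg hu, if_neg hv, hm.mate_eq], hm, hxy, hy, hu, hv⟩)

theorem Charged.parentEdge_mem (h : S.Charged H x) : S.parentEdge H x ∈ H.edgeSet := by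
  obtain ⟨he, h⟩ | ⟨he, h, -⟩ | ⟨y, he, -, h, -⟩ := h.parentEdge_cases <;> rwa [he]

theorem parentEdge_injOn : Set.InjOn (S.parentEdge H) {x | S.Charged H x} := by
  intro x hx y hy heq
  have hxin := hx.inner
  have hyin := hy.inner
  obtain ⟨hx, -⟩ | ⟨hx, -⟩ | ⟨x', hx, hmx, -, hx', hxu, hxv⟩ := hx.parentEdge_cases <;>
    obtain ⟨hy, -⟩ | ⟨hy, -⟩ | ⟨y', hy, hmy, -, hy', hyu, hyv⟩ := hy.parentEdge_cases <;>
    rw [hx, hy, Sym2.eq_iff] at heq <;> grind [Inner, Mate]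

variable (S) in
/-- An edge of `H` that is not charged to a vertex by `parentEdge`. -/
def Spare (H : SimpleGraph ℕ) (e : Sym2 ℕ) : Prop :=
  e ∈ H.edgeSet ∧ ∀ x, S.Charged H x → S.parentEdge H x ≠ e

theorem IsForest.finite_edgeSet (hH : S.IsForest H) : H.edgeSet.Finite := by
  refine ((range S.N).sym2.finite_toSet).subset fun e he => ?_
  induction e with
  | h x y =>
    have hadj := hH.le he
    rw [mem_coe, mk_mem_sym2_iff, mem_range, mem_range]
    exact ⟨S.adj_lt _ _ hadj, S.adj_lt _ _ hadj.symm⟩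

theorem IsForest.card_le (hH : S.IsForest H) {Z : Finset ℕ} {X : Finset (Sym2 ℕ)}
    (hZ : ∀ x ∈ Z, S.Charged H x) (hX : ∀ e ∈ X, S.Spare H e) :
    #Z + #X ≤ H.edgeSet.ncard := by
  have hdisj : Disjoint (Z.image (S.parentEdge H)) X := by
    refine disjoint_left.2 fun e he heX => ?_
    obtain ⟨x, hx, rfl⟩ := mem_image.1 he
    exact (hX _ heX).2 x (hZ x hx) rfl
  have hsub : (↑(Z.image (S.parentEdge H) ∪ X) : Set (Sym2 ℕ)) ⊆ H.edgeSet := by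
    intro e he
    obtain he | he := mem_union.1 (mem_coe.1 he)
    · obtain ⟨x, hx, rfl⟩ := mem_image.1 he
      exact (hZ x hx).parentEdge_mem
    · exact (hX e he).1
  calc #Z + #X = #(Z.image (S.parentEdge H) ∪ X) := by
        rw [card_union_of_disjoint hdisj, card_image_of_injOn (parentEdge_injOn.mono hZ)]
    _ ≤ H.edgeSet.ncard := by
        rw [← Set.ncard_coe_finset]
        exact Set.ncard_le_ncard hsub hH.finite_edgeSet

theorem Mate.eq_of_lt (hx : S.Mate x y) (hxy : x < y) {x' y' : ℕ} (hx' : S.Mate x' y')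
    (hxy' : x' < y') (hz : z = x ∨ z = y) (hz' : z = x' ∨ z = y') : x = x' := by
  have hy : x = x' → y = y' := fun h => (h ▸ hx).unique hx'
  have hyx : y = y' → x = x' := fun h => (h ▸ hx.symm).unique hx'.symm
  have h₁ : x = y' → y = x' := fun h => (h ▸ hx).unique hx'.symm
  have h₂ : y = x' → x = y' := fun h => (h ▸ hx.symm).unique hx'
  omega

/-- For a pair that is anchored, the edge is the parent edge of its vertex `rep x`. -/
theorem IsForest.card_add_card_pairs_le (hH : S.IsForest H) {B D : Finset ℕ}
    {X : Finset (Sym2 ℕ)} (rep : ℕ → ℕ) (hB : ∀ x ∈ B, S.Anchored H x)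
    (hD : ∀ x ∈ D, ∃ y, x < y ∧ S.Mate x y ∧ S.P x y ∧ (rep x = x ∨ rep x = y) ∧ rep x ∉ B)
    (hX : ∀ e ∈ X, S.Spare H e) : #B + #D + #X ≤ H.edgeSet.ncard := by
  classical
  let top x := if S.Anchored H x then rep x else x
  have htop : ∀ x ∈ D, ∃ y, x < y ∧ S.Mate x y ∧ (top x = x ∨ top x = y) ∧
      S.Charged H (top x) ∧ top x ∉ B := by
    intro x hx
    obtain ⟨y, hxy, hm, hp, hrep, hrepB⟩ := hD x hx
    by_cases hanc : S.Anchored H x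
    · simp only [top, if_pos hanc]
      have hanc' : S.Anchored H (rep x) := by
        obtain h | h := hrep <;> rw [h]
        exacts [hanc, hm.anchored hH hp hanc]
      exact ⟨y, hxy, hm, hrep, .inl hanc', hrepB⟩
    · simp only [top, if_neg hanc]
      exact ⟨y, hxy, hm, .inl trivial, .inr ⟨y, hxy, hm, (hm.adj_or_anchored hH hp).resolve_right
        hanc⟩, fun hxB => hanc (hB x hxB)⟩
  have hinj : Set.InjOn top D := by
    intro x hx x' hx' heq
    obtain ⟨y, hxy, hm, htx, -⟩ := htop x hx
    obtain ⟨y', hxy', hm', htx', -⟩ := htop x' hx'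
    exact hm.eq_of_lt hxy hm' hxy' htx (heq ▸ htx')
  have hdisj : Disjoint B (D.image top) := by
    refine disjoint_right.2 fun z hz => ?_
    obtain ⟨x, hx, rfl⟩ := mem_image.1 hz
    obtain ⟨y, -, -, -, -, hxB⟩ := htop x hx
    exact hxB
  rw [← card_image_of_injOn hinj, ← card_union_of_disjoint hdisj]
  refine hH.card_le (fun z hz => ?_) hX
  obtain hz | hz := mem_union.1 hz
  · exact .inl (hB z hz)
  · obtain ⟨x, hx, rfl⟩ := mem_image.1 hz
    obtain ⟨y, -, -, -, hch, -⟩ := htop x hx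
    exact hch

/-! ### Steiner forests with few edges -/

theorem exists_le_edgeSet_eq {G : SimpleGraph ℕ} {E : Set (Sym2 ℕ)} (hE : E ⊆ G.edgeSet) :
    ∃ H ≤ G, H.edgeSet = E := by
  have hset : (SimpleGraph.fromEdgeSet E).edgeSet = E := by
    rw [SimpleGraph.edgeSet_fromEdgeSet, sdiff_eq_left, Set.disjoint_left]
    exact fun e he => G.not_isDiag_of_mem_edgeSet (hE he)
  refine ⟨_, ?_, hset⟩
  rwa [← SimpleGraph.edgeSet_subset_edgeSet, hset]

variable (S) in
/-- Each vertex `z` of `Z` is adjacent to `L z`, or its mate is an adjacent vertex of `Z` with the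
same value of `L`. -/
def Leads (L : ℕ → ℕ) (Z : Finset ℕ) : Prop :=
  ∀ z ∈ Z, S.G.Adj z (L z) ∨ ∃ y ∈ Z, S.Mate z y ∧ L y = L z ∧ S.G.Adj y (L y)

variable (S) in
open Classical in
/-- The first edge on the way from `z` to `L z`. -/
noncomputable def leadEdge (L : ℕ → ℕ) (z : ℕ) : Sym2 ℕ :=
  if S.G.Adj z (L z) then s(z, L z) else s(z, S.mate z)

theorem Leads.leadEdge_mem {L : ℕ → ℕ} {Z : Finset ℕ} (h : S.Leads L Z) (hz : z ∈ Z) :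
    S.leadEdge L z ∈ S.G.edgeSet := by
  by_cases hadj : S.G.Adj z (L z)
  · rwa [leadEdge, if_pos hadj]
  · obtain ⟨y, -, hm, -⟩ := (h z hz).resolve_left hadj
    rw [leadEdge, if_neg hadj, hm.mate_eq]
    exact hm.2.2

theorem Leads.reachable {L : ℕ → ℕ} {Z : Finset ℕ} (h : S.Leads L Z)
    (hH : ∀ z ∈ Z, S.leadEdge L z ∈ H.edgeSet) (hz : z ∈ Z) : H.Reachable z (L z) := by
  have hdirect : ∀ y ∈ Z, S.G.Adj y (L y) → H.Reachable y (L y) := by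
    intro y hy hadj
    have hedge := hH y hy
    rw [leadEdge, if_pos hadj] at hedge
    exact SimpleGraph.Adj.reachable hedge
  by_cases hadj : S.G.Adj z (L z)
  · exact hdirect z hz hadj
  · obtain ⟨y, hy, hm, hL, hyL⟩ := (h z hz).resolve_left hadj
    have hedge := hH z hz
    rw [leadEdge, if_neg hadj, hm.mate_eq] at hedge
    exact (SimpleGraph.Adj.reachable hedge).trans (hL ▸ hdirect y hy hyL)

theorem Leads.exists_subgraph {L : ℕ → ℕ} {Z D : Finset ℕ} {X : Finset (Sym2 ℕ)}
    (hZ : S.Leads L Z) (hD : ∀ x ∈ D, ∃ y, S.Mate x y) (hX : ∀ e ∈ X, e ∈ S.G.edgeSet) :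
    ∃ H ≤ S.G, H.edgeSet.ncard ≤ #Z + #D + #X ∧ (∀ z ∈ Z, H.Reachable z (L z)) ∧
      (∀ x ∈ D, ∀ y, S.Mate x y → H.Adj x y) ∧ ∀ e ∈ X, e ∈ H.edgeSet := by
  let E : Finset (Sym2 ℕ) := Z.image (S.leadEdge L) ∪ D.image (fun x => s(x, S.mate x)) ∪ X
  have hE : (E : Set (Sym2 ℕ)) ⊆ S.G.edgeSet := by
    intro e he
    simp only [E, mem_coe, mem_union, mem_image] at he
    obtain (⟨z, hz, rfl⟩ | ⟨x, hx, rfl⟩) | he := he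
    · exact hZ.leadEdge_mem hz
    · obtain ⟨y, hm⟩ := hD x hx
      rw [hm.mate_eq]
      exact hm.2.2
    · exact hX e he
  obtain ⟨H, hle, hedge⟩ := exists_le_edgeSet_eq hE
  have hmem : ∀ e, e ∈ H.edgeSet ↔ e ∈ E := fun e => by rw [hedge, mem_coe]
  refine ⟨H, hle, ?_, ?_, ?_, ?_⟩
  · rw [hedge, Set.ncard_coe_finset]
    calc #E ≤ #(Z.image (S.leadEdge L)) + #(D.image fun x => s(x, S.mate x)) + #X :=
          (card_union_le _ _).trans (Nat.add_le_add_right (card_union_le _ _) _)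
      _ ≤ #Z + #D + #X := by gcongr <;> exact card_image_le
  · refine fun z => hZ.reachable fun y hy => (hmem _).2 ?_
    exact mem_union_left _ (mem_union_left _ (mem_image_of_mem _ hy))
  · intro x hx y hm
    refine (hmem s(x, y)).2 (mem_union_left _ (mem_union_right _ (mem_image.2 ⟨x, hx, ?_⟩)))
    rw [hm.mate_eq]
  · exact fun e he => (hmem e).2 (mem_union_right _ he)

theorem reachable_of_forall_lt (h : ∀ x y, S.P x y → x < y → H.Reachable x y) (hp : S.P x y) :
    H.Reachable x y := by
  obtain hlt | hlt := (S.pair_ne _ _ hp).lt_or_gt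
  · exact h x y hp hlt
  · exact (h y x (S.pair_symm _ _ hp) hlt).symm

end DeletionInst

namespace DeletionInst

variable (S : DeletionInst)

/-! ### Steiner forests that connect the two vertices of the deletion set -/

/-- Every vertex that has to be connected to `u` or `v` can be. -/
def Attachable : Prop := ∀ x, S.Req x → S.Anchored S.G x

/-- `u, a, b, v` is a walk, up to repetitions. -/
def Bridge (a b : ℕ) : Prop :=
  (a = S.u ∨ S.G.Adj a S.u) ∧ (a = b ∨ S.Mate a b) ∧ S.G.Adj b S.v

/-- `x` is an inner vertex of the path given by `a` and `b`. -/
def OnBridge (a b x : ℕ) : Prop := x ≠ S.u ∧ (x = a ∨ x = b)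

/-- The vertex `y` has to be used to connect its mate. -/
def Helper (y : ℕ) : Prop :=
  ¬ S.Req y ∧ ∃ x, S.Mate y x ∧ S.Req x ∧ ¬ S.G.Adj x S.u ∧ ¬ S.G.Adj x S.v

/-- The vertices other than `u` and `v` of the component of `u` and `v`. -/
def JoinVert (a b x : ℕ) : Prop := S.Req x ∨ S.Helper x ∨ S.OnBridge a b x

/-- `x` is the smaller vertex of a pair of mates that is connected separately. -/
def JoinPair (a b x : ℕ) : Prop :=
  ∃ y, x < y ∧ S.Detached x y ∧ ¬ (S.OnBridge a b x ∧ S.OnBridge a b y)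

/-- The edge of a bridge that is not the parent edge of one of its vertices. -/
def bridgeEdge (a b : ℕ) : Sym2 ℕ := if a = b then s(b, S.v) else s(a, b)

variable {S} {H : SimpleGraph ℕ} {a b x y z : ℕ}

theorem Bridge.cases (h : S.Bridge a b) :
    a = S.u ∧ b = S.u ∧ S.G.Adj S.u S.v ∨ S.Inner a ∧ a = b ∧ S.G.Adj a S.u ∧ S.G.Adj a S.v ∨
      S.Mate a b ∧ S.G.Adj a S.u ∧ S.G.Adj b S.v := by
  obtain ⟨rfl | hau, rfl | hm, hbv⟩ := h
  exacts [.inl ⟨rfl, rfl, hbv⟩, absurd rfl hm.1.1, .inr (.inl ⟨⟨hau.ne, hbv.ne⟩, rfl, hau, hbv⟩),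
    .inr (.inr ⟨hm, hau, hbv⟩)]

theorem Bridge.left_lt (h : S.Bridge a b) : a < S.N := by
  obtain ⟨rfl | h, -, -⟩ := h
  exacts [S.u_lt, S.adj_lt _ _ h]

theorem Bridge.right_lt (h : S.Bridge a b) : b < S.N := S.adj_lt _ _ h.2.2

theorem Bridge.bridgeEdge_mem (h : S.Bridge a b) : S.bridgeEdge a b ∈ S.G.edgeSet := by
  by_cases hab : a = b
  · rw [bridgeEdge, if_pos hab]
    exact h.2.2
  · rw [bridgeEdge, if_neg hab]
    exact (h.2.1.resolve_left hab).2.2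

variable (S) in
/-- The bridge given by `a` and `b` is a walk in `H`. -/
def BridgeIn (H : SimpleGraph ℕ) (a b : ℕ) : Prop :=
  S.Bridge a b ∧ (a = S.u ∨ H.Adj a S.u) ∧ (a = b ∨ H.Adj a b) ∧ H.Adj b S.v

theorem exists_bridgeIn (hH : H ≤ S.G) (h : H.Reachable S.u S.v) : ∃ a b, S.BridgeIn H a b := by
  by_contra! hcon
  have hnot : S.v ∈ {x | x ≠ S.v ∧
      (x = S.u ∨ H.Adj x S.u ∨ ∃ z, S.Mate z x ∧ H.Adj z x ∧ H.Adj z S.u)} := by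
    refine mem_of_reachable ?_ h ⟨S.u_ne_v, .inl rfl⟩
    rintro x y ⟨hxv, hx⟩ hxy
    have hyv : y ≠ S.v := by
      rintro rfl
      obtain rfl | hx | ⟨z, hm, hzx, hz⟩ := hx
      · exact hcon S.u S.u ⟨⟨.inl rfl, .inl rfl, hH hxy⟩, .inl rfl, .inl rfl, hxy⟩
      · exact hcon x x ⟨⟨.inr (hH hx), .inl rfl, hH hxy⟩, .inr hx, .inl rfl, hxy⟩
      · exact hcon z x ⟨⟨.inr (hH hz), .inr hm, hH hxy⟩, .inr hz, .inr hzx, hxy⟩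
    refine ⟨hyv, ?_⟩
    by_cases hyu : y = S.u
    · exact .inl hyu
    obtain rfl | hx | ⟨z, hm, -, hz⟩ := hx
    · exact .inr (.inl hxy.symm)
    · exact .inr (.inr ⟨x, ⟨⟨hx.ne, hxv⟩, ⟨hyu, hyv⟩, hH hxy⟩, hxy, hx⟩)
    · exact .inr (.inl (hm.symm.unique ⟨hm.2.1, ⟨hyu, hyv⟩, hH hxy⟩ ▸ hz))
  exact hnot.1 rfl

theorem BridgeIn.anchored (h : S.BridgeIn H a b) (hx : S.OnBridge a b x) : S.Anchored H x := by
  obtain ⟨hbr, hau, hab, hbv⟩ := h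
  obtain ⟨hxu, rfl | rfl⟩ := hx
  · have hxu' := hau.resolve_left hxu
    obtain ⟨rfl, -⟩ | ⟨hin, -⟩ | ⟨hm, -⟩ := hbr.cases
    exacts [absurd rfl hxu, .inl ⟨hin, .inl hxu'⟩, .inl ⟨hm.1, .inl hxu'⟩]
  · exact .inr ⟨⟨hxu, hbv.ne⟩, .inl hbv⟩

theorem BridgeIn.spare_bridgeEdge (h : S.BridgeIn H a b) : S.Spare H (S.bridgeEdge a b) := by
  obtain ⟨hbr, hau, hab, hbv⟩ := h
  constructor
  · by_cases heq : a = b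
    · rwa [bridgeEdge, if_pos heq]
    · rw [bridgeEdge, if_neg heq]
      exact hab.resolve_left heq
  intro x hx
  have hin := hx.inner
  have huv := S.u_ne_v
  obtain ⟨rfl, rfl, -⟩ | ⟨ha, rfl, -⟩ | ⟨hm, -⟩ := hbr.cases
  · rw [bridgeEdge, if_pos rfl]
    obtain ⟨he, -⟩ | ⟨he, -⟩ | ⟨y, he, -⟩ := hx.parentEdge_cases <;>
      rw [he, Ne, Sym2.eq_iff] <;> grind [Inner]
  · rw [bridgeEdge, if_pos rfl]
    obtain ⟨he, -⟩ | ⟨he, -, hxu⟩ | ⟨y, he, -, -, -, hxu, -⟩ := hx.parentEdge_cases <;>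
      rw [he, Ne, Sym2.eq_iff] <;> grind [Inner, Mate]
  · rw [bridgeEdge, if_neg hm.2.2.ne]
    obtain ⟨he, -⟩ | ⟨he, -⟩ | ⟨y, he, -, -, -, hxu, hxv⟩ := hx.parentEdge_cases <;>
      rw [he, Ne, Sym2.eq_iff] <;> grind [Inner, Mate]

theorem JoinVert.anchored (hH : S.IsForest H) (hab : S.BridgeIn H a b) (hx : S.JoinVert a b x) :
    S.Anchored H x := by
  obtain hx | ⟨-, y, hm, hy, hyu, hyv⟩ | hx := hx
  · exact hx.anchored hH
  · have hyanc := hy.anchored hH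
    refine .of_adj hm.symm ?_ hyanc
    obtain ⟨-, h | ⟨z, hz, h, -⟩⟩ | ⟨-, h | ⟨z, hz, h, -⟩⟩ := hyanc
    exacts [absurd (hH.le h) hyu, hz.unique hm.symm ▸ h, absurd (hH.le h) hyv,
      hz.unique hm.symm ▸ h]
  · exact hab.anchored hx

theorem Detached.not_joinVert (h : S.Detached x y) (hx : ¬ S.OnBridge a b x) :
    ¬ S.JoinVert a b x := by
  rintro (hr | ⟨-, z, hm, hr, -⟩ | hon)
  exacts [h.2.2 hr, h.symm.2.2 (hm.unique h.2.1 ▸ hr), hx hon]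

theorem IsForest.card_join_le (hH : S.IsForest H) (hab : S.BridgeIn H a b) :
    1 + count S.N (S.JoinVert a b) + count S.N (S.JoinPair a b) ≤ H.edgeSet.ncard := by
  classical
  have key := hH.card_add_card_pairs_le (B := {x ∈ range S.N | S.JoinVert a b x})
    (D := {x ∈ range S.N | S.JoinPair a b x}) (X := {S.bridgeEdge a b})
    (fun x => if S.OnBridge a b x then S.mate x else x)
    (fun x hx => (mem_filter.1 hx).2.anchored hH hab) (fun x hx => ?_)
    (fun e he => mem_singleton.1 he ▸ hab.spare_bridgeEdge)
  · rw [card_singleton] at key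
    rw [count, count]
    omega
  · obtain ⟨y, hxy, hd, hon⟩ := (mem_filter.1 hx).2
    refine ⟨y, hxy, hd.2.1, hd.1, ?_⟩
    by_cases hx : S.OnBridge a b x
    · simp only [if_pos hx, hd.2.1.mate_eq]
      have hy : ¬ S.OnBridge a b y := fun h => hon ⟨hx, h⟩
      exact ⟨.inr trivial, fun hy' => hd.symm.not_joinVert hy (mem_filter.1 hy').2⟩
    · simp only [if_neg hx]
      exact ⟨.inl trivial, fun hx' => hd.not_joinVert hx (mem_filter.1 hx').2⟩

variable (S) in
open Classical in
/-- The vertex among `u` and `v` to which `z` is attached if the bridge is given by `a` and `b`. -/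
noncomputable def joinTarget (a b z : ℕ) : ℕ :=
  if z = b ∧ a ≠ b then S.v
  else if S.G.Adj z S.u ∨ ¬ S.G.Adj z S.v ∧ S.G.Adj (S.mate z) S.u then S.u else S.v

theorem JoinVert.lt (h : S.JoinVert a b x) (hab : S.Bridge a b) : x < S.N := by
  obtain h | ⟨-, y, hm, -⟩ | ⟨-, rfl | rfl⟩ := h
  exacts [h.lt, hm.lt, hab.left_lt, hab.right_lt]

theorem Bridge.adj_joinTarget (hab : S.Bridge a b) (hz : S.G.Adj z S.u ∨ S.G.Adj z S.v) :
    S.G.Adj z (S.joinTarget a b z) := by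
  have hbv := hab.2.2
  unfold joinTarget
  grind

theorem JoinVert.req_of_not_adj (hA : S.Attachable) (hab : S.Bridge a b)
    (hz : S.JoinVert a b z) (hu : ¬ S.G.Adj z S.u) (hv : ¬ S.G.Adj z S.v) : S.Req z := by
  obtain hz | ⟨-, x, hm, hx, hxu, hxv⟩ | ⟨hzu, rfl | rfl⟩ := hz
  · exact hz
  · obtain ⟨-, h | ⟨y, hy, -, h⟩⟩ | ⟨-, h | ⟨y, hy, -, h⟩⟩ := hA x hx
    exacts [absurd h hxu, absurd (hy.unique hm.symm ▸ h) hu, absurd h hxv,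
      absurd (hy.unique hm.symm ▸ h) hv]
  · exact absurd (hab.1.resolve_left hzu) hu
  · exact absurd hab.2.2 hv

theorem Bridge.joinTarget_mate (hab : S.Bridge a b) (hm : S.Mate z y) (hu : ¬ S.G.Adj z S.u)
    (hv : ¬ S.G.Adj z S.v) :
    S.joinTarget a b y = S.joinTarget a b z := by
  have hzb : z ≠ b := fun h => hv (h ▸ hab.2.2)
  have hyb : ¬ (y = b ∧ a ≠ b) := by
    rintro ⟨rfl, hne⟩
    have hza : z = a := hm.symm.unique (hab.2.1.resolve_left hne).symm
    exact hu (hza ▸ hab.1.resolve_left fun h => hm.1.1 (hza.trans h))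
  have hzb' : ¬ (z = b ∧ a ≠ b) := fun h => hzb h.1
  rw [joinTarget, joinTarget, if_neg hyb, if_neg hzb', hm.symm.mate_eq, hm.mate_eq]
  grind

theorem Bridge.leads_joinTarget (hab : S.Bridge a b) (hA : S.Attachable) {Z : Finset ℕ}
    (hZ : ∀ x, x ∈ Z ↔ S.JoinVert a b x) : S.Leads (S.joinTarget a b) Z := by
  intro z hz
  by_cases hadj : S.G.Adj z S.u ∨ S.G.Adj z S.v
  · exact .inl (hab.adj_joinTarget hadj)
  obtain ⟨hu, hv⟩ := not_or.1 hadj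
  have hreq := ((hZ z).1 hz).req_of_not_adj hA hab hu hv
  obtain ⟨y, hm, hy⟩ : ∃ y, S.Mate z y ∧ (S.G.Adj y S.u ∨ S.G.Adj y S.v) := by
    obtain ⟨-, h | ⟨y, hm, -, hy⟩⟩ | ⟨-, h | ⟨y, hm, -, hy⟩⟩ := hA z hreq
    exacts [absurd h hu, ⟨y, hm, .inl hy⟩, absurd h hv, ⟨y, hm, .inr hy⟩]
  have hyZ : y ∈ Z := by
    by_cases hry : S.Req y
    · exact (hZ y).2 (.inl hry)
    · exact (hZ y).2 (.inr (.inl ⟨hry, z, hm.symm, hreq, hu, hv⟩))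
  exact .inr ⟨y, hyZ, hm, hab.joinTarget_mate hm hu hv, hab.adj_joinTarget hy⟩

theorem Bridge.reachable (hab : S.Bridge a b) (hedge : S.bridgeEdge a b ∈ H.edgeSet)
    (hL : ∀ z, S.JoinVert a b z → H.Reachable z (S.joinTarget a b z)) :
    H.Reachable S.u S.v := by
  obtain ⟨rfl, rfl, -⟩ | ⟨hin, rfl, hau, -⟩ | ⟨hm, hau, -⟩ := hab.cases
  · rw [bridgeEdge, if_pos rfl] at hedge
    exact SimpleGraph.Adj.reachable hedge
  · have ha := hL a (.inr (.inr ⟨hin.1, .inl rfl⟩))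
    rw [joinTarget, if_neg fun h => h.2 rfl, if_pos (.inl hau)] at ha
    rw [bridgeEdge, if_pos rfl] at hedge
    exact ha.symm.trans (SimpleGraph.Adj.reachable hedge)
  · have hne := hm.2.2.ne
    have ha := hL a (.inr (.inr ⟨hm.1.1, .inl rfl⟩))
    have hb := hL b (.inr (.inr ⟨hm.2.1.1, .inr rfl⟩))
    rw [joinTarget, if_neg fun h => hne h.1, if_pos (.inl hau)] at ha
    rw [joinTarget, if_pos ⟨rfl, hne⟩] at hb
    rw [bridgeEdge, if_neg hne] at hedge
    exact (ha.symm.trans (SimpleGraph.Adj.reachable hedge)).trans hb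

theorem isForest_of_join (hle : H ≤ S.G) (huv : H.Reachable S.u S.v)
    (hL : ∀ z, S.JoinVert a b z → H.Reachable z (S.joinTarget a b z))
    (hD : ∀ x y, S.JoinPair a b x → S.Mate x y → H.Adj x y) : S.IsForest H := by
  have hjoin : ∀ z, S.JoinVert a b z → H.Reachable z S.u := by
    intro z hz
    obtain h | h : S.joinTarget a b z = S.u ∨ S.joinTarget a b z = S.v := by
      unfold joinTarget
      split_ifs <;> simp
    · exact h ▸ hL z hz
    · exact (h ▸ hL z hz).trans huv.symm
  have hend : ∀ x y, S.P x y → ¬ S.Detached x y → H.Reachable x S.u := by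
    intro x y hp hd
    obtain rfl | rfl | hx := eq_or_eq_or_req_of_pair hp hd
    exacts [.refl _, huv.symm, hjoin x (.inl hx)]
  refine ⟨hle, fun x y => reachable_of_forall_lt fun x y hp hxy => ?_⟩
  by_cases hd : S.Detached x y
  · by_cases hon : S.OnBridge a b x ∧ S.OnBridge a b y
    · exact (hjoin x (.inr (.inr hon.1))).trans (hjoin y (.inr (.inr hon.2))).symm
    · exact (hD x y ⟨y, hxy, hd, hon⟩ hd.2.1).reachable
  · exact (hend x y hp hd).trans (hend y x (S.pair_symm _ _ hp) fun h => hd h.symm).symm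

theorem exists_forest_of_bridge (hA : S.Attachable) (hab : S.Bridge a b) :
    ∃ H, S.IsForest H ∧ H.edgeSet.ncard ≤
      1 + count S.N (S.JoinVert a b) + count S.N (S.JoinPair a b) := by
  classical
  set Z := {x ∈ range S.N | S.JoinVert a b x} with hZ
  set D := {x ∈ range S.N | S.JoinPair a b x} with hD
  have hmemZ : ∀ x, x ∈ Z ↔ S.JoinVert a b x := fun x => by
    simpa [hZ] using fun h : S.JoinVert a b x => h.lt hab
  have hmemD : ∀ x, x ∈ D ↔ S.JoinPair a b x := fun x => by
    simpa [hD] using fun h : S.JoinPair a b x => h.choose_spec.2.1.2.1.lt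
  obtain ⟨H, hle, hcard, hL, hDH, hedge⟩ := (hab.leads_joinTarget hA hmemZ).exists_subgraph
    (D := D) (X := {S.bridgeEdge a b})
    (fun x hx => ((hmemD x).1 hx).imp fun y hy => hy.2.1.2.1)
    (fun e he => mem_singleton.1 he ▸ hab.bridgeEdge_mem)
  simp only [hmemZ] at hL
  have huv := hab.reachable (hedge _ (mem_singleton_self _)) hL
  refine ⟨H, isForest_of_join hle huv hL fun x y hx => hDH x ((hmemD x).2 hx) y, ?_⟩
  rw [card_singleton] at hcard
  rw [count, count, ← hZ, ← hD]
  omega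

end DeletionInst

namespace DeletionInst

/-! ### Steiner forests that separate the two vertices of the deletion set -/

variable (S : DeletionInst)

/-- A pair of vertices such that no Steiner forest connects the first to `u` and the second to `v`
in different components. -/
def Blocked (i j : ℕ) : Prop :=
  S.P i j ∧ ¬ S.Detached i j ∨
    S.Mate i j ∧ S.Req i ∧ S.Req j ∧ (¬ S.G.Adj i S.u ∨ ¬ S.G.Adj j S.v) ∨
    j = S.v ∧ S.Req i ∧ ¬ S.AnchoredTo S.G S.u i ∨
    i = S.u ∧ S.Req j ∧ ¬ S.AnchoredTo S.G S.v j

/-- To connect `x` to `w`, its mate has to be added. -/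
def Extra (w x : ℕ) : Prop := S.Req x ∧ ¬ S.G.Adj x w ∧ ∃ y, S.Mate x y ∧ ¬ S.Req y

open Classical in
/-- The network in which the cuts of capacity less than `N` are the admissible sets, with the number
of vertices added by `Extra` as capacity. -/
noncomputable def capacity (i j : ℕ) : ℕ :=
  if S.Blocked i j then S.N
  else if j = S.v ∧ S.Extra S.u i ∨ i = S.u ∧ S.Extra S.v j then 1 else 0

/-- The vertex among `u` and `v` to which `x` is connected if `X` is the side of `u`. -/
def side (X : Finset ℕ) (x : ℕ) : ℕ := if x ∈ X then S.u else S.v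

/-- The set `X` can be the side of `u` in a Steiner forest that separates `u` from `v`. -/
def Admissible (X : Finset ℕ) : Prop := ∀ i ∈ X, ∀ j < S.N, j ∉ X → ¬ S.Blocked i j

open Classical in
/-- The vertices that a Steiner forest with side `X` has to contain besides the required ones. -/
noncomputable def extras (X : Finset ℕ) : Finset ℕ :=
  {x ∈ range S.N | S.Extra (S.side X x) x}.image S.mate

variable {S} {H : SimpleGraph ℕ} {X : Finset ℕ} {x y z w : ℕ}

theorem side_of_mem (h : x ∈ X) : S.side X x = S.u := if_pos h

theorem side_of_notMem (h : x ∉ X) : S.side X x = S.v := if_neg h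

theorem Extra.lt (h : S.Extra w x) : x < S.N := h.1.lt

theorem mem_extras : y ∈ S.extras X ↔ ∃ x, S.Extra (S.side X x) x ∧ S.Mate x y := by
  simp only [extras, mem_image, mem_filter, mem_range]
  constructor
  · rintro ⟨x, ⟨-, hx⟩, rfl⟩
    obtain ⟨y, hm, -⟩ := hx.2.2
    exact ⟨x, hx, hm.mate_eq ▸ hm⟩
  · rintro ⟨x, hx, hm⟩
    exact ⟨x, ⟨hx.lt, hx⟩, hm.mate_eq⟩

theorem not_req_of_mem_extras (h : y ∈ S.extras X) : ¬ S.Req y := by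
  obtain ⟨x, ⟨-, -, z, hz, hr⟩, hm⟩ := mem_extras.1 h
  rwa [hm.unique hz]

theorem card_extras : #(S.extras X) = count S.N fun x => S.Extra (S.side X x) x := by
  classical
  refine card_image_of_injOn fun x hx y hy hxy => ?_
  obtain ⟨x', hx', -⟩ := (mem_filter.1 (mem_coe.1 hx)).2.2.2
  obtain ⟨y', hy', -⟩ := (mem_filter.1 (mem_coe.1 hy)).2.2.2
  rw [hx'.mate_eq, hy'.mate_eq] at hxy
  exact hx'.symm.unique (hxy ▸ hy'.symm)

theorem Req.anchoredTo_side (hH : S.IsForest H) (huv : ¬ H.Reachable S.u S.v)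
    (hX : ∀ x < S.N, x ∈ X ↔ H.Reachable S.u x) (hx : S.Req x) :
    S.AnchoredTo H (S.side X x) x := by
  by_cases hxX : x ∈ X
  · rw [side_of_mem hxX]
    have hux := (hX x hx.lt).1 hxX
    exact (hx.anchored hH).resolve_right fun h => huv (hux.trans h.reachable)
  · rw [side_of_notMem hxX]
    have hux := mt (hX x hx.lt).2 hxX
    exact (hx.anchored hH).resolve_left fun h => hux h.reachable.symm

theorem IsForest.admissible (hH : S.IsForest H) (huv : ¬ H.Reachable S.u S.v)
    (hX : ∀ x < S.N, x ∈ X ↔ H.Reachable S.u x) (hXN : X ⊆ range S.N) : S.Admissible X := by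
  intro i hi j hjN hj
  have hui := (hX i (mem_range.1 (hXN hi))).1 hi
  have huj := mt (hX j hjN).2 hj
  have hanci : S.Req i → S.AnchoredTo H S.u i := fun h =>
    side_of_mem hi ▸ h.anchoredTo_side hH huv hX
  have hancj : S.Req j → S.AnchoredTo H S.v j := fun h =>
    side_of_notMem hj ▸ h.anchoredTo_side hH huv hX
  rintro (⟨hp, -⟩ | ⟨hm, hri, hrj, hn⟩ | ⟨-, hr, hn⟩ | ⟨-, hr, hn⟩)
  · exact huj (hui.trans (hH.reachable _ _ hp))
  · have hij : ¬ H.Adj i j := fun h => huj (hui.trans h.reachable)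
    obtain ⟨-, hiu | ⟨y, hy, hiy, -⟩⟩ := hanci hri
    · obtain ⟨-, hjv | ⟨y, hy, hjy, -⟩⟩ := hancj hrj
      · exact hn.elim (fun h => h (hH.le hiu)) fun h => h (hH.le hjv)
      · exact hij (hy.unique hm.symm ▸ hjy).symm
    · exact hij (hy.unique hm ▸ hiy)
  · exact hn ((hanci hr).mono hH.le)
  · exact hn ((hancj hr).mono hH.le)

theorem anchored_of_mem_extras (hH : S.IsForest H) (huv : ¬ H.Reachable S.u S.v)
    (hX : ∀ x < S.N, x ∈ X ↔ H.Reachable S.u x) (hy : y ∈ S.extras X) : S.Anchored H y := by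
  obtain ⟨x, ⟨hr, hn, -⟩, hm⟩ := mem_extras.1 hy
  have hanc : S.Anchored H x := hr.anchored hH
  obtain ⟨-, h | ⟨z, hz, hxz, -⟩⟩ := hr.anchoredTo_side hH huv hX
  · exact absurd (hH.le h) hn
  · exact hanc.of_adj hm (hz.unique hm ▸ hxz)

theorem IsForest.card_sep_le (hH : S.IsForest H) (huv : ¬ H.Reachable S.u S.v)
    (hX : ∀ x < S.N, x ∈ X ↔ H.Reachable S.u x) :
    count S.N S.Req + #(S.extras X) + count S.N S.InnerPair ≤ H.edgeSet.ncard := by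
  classical
  set R := {x ∈ range S.N | S.Req x}
  have hdisj : Disjoint R (S.extras X) := disjoint_left.2 fun z hz hzE =>
    not_req_of_mem_extras hzE (mem_filter.1 hz).2
  have hB : ∀ x ∈ R ∪ S.extras X, S.Anchored H x := by
    intro x hx
    obtain hx | hx := mem_union.1 hx
    · exact (mem_filter.1 hx).2.anchored hH
    · exact anchored_of_mem_extras hH huv hX hx
  have hD : ∀ x ∈ {x ∈ range S.N | S.InnerPair x}, ∃ y, x < y ∧ S.Mate x y ∧ S.P x y ∧
      (id x = x ∨ id x = y) ∧ id x ∉ R ∪ S.extras X := by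
    intro x hx
    obtain ⟨-, y, hxy, hd⟩ := mem_filter.1 hx
    refine ⟨y, hxy, hd.2.1, hd.1, .inl rfl, fun hmem => ?_⟩
    obtain hmem | hmem := mem_union.1 hmem
    · exact hd.2.2 (mem_filter.1 hmem).2
    · obtain ⟨z, hz, hm⟩ := mem_extras.1 hmem
      exact hd.symm.2.2 (hm.symm.unique hd.2.1 ▸ hz.1)
  have hcard := hH.card_add_card_pairs_le (X := ∅) id hB hD (by simp)
  rw [card_union_of_disjoint hdisj, card_empty] at hcard
  exact hcard

theorem Admissible.exists_mate (hX : S.Admissible X) (hcut : IsCut S.N S.u S.v X)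
    (hx : S.Req x) (hn : ¬ S.G.Adj x (S.side X x)) :
    ∃ y, S.Mate x y ∧ S.G.Adj y (S.side X x) ∧ (S.Req y → S.side X y = S.side X x) := by
  by_cases hxX : x ∈ X
  · rw [side_of_mem hxX] at hn ⊢
    have hanc : S.AnchoredTo S.G S.u x := by_contra fun h =>
      hX x hxX S.v S.v_lt hcut.sink_notMem (.inr (.inr (.inl ⟨rfl, hx, h⟩)))
    obtain ⟨y, hm, -, hy⟩ := hanc.2.resolve_left hn
    refine ⟨y, hm, hy, fun hr => side_of_mem (by_contra fun hyX => ?_)⟩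
    exact hX x hxX y hr.lt hyX (.inr (.inl ⟨hm, hx, hr, .inl hn⟩))
  · rw [side_of_notMem hxX] at hn ⊢
    have hanc : S.AnchoredTo S.G S.v x := by_contra fun h =>
      hX S.u hcut.source_mem x hx.lt hxX (.inr (.inr (.inr ⟨rfl, hx, h⟩)))
    obtain ⟨y, hm, -, hy⟩ := hanc.2.resolve_left hn
    refine ⟨y, hm, hy, fun hr => side_of_notMem fun hyX => ?_⟩
    exact hX y hyX x hx.lt hxX (.inr (.inl ⟨hm.symm, hr, hx, .inr hn⟩))

variable (S) in
open Classical in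
/-- The vertex among `u` and `v` to which a required or extra vertex is connected. -/
noncomputable def sepTarget (X : Finset ℕ) (z : ℕ) : ℕ :=
  S.side X (if S.Req z then z else S.mate z)

theorem Req.sepTarget_eq (hz : S.Req z) : S.sepTarget X z = S.side X z := by
  rw [sepTarget, if_pos hz]

theorem Mate.sepTarget_eq (hm : S.Mate x y) (hy : ¬ S.Req y) : S.sepTarget X y = S.side X x := by
  rw [sepTarget, if_neg hy, hm.symm.mate_eq]

theorem Admissible.leads_sepTarget (hX : S.Admissible X) (hcut : IsCut S.N S.u S.v X)
    {Z : Finset ℕ} (hZ : ∀ z, z ∈ Z ↔ S.Req z ∨ z ∈ S.extras X) : S.Leads (S.sepTarget X) Z := by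
  intro z hz
  obtain hr | hE := (hZ z).1 hz
  · by_cases hadj : S.G.Adj z (S.side X z)
    · exact .inl (hr.sepTarget_eq ▸ hadj)
    obtain ⟨y, hm, hy, hside⟩ := hX.exists_mate hcut hr hadj
    have hyL : S.sepTarget X y = S.side X z := by
      by_cases hry : S.Req y
      · rw [hry.sepTarget_eq, hside hry]
      · exact hm.sepTarget_eq hry
    have hyZ : y ∈ Z := (hZ y).2 <| or_iff_not_imp_left.2 fun hry =>
      mem_extras.2 ⟨z, ⟨hr, hadj, y, hm, hry⟩, hm⟩
    exact .inr ⟨y, hyZ, hm, by rw [hyL, hr.sepTarget_eq], hyL ▸ hy⟩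
  · obtain ⟨x, hx, hm⟩ := mem_extras.1 hE
    obtain ⟨y, hm', hy, -⟩ := hX.exists_mate hcut hx.1 hx.2.1
    rw [hm.sepTarget_eq (not_req_of_mem_extras hE), hm.unique hm']
    exact .inl hy

theorem Admissible.side_eq (hX : S.Admissible X) (hp : S.P x y) (hd : ¬ S.Detached x y) :
    S.side X x = S.side X y := by
  have hp' := S.pair_symm _ _ hp
  by_cases hx : x ∈ X <;> by_cases hy : y ∈ X
  · rw [side_of_mem hx, side_of_mem hy]
  · exact absurd (.inl ⟨hp, hd⟩) (hX x hx y (S.pair_lt _ _ hp') hy)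
  · exact absurd (.inl ⟨hp', fun h => hd h.symm⟩) (hX y hy x (S.pair_lt _ _ hp) hx)
  · rw [side_of_notMem hx, side_of_notMem hy]

theorem Admissible.isForest (hX : S.Admissible X) (hcut : IsCut S.N S.u S.v X) (hle : H ≤ S.G)
    (hL : ∀ z, S.Req z → H.Reachable z (S.side X z))
    (hD : ∀ x y, S.InnerPair x → S.Mate x y → H.Adj x y) : S.IsForest H := by
  have hend : ∀ x y, S.P x y → ¬ S.Detached x y → H.Reachable x (S.side X x) := by
    intro x y hp hd
    obtain rfl | rfl | hx := eq_or_eq_or_req_of_pair hp hd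
    · rw [side_of_mem hcut.source_mem]
    · rw [side_of_notMem hcut.sink_notMem]
    · exact hL x hx
  refine ⟨hle, fun x y => reachable_of_forall_lt fun x y hp hxy => ?_⟩
  by_cases hd : S.Detached x y
  · exact (hD x y ⟨y, hxy, hd⟩ hd.2.1).reachable
  · have hy := hend y x (S.pair_symm _ _ hp) fun h => hd h.symm
    exact (hX.side_eq hp hd ▸ hend x y hp hd).trans hy.symm

theorem Admissible.exists_forest (hX : S.Admissible X) (hcut : IsCut S.N S.u S.v X) :
    ∃ H, S.IsForest H ∧ H.edgeSet.ncard ≤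
      count S.N S.Req + #(S.extras X) + count S.N S.InnerPair := by
  classical
  set R := {x ∈ range S.N | S.Req x} with hR
  set D := {x ∈ range S.N | S.InnerPair x} with hD
  have hmemR : ∀ x, x ∈ R ↔ S.Req x := fun x => by simpa [hR] using Req.lt
  have hmemD : ∀ x, x ∈ D ↔ S.InnerPair x := fun x => by
    simpa [hD] using fun h : S.InnerPair x => h.choose_spec.2.2.1.lt
  have hleads := hX.leads_sepTarget hcut (Z := R ∪ S.extras X) fun z => by rw [mem_union, hmemR]
  obtain ⟨H, hle, hcard, hL, hDH, -⟩ := hleads.exists_subgraph (D := D) (X := ∅)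
    (fun x hx => ((hmemD x).1 hx).imp fun y hy => hy.2.2.1) (by simp)
  refine ⟨H, hX.isForest hcut hle (fun z hz => ?_) fun x y hx => hDH x ((hmemD x).2 hx) y, ?_⟩
  · exact hz.sepTarget_eq ▸ hL z (mem_union_left _ ((hmemR z).2 hz))
  · have hunion := card_union_le R (S.extras X)
    rw [card_empty] at hcard
    rw [count, count, ← hR, ← hD]
    omega

/-! ### Reduction to a minimum cut -/

theorem Admissible.cutCap_eq (hX : S.Admissible X) (hcut : IsCut S.N S.u S.v X) :
    cutCap S.N S.capacity X = #(S.extras X) := by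
  classical
  have hEu : ¬ S.Extra S.u S.u := fun h => h.1.1.1 rfl
  have hEv : ¬ S.Extra S.v S.v := fun h => h.1.1.2 rfl
  have hcap : ∀ i ∈ X, ∀ j ∈ range S.N \ X, S.capacity i j =
      (if j = S.v then if S.Extra S.u i then 1 else 0 else 0) +
        if i = S.u then if S.Extra S.v j then 1 else 0 else 0 := by
    intro i hi j hj
    rw [mem_sdiff, mem_range] at hj
    rw [capacity, if_neg (hX i hi j hj.1 hj.2)]
    by_cases hjv : j = S.v <;> by_cases hiu : i = S.u <;> simp [hjv, hiu, hEu, hEv]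
  have hv : S.v ∈ range S.N \ X := mem_sdiff.2 ⟨mem_range.2 S.v_lt, hcut.sink_notMem⟩
  calc cutCap S.N S.capacity X
      = ∑ i ∈ X, (if S.Extra S.u i then 1 else 0) +
          ∑ j ∈ range S.N \ X, if S.Extra S.v j then 1 else 0 := by
        rw [cutCap, sum_congr rfl fun i hi => sum_congr rfl (hcap i hi)]
        simp only [sum_add_distrib, sum_ite_eq', hv, if_true]
        rw [sum_comm (s := X)]
        simp only [sum_ite_eq', hcut.source_mem, if_true]
    _ = ∑ i ∈ X, (if S.Extra (S.side X i) i then 1 else 0) +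
          ∑ j ∈ range S.N \ X, if S.Extra (S.side X j) j then 1 else 0 := by
        congr 1 <;> refine sum_congr rfl fun i hi => ?_
        · rw [side_of_mem hi]
        · rw [side_of_notMem (mem_sdiff.1 hi).2]
    _ = #(S.extras X) := by
        rw [card_extras, count, card_filter, ← sum_sdiff hcut.subset, add_comm]

theorem admissible_of_cutCap_lt (hlt : cutCap S.N S.capacity X < S.N) : S.Admissible X := by
  intro i hi j hj hjX hb
  have hcap : S.capacity i j = S.N := if_pos hb
  have hrow : S.capacity i j ≤ ∑ j ∈ range S.N \ X, S.capacity i j :=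
    single_le_sum (f := fun j => S.capacity i j) (fun _ _ => Nat.zero_le _)
      (mem_sdiff.2 ⟨mem_range.2 hj, hjX⟩)
  have hsum : ∑ j ∈ range S.N \ X, S.capacity i j ≤ cutCap S.N S.capacity X :=
    single_le_sum (f := fun i => ∑ j ∈ range S.N \ X, S.capacity i j)
      (fun _ _ => Nat.zero_le _) hi
  omega

theorem capacity_le (i j : ℕ) : S.capacity i j ≤ S.N := by
  have hN := S.u_lt
  unfold capacity
  split_ifs <;> omega

theorem card_extras_lt : #(S.extras X) < S.N := by
  classical
  have hssub : {x ∈ range S.N | S.Extra (S.side X x) x} ⊂ range S.N := by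
    rw [filter_ssubset]
    exact ⟨S.u, mem_range.2 S.u_lt, fun h => h.1.1.1 rfl⟩
  rw [card_extras, count]
  simpa using card_lt_card hssub

theorem IsForest.exists_cut_of_not_reachable (hH : S.IsForest H)
    (huv : ¬ H.Reachable S.u S.v) : ∃ X, IsCut S.N S.u S.v X ∧ cutCap S.N S.capacity X < S.N ∧
      count S.N S.Req + cutCap S.N S.capacity X + count S.N S.InnerPair ≤ H.edgeSet.ncard := by
  classical
  set X := {x ∈ range S.N | H.Reachable S.u x} with hX
  have hmem : ∀ x < S.N, x ∈ X ↔ H.Reachable S.u x := fun x hx => by simp [hX, hx]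
  have hcut : IsCut S.N S.u S.v X := ⟨filter_subset _ _, (hmem _ S.u_lt).2 (.refl _),
    fun hv => huv ((hmem _ S.v_lt).1 hv)⟩
  have hadm := hH.admissible huv hmem hcut.subset
  refine ⟨X, hcut, ?_⟩
  rw [hadm.cutCap_eq hcut]
  exact ⟨card_extras_lt, hH.card_sep_le huv hmem⟩

theorem exists_isForest_iff {m : ℕ} (hm : IsMinCut S.N S.u S.v S.capacity m) (k : ℕ) :
    (∃ H, S.IsForest H ∧ H.edgeSet.ncard ≤ k) ↔
      (S.Attachable ∧ ∃ a < S.N, ∃ b < S.N, S.Bridge a b ∧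
        1 + count S.N (S.JoinVert a b) + count S.N (S.JoinPair a b) ≤ k) ∨
      m < S.N ∧ count S.N S.Req + m + count S.N S.InnerPair ≤ k := by
  constructor
  · rintro ⟨H, hH, hk⟩
    by_cases huv : H.Reachable S.u S.v
    · obtain ⟨a, b, hab⟩ := exists_bridgeIn hH.le huv
      exact .inl ⟨fun x hx => (hx.anchored hH).mono hH.le, a, hab.1.left_lt, b, hab.1.right_lt,
        hab.1, (hH.card_join_le hab).trans hk⟩
    · obtain ⟨X, hcut, hlt, hX⟩ := hH.exists_cut_of_not_reachable huv
      have hmX : m ≤ cutCap S.N S.capacity X := hm.2 ⟨X, hcut, rfl⟩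
      exact .inr ⟨hmX.trans_lt hlt, by omega⟩
  · rintro (⟨hA, a, -, b, -, hab, hc⟩ | ⟨hlt, hc⟩)
    · obtain ⟨H, hH, hk⟩ := exists_forest_of_bridge hA hab
      exact ⟨H, hH, hk.trans hc⟩
    · obtain ⟨X, hcut, rfl⟩ := hm.1
      have hadm := admissible_of_cutCap_lt hlt
      obtain ⟨H, hH, hk⟩ := hadm.exists_forest hcut
      rw [hadm.cutCap_eq hcut] at hc
      exact ⟨H, hH, hk.trans hc⟩

end DeletionInst

/-! ### Instances as graphs on the natural numbers -/

/-- The graph of an instance, with isolated vertices added. -/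
def Inst.graph (I : Inst) : SimpleGraph ℕ := I.G.map Fin.valEmbedding

/-- The symmetric relation given by the terminal pairs. -/
def Inst.pair (I : Inst) (x y : ℕ) : Prop :=
  x ≠ y ∧ ∃ (hx : x < I.n) (hy : y < I.n),
    ((⟨x, hx⟩, ⟨y, hy⟩) ∈ I.S ∨ (⟨y, hy⟩, ⟨x, hx⟩) ∈ I.S)

theorem Inst.graph_adj {I : Inst} {x y : ℕ} :
    I.graph.Adj x y ↔ ∃ (hx : x < I.n) (hy : y < I.n), I.G.Adj ⟨x, hx⟩ ⟨y, hy⟩ := by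
  rw [graph, SimpleGraph.map_adj]
  constructor
  · rintro ⟨a, b, h, rfl, rfl⟩
    exact ⟨a.2, b.2, h⟩
  · rintro ⟨hx, hy, h⟩
    exact ⟨_, _, h, rfl, rfl⟩

theorem Inst.graph_adj_lt {I : Inst} {x y : ℕ} (h : I.graph.Adj x y) : x < I.n :=
  (graph_adj.1 h).1

theorem Inst.pair.symm {I : Inst} {x y : ℕ} (h : I.pair x y) : I.pair y x :=
  let ⟨hne, hx, hy, hxy⟩ := h
  ⟨hne.symm, hy, hx, hxy.symm⟩

theorem Inst.pair_lt {I : Inst} {x y : ℕ} (h : I.pair x y) : x < I.n := h.2.1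

theorem Inst.exists_le_graph_of_yes {I : Inst} (h : I.Yes) :
    ∃ H ≤ I.graph, (∀ x y, I.pair x y → H.Reachable x y) ∧ (H.edgeSet.ncard : ℤ) ≤ I.k := by
  obtain ⟨F, hF, hk⟩ := h
  refine ⟨F.spanningCoe.map Fin.valEmbedding, SimpleGraph.map_monotone _ F.spanningCoe_le, ?_, ?_⟩
  · have hreach : ∀ a b : Fin I.n, (a, b) ∈ I.S →
        (F.spanningCoe.map Fin.valEmbedding).Reachable (a : ℕ) (b : ℕ) := by
      intro a b hab
      obtain ⟨_, _, h⟩ := hF _ hab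
      exact (h.map F.coeEmbeddingSpanningCoe.toHom).map
        (SimpleGraph.Embedding.map Fin.valEmbedding _).toHom
    rintro x y ⟨-, hx, hy, h | h⟩
    · exact hreach _ _ h
    · exact (hreach _ _ h).symm
  · rw [SimpleGraph.edgeSet_map, SimpleGraph.Subgraph.edgeSet_spanningCoe]
    exact (Nat.cast_le.2 (Set.ncard_image_le (Set.toFinite _))).trans hk

/-- The spanning subgraph of `I.G` with the edges of `H`. -/
def Inst.subgraph (I : Inst) {H : SimpleGraph ℕ} (hH : H ≤ I.graph) : I.G.Subgraph where
  verts := Set.univ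
  Adj a b := H.Adj a b
  adj_sub h := (graph_adj.1 (hH h)).2.2
  edge_vert _ := Set.mem_univ _
  symm := ⟨fun _ _ h => SimpleGraph.Adj.symm h⟩

theorem Inst.yes_of_le_graph {I : Inst} {H : SimpleGraph ℕ} (hH : H ≤ I.graph)
    (hP : ∀ x y, I.pair x y → H.Reachable x y) (hfin : H.edgeSet.Finite)
    (hk : (H.edgeSet.ncard : ℤ) ≤ I.k) : I.Yes := by
  refine ⟨I.subgraph hH, fun p hp => ⟨Set.mem_univ _, Set.mem_univ _, ?_⟩, ?_⟩
  · obtain heq | hne := eq_or_ne p.1 p.2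
    · simp only [heq, SimpleGraph.Reachable.refl]
    · have hr := hP p.1 p.2 ⟨fun h => hne (Fin.ext h), p.1.2, p.2.2, .inl hp⟩
      refine (DeletionInst.mem_of_reachable (Y := {z | ∃ hz : z < I.n,
        (I.subgraph hH).coe.Reachable ⟨p.1, Set.mem_univ _⟩ ⟨⟨z, hz⟩, Set.mem_univ _⟩})
        ?_ hr ⟨p.1.2, .refl _⟩).2
      rintro x y ⟨hx, h⟩ hxy
      exact ⟨graph_adj_lt (hH hxy.symm), h.trans (SimpleGraph.Adj.reachable hxy)⟩
  · refine (Nat.cast_le.2 ?_).trans hk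
    refine Set.ncard_le_ncard_of_injOn (Sym2.map Fin.val) ?_
      (Sym2.map.injective Fin.val_injective).injOn hfin
    intro e he
    induction e with
    | h x y => exact he

/-- Every component of the graph without `u` and `v` has at most two vertices. -/
def Inst.IsDeletionPair (I : Inst) (u v : ℕ) : Prop :=
  u ≠ v ∧ ∀ x y z, x ≠ u ∧ x ≠ v → y ≠ u ∧ y ≠ v → z ≠ u ∧ z ≠ v →
    I.graph.Adj x y → I.graph.Adj x z → y = z

/-- An instance with a deletion pair, on the vertices below `N`. -/
@[simps N] def Inst.deletionInst (I : Inst) {N u v : ℕ} (h : I.IsDeletionPair u v) (hu : u < N)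
    (hv : v < N) (hN : I.n ≤ N) : DeletionInst where
  N := N
  G := I.graph
  P := I.pair
  u := u
  v := v
  u_ne_v := h.1
  u_lt := hu
  v_lt := hv
  adj_lt _ _ hxy := (graph_adj_lt hxy).trans_le hN
  pair_symm _ _ := pair.symm
  pair_ne _ _ hp := hp.1
  pair_lt _ _ hp := (pair_lt hp).trans_le hN
  adj_unique := h.2

theorem Inst.yes_iff {I : Inst} {N u v : ℕ} (h : I.IsDeletionPair u v) (hu : u < N) (hv : v < N)
    (hN : I.n ≤ N) : I.Yes ↔ ¬ I.k < 0 ∧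
      ∃ H, (I.deletionInst h hu hv hN).IsForest H ∧ H.edgeSet.ncard ≤ I.k.natAbs := by
  constructor
  · intro hI
    obtain ⟨H, hH, hP, hk⟩ := exists_le_graph_of_yes hI
    exact ⟨by omega, H, ⟨hH, hP⟩, by omega⟩
  · rintro ⟨hk, H, hH, hle⟩
    exact yes_of_le_graph hH.le hH.reachable hH.finite_edgeSet (by omega)

theorem IsDeletionSet.eq_of_adj {V : Type} {G : SimpleGraph V} {T : Finset V}
    (hT : IsDeletionSet G 2 T) {x y z : V} (hx : x ∉ T) (hy : y ∉ T) (hz : z ∉ T)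
    (hxy : G.Adj x y) (hxz : G.Adj x z) : y = z := by
  by_contra hyz
  let C := (G.induce {v | v ∉ T}).connectedComponentMk ⟨x, hx⟩
  have hsub : ({⟨x, hx⟩, ⟨y, hy⟩, ⟨z, hz⟩} : Set {v | v ∉ T}) ⊆ C.supp := by
    have hadj : (G.induce {v | v ∉ T}).Adj ⟨x, hx⟩ ⟨y, hy⟩ := hxy
    have hadj' : (G.induce {v | v ∉ T}).Adj ⟨x, hx⟩ ⟨z, hz⟩ := hxz
    rintro w (rfl | rfl | rfl)
    · rfl
    · exact SimpleGraph.ConnectedComponent.sound hadj.symm.reachable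
    · exact SimpleGraph.ConnectedComponent.sound hadj'.symm.reachable
  have hcard := (Set.encard_le_encard hsub).trans (hT C)
  rw [Set.encard_insert_of_notMem (by simp [hxy.ne, hxz.ne]), Set.encard_pair (by simpa)] at hcard
  norm_num at hcard

theorem Inst.exists_isDeletionPair {I : Inst} {N : ℕ} (hN : I.n + 2 ≤ N) {T : Finset (Fin I.n)}
    (hcard : #T ≤ 2) (hT : IsDeletionSet I.G 2 T) : ∃ u < N, ∃ v < N, I.IsDeletionPair u v := by
  have hTN : T.map Fin.valEmbedding ⊆ range N := by
    intro x hx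
    obtain ⟨y, -, rfl⟩ := mem_map.1 hx
    exact mem_range.2 (y.2.trans_le (by omega))
  obtain ⟨U, hTU, hUN, hU⟩ := exists_subsuperset_card_eq (n := 2) hTN (by simpa using hcard)
    (by simpa using by omega)
  obtain ⟨u, v, huv, rfl⟩ := card_eq_two.1 hU
  have hnot : ∀ (w : ℕ) (hw : w < I.n), w ≠ u ∧ w ≠ v → (⟨w, hw⟩ : Fin I.n) ∉ T := by
    intro w hw hne hmem
    have hw' := hTU (mem_map_of_mem Fin.valEmbedding hmem)
    rw [mem_insert, mem_singleton] at hw'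
    tauto
  refine ⟨u, mem_range.1 (hUN (by simp)), v, mem_range.1 (hUN (by simp)), huv, ?_⟩
  intro x y z hx hy hz hxy hxz
  obtain ⟨hxn, hyn, hadj_xy⟩ := graph_adj.1 hxy
  obtain ⟨_, hzn, hadj_xz⟩ := graph_adj.1 hxz
  exact congrArg Fin.val <|
    hT.eq_of_adj (hnot x hxn hx) (hnot y hyn hy) (hnot z hzn hz) hadj_xy hadj_xz

/-! ### The encoding -/

theorem length_matrixBits {n : ℕ} (r : Fin n → Fin n → Prop) :
    (matrixBits r).length = n * n := by
  simp [matrixBits]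

theorem getD_append_add {l : List Bool} {m : ℕ} (hl : l.length = m) (l' : List Bool) (i : ℕ) :
    (l ++ l').getD (m + i) false = l'.getD i false := by
  subst hl
  rw [List.getD_append_right _ _ _ _ (Nat.le_add_right _ _), Nat.add_sub_cancel_left]

theorem getD_flatMap {α : Type} {f : α → List Bool} {m : ℕ} (hf : ∀ a, (f a).length = m)
    {l : List α} {i j : ℕ} (hi : i < l.length) (hj : j < m) :
    (l.flatMap f).getD (i * m + j) false = (f l[i]).getD j false := by
  induction l generalizing i with
  | nil => simp at hi
  | cons a l ih =>
    rw [List.flatMap_cons]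
    cases i with
    | zero => rw [Nat.zero_mul, Nat.zero_add, List.getD_append _ _ _ _ (by rwa [hf]),
        List.getElem_cons_zero]
    | succ i =>
      rw [Nat.succ_mul, Nat.add_right_comm, Nat.add_comm, getD_append_add (hf a),
        ih (Nat.lt_of_succ_lt_succ hi), List.getElem_cons_succ]

theorem getD_matrixBits {n : ℕ} (r : Fin n → Fin n → Prop) {i j : ℕ} (hi : i < n) (hj : j < n) :
    (matrixBits r).getD (i * n + j) false = true ↔ r ⟨i, hi⟩ ⟨j, hj⟩ := by
  rw [matrixBits, getD_flatMap (by simp) (by simpa using hi) hj]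
  simp [List.getD_eq_getElem?_getD, hj]

section Encode

variable (I : Inst)

theorem Inst.length_encode :
    I.encode.length = I.n + 1 + I.n * I.n + I.n * I.n + 1 + I.k.natAbs.bits.length := by
  simp only [encode, List.length_append, List.length_replicate, List.length_singleton,
    length_matrixBits]

theorem Inst.getD_encode_of_lt {i : ℕ} (hi : i < I.n) : I.encode.getD i false = true := by
  simp only [encode, List.append_assoc]
  rw [List.getD_append _ _ _ _ (by rwa [List.length_replicate]), List.getD_replicate _ hi]

theorem Inst.getD_encode_n : I.encode.getD I.n false = false := by
  simp only [encode, List.append_assoc]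
  exact getD_append_add List.length_replicate _ 0

theorem Inst.getD_encode_adj {i j : ℕ} (hi : i < I.n) (hj : j < I.n) :
    I.encode.getD (I.n + 1 + (i * I.n + j)) false = true ↔ I.G.Adj ⟨i, hi⟩ ⟨j, hj⟩ := by
  have hij : i * I.n + j < I.n * I.n := by nlinarith
  rw [← getD_matrixBits I.G.Adj hi hj, encode, List.append_assoc, List.append_assoc,
    List.append_assoc, getD_append_add (by simp), List.getD_append _ _ _ _ (by
      rwa [length_matrixBits])]

theorem Inst.getD_encode_pair {i j : ℕ} (hi : i < I.n) (hj : j < I.n) :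
    I.encode.getD (I.n + 1 + I.n * I.n + (i * I.n + j)) false = true ↔
      ((⟨i, hi⟩, ⟨j, hj⟩) : Fin I.n × Fin I.n) ∈ I.S := by
  have hij : i * I.n + j < I.n * I.n := by nlinarith
  rw [← getD_matrixBits (fun i j => (i, j) ∈ I.S) hi hj, encode, List.append_assoc,
    List.append_assoc,
    getD_append_add (by simp [length_matrixBits, ← add_assoc, add_right_comm]),
    List.getD_append _ _ _ _ (by rwa [length_matrixBits])]

theorem Inst.getD_encode_sign :
    I.encode.getD (I.n + 1 + I.n * I.n + I.n * I.n) false = decide (I.k < 0) := by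
  rw [encode, List.append_assoc]
  exact getD_append_add (by simp [length_matrixBits, ← add_assoc, add_right_comm]) _ 0

theorem Inst.getD_encode_bits (i : ℕ) :
    I.encode.getD (I.n + 1 + I.n * I.n + I.n * I.n + 1 + i) false =
      I.k.natAbs.bits.getD i false :=
  getD_append_add (by simp [length_matrixBits, ← add_assoc, add_right_comm]) _ i

end Encode

theorem div_two_pow_eq (m i : ℕ) :
    m / 2 ^ i = 2 * (m / 2 ^ (i + 1)) + (m.bits.getD i false).toNat := by
  have hbit : m.bits.getD i false = m.testBit i := (Nat.testBit_eq_inth m i).symm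
  rw [hbit, Nat.toNat_testBit, pow_succ, ← Nat.div_div_eq_div_mul]
  omega

theorem div_two_pow_eq_zero {m N : ℕ} (h : m.bits.length ≤ N) : m / 2 ^ N = 0 := by
  rw [Nat.size_eq_bits_len] at h
  exact Nat.div_eq_of_lt (Nat.size_le.1 h)

/-! ### Logic in the language of array programs -/

theorem truth_congr {p q : Prop} (h : p ↔ q) : truth p = truth q := congrArg truth (propext h)

theorem truth_exists_lt {N : ℕ} {Q : ℕ → Prop} (hQ : ∀ x, Q x → x < N) :
    truth (∃ x < N, Q x) = truth (∃ x, Q x) :=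
  truth_congr (exists_congr fun x => and_iff_right_of_imp (hQ x))

namespace Exp

/-- Negation. -/
def notE (a : Exp) : Exp := cond a (num 0) (num 1)

/-- Conjunction. -/
def andE (a b : Exp) : Exp := notE (notE (cond a b (num 0)))

/-- Disjunction. -/
def orE (a b : Exp) : Exp := notE (notE (add a b))

/-- Implication. -/
def impE (a b : Exp) : Exp := orE (notE a) b

/-- The order of the natural numbers. -/
def leE (a b : Exp) : Exp := notE (sub a b)

/-- The strict order of the natural numbers. -/
def ltE (a b : Exp) : Exp := notE (leE b a)

/-- Equality. -/
def eqE (a b : Exp) : Exp := andE (leE a b) (leE b a)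

/-- Existential quantification over the numbers less than `size`. -/
def exE (x : ℕ) (a : Exp) : Exp := notE (notE (sum x a))

/-- Universal quantification over the numbers less than `size`. -/
def allE (x : ℕ) (a : Exp) : Exp := notE (exE x (notE a))

/-- The least value of the variable `y` with the property `a`, and `size` if there is none.  The
variable `x` must not occur in `a`. -/
def leastE (x y : ℕ) (a : Exp) : Exp := sum x (allE y (impE (leE (var y) (var x)) (notE a)))

/-- The entry `(0, 0)` of an array. -/
def cell (k : ℕ) : Exp := arr k (num 0) (num 0)

/-- An entry of the column `0` of an array. -/
def col (k : ℕ) (a : Exp) : Exp := arr k a (num 0)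

attribute [simp] eval

variable {N : ℕ} {A : Arrays} {v : ℕ → ℕ}

@[simp] theorem eval_notE (a : Exp) : (notE a).eval N A v = truth (a.eval N A v = 0) := by
  simp [notE, truth_eq_ite]

@[simp] theorem eval_andE (a b : Exp) :
    (andE a b).eval N A v = truth (a.eval N A v ≠ 0 ∧ b.eval N A v ≠ 0) := by
  by_cases h : a.eval N A v = 0 <;> simp [andE, h]

@[simp] theorem eval_orE (a b : Exp) :
    (orE a b).eval N A v = truth (a.eval N A v ≠ 0 ∨ b.eval N A v ≠ 0) := by
  simp only [orE, eval_notE, eval, truth_eq_zero, Nat.add_eq_zero_iff, not_and_or, ne_eq]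

@[simp] theorem eval_impE (a b : Exp) :
    (impE a b).eval N A v = truth (a.eval N A v ≠ 0 → b.eval N A v ≠ 0) := by
  simp only [impE, eval_orE, eval_notE, ne_eq, truth_eq_zero, not_not, imp_iff_not_or]

@[simp] theorem eval_leE (a b : Exp) :
    (leE a b).eval N A v = truth (a.eval N A v ≤ b.eval N A v) := by
  simp [leE, Nat.sub_eq_zero_iff_le]

@[simp] theorem eval_ltE (a b : Exp) :
    (ltE a b).eval N A v = truth (a.eval N A v < b.eval N A v) := by
  simp [ltE]

@[simp] theorem eval_eqE (a b : Exp) :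
    (eqE a b).eval N A v = truth (a.eval N A v = b.eval N A v) := by
  simp only [eqE, eval_andE, eval_leE, ne_eq, truth_eq_zero, not_not]
  exact truth_congr le_antisymm_iff.symm

@[simp] theorem eval_exE (x : ℕ) (a : Exp) :
    (exE x a).eval N A v = truth (∃ i < N, a.eval N A (Function.update v x i) ≠ 0) := by
  simp [exE, sum_eq_zero_iff]

@[simp] theorem eval_allE (x : ℕ) (a : Exp) :
    (allE x a).eval N A v = truth (∀ i < N, a.eval N A (Function.update v x i) ≠ 0) := by
  simp [allE]

@[simp] theorem eval_cell (k : ℕ) : (cell k).eval N A v = A k 0 0 := rfl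

@[simp] theorem eval_col (k : ℕ) (a : Exp) : (col k a).eval N A v = A k (a.eval N A v) 0 := rfl

theorem eval_leastE {x y : ℕ} (hxy : x ≠ y) {a : Exp} {Q : ℕ → Prop}
    (hQ : ∀ i, ∀ j < N, a.eval N A (Function.update (Function.update v x i) y j) ≠ 0 ↔ Q j) :
    (leastE x y a).eval N A v = leastBelow N Q := by
  rw [← sum_truth_forall_not]
  refine sum_congr rfl fun i _ => ?_
  rw [eval_allE]
  refine truth_congr (forall₂_congr fun j hj => ?_)
  simp [Function.update_of_ne hxy, ← hQ i j hj]

end Exp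

@[simp] theorem env_zero (i j : ℕ) : env i j 0 = i := rfl

@[simp] theorem env_one (i j : ℕ) : env i j 1 = j := rfl

/-! ### Blocks of definitions -/

/-- The array with the entries given by an expression. -/
def table (N : ℕ) (A : Arrays) (e : Exp) : ℕ → ℕ → ℕ := fun i j =>
  if i < N ∧ j < N then e.eval N A (env i j) else 0

section Table

variable {N i j k : ℕ} {A B : Arrays} {e : Exp}

theorem table_of_lt (hi : i < N) (hj : j < N) : table N A e i j = e.eval N A (env i j) :=
  if_pos ⟨hi, hj⟩

theorem table_eq_zero (h : ¬ (i < N ∧ j < N)) : table N A e i j = 0 := if_neg h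

theorem table_eq_truth {Q : Prop} (hQ : Q → i < N ∧ j < N)
    (he : i < N → j < N → e.eval N A (env i j) = truth Q) : table N A e i j = truth Q := by
  by_cases h : i < N ∧ j < N
  · rw [table_of_lt h.1 h.2, he h.1 h.2]
  · rw [table_eq_zero h, truth_of_not (mt hQ h)]

theorem table_congr (h : ∀ l ∈ e.reads, A l = B l) : table N A e = table N B e := by
  funext i j
  rw [table, table, e.eval_congr h]

end Table

/-- The arrays that a program changes. -/
def Stm.writes : Stm → Finset ℕ
  | .tab k _ => {k}
  | .seq p q => p.writes ∪ q.writes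
  | .rep p => p.writes

theorem Stm.run_eq_of_notMem_writes {N k : ℕ} {p : Stm} (hk : k ∉ p.writes) (A : Arrays) :
    p.run N A k = A k := by
  induction p generalizing A with
  | tab l e => exact Function.update_of_ne (by simpa [writes] using hk) _ _
  | seq p q ihp ihq =>
    rw [writes, notMem_union] at hk
    rw [run, ihq hk.2, ihp hk.1]
  | rep p ih =>
    have iterate_eq (m : ℕ) : (p.run N)^[m] A k = A k := by
      induction m with
      | zero => rfl
      | succ m ihm => rw [Function.iterate_succ_apply', ih hk, ihm]
    exact iterate_eq N

/-- The program that fills the arrays `k`, `k + 1`, … as given by a nonempty list of expressions. -/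
def tabs : ℕ → Exp → List Exp → Stm
  | k, e, [] => .tab k e
  | k, e, next :: l => .seq (.tab k e) (tabs (k + 1) next l)

/-- The expressions for the arrays `k`, `k + 1`, … read arrays of smaller number only. -/
def Stratified : ℕ → List Exp → Prop
  | _, [] => True
  | k, e :: l => (∀ m ∈ e.reads, m < k) ∧ Stratified (k + 1) l

instance decidableStratified : (k : ℕ) → (l : List Exp) → Decidable (Stratified k l)
  | _, [] => .isTrue trivial
  | k, _ :: l => @instDecidableAnd _ _ _ (decidableStratified (k + 1) l)

/-- The arrays `k`, `k + 1`, … are as given by a list of expressions. -/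
def Defines (N : ℕ) (A : Arrays) : ℕ → List Exp → Prop
  | _, [] => True
  | k, e :: l => A k = table N A e ∧ Defines N A (k + 1) l

theorem le_of_mem_writes_tabs {k m : ℕ} {e : Exp} {l : List Exp} (h : m ∈ (tabs k e l).writes) :
    k ≤ m := by
  induction l generalizing k e with
  | nil => exact (mem_singleton.1 h).ge
  | cons e' l ih =>
    rcases mem_union.1 h with h | h
    · exact (mem_singleton.1 h).ge
    · exact Nat.le_of_succ_le (ih h)

theorem run_tabs_of_lt {N k m : ℕ} {e : Exp} {l : List Exp} (h : m < k) (A : Arrays) :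
    (tabs k e l).run N A m = A m :=
  Stm.run_eq_of_notMem_writes (fun hm => h.not_ge (le_of_mem_writes_tabs hm)) A

theorem run_tab_self {N k : ℕ} {e : Exp} (h : k ∉ e.reads) (A : Arrays) :
    (Stm.tab k e).run N A k = table N ((Stm.tab k e).run N A) e := by
  have run_eq {m : ℕ} (hm : m ∈ e.reads) : (Stm.tab k e).run N A m = A m :=
    Function.update_of_ne (ne_of_mem_of_not_mem hm h) ..
  rw [table_congr fun m hm => run_eq hm]
  exact Function.update_self ..

theorem defines_run_tabs (N : ℕ) {k : ℕ} {e : Exp} {l : List Exp} (h : Stratified k (e :: l))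
    (A : Arrays) : Defines N ((tabs k e l).run N A) k (e :: l) := by
  have head := run_tab_self (N := N) (fun hk => (h.1 k hk).false) A
  induction l generalizing k e A with
  | nil => exact ⟨head, trivial⟩
  | cons e' l ih =>
    have run_eq {m : ℕ} (hm : m ≤ k) :
        (tabs k e (e' :: l)).run N A m = (Stm.tab k e).run N A m :=
      run_tabs_of_lt (Nat.lt_succ_of_le hm) _
    refine ⟨?_, ih h.2 _ (run_tab_self (fun hk => (h.2.1 _ hk).false) _)⟩
    rw [run_eq le_rfl, head, table_congr fun m hm => run_eq (h.1 m hm).le]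

/-! ### The graph as a table -/

namespace Exp

/-- A bit of the input. -/
@[simp] def bitE (a : Exp) : Exp := arr 0 (num 0) a

/-- The number of vertices. -/
@[simp] def orderE : Exp := cell 1

/-- A multiple of the number of vertices. -/
@[simp] def rowE (a : Exp) : Exp := col 2 a

/-- Adjacency. -/
@[simp] def adjE (a b : Exp) : Exp := arr 3 a b

/-- The symmetric relation given by the terminal pairs. -/
@[simp] def pairE (a b : Exp) : Exp := arr 4 a b

/-- The first vertex of the deletion pair. -/
@[simp] def uE : Exp := cell 6

/-- The second vertex of the deletion pair. -/
@[simp] def vE : Exp := cell 7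

/-- The number `a` is different from `p` and `q`. -/
def avoidsE (p q a : Exp) : Exp := andE (notE (eqE a p)) (notE (eqE a q))

/-- The entry `(0, 0)` is the number of vertices, which the encoding gives in unary. -/
def orderDef : Exp := leastE 2 3 (notE (bitE (var 3)))

/-- The column `0` holds the multiples of the number of vertices. -/
def rowDef : Exp := sum 2 (cond (ltE (var 2) orderE) (var 0) (num 0))

/-- The position in the input of the first matrix. -/
def adjPos : Exp := add orderE (num 1)

/-- The position in the input of the second matrix. -/
def pairPos : Exp := add adjPos (rowE orderE)

/-- The adjacency matrix. -/
def adjDef : Exp :=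
  andE (ltE (var 0) orderE)
    (andE (ltE (var 1) orderE) (bitE (add adjPos (add (rowE (var 0)) (var 1)))))

/-- The matrix of `Inst.pair`. -/
def pairDef : Exp :=
  andE (notE (eqE (var 0) (var 1)))
    (andE (ltE (var 0) orderE)
      (andE (ltE (var 1) orderE)
        (orE (bitE (add pairPos (add (rowE (var 0)) (var 1))))
          (bitE (add pairPos (add (rowE (var 1)) (var 0)))))))

/-- The matrix of `Inst.IsDeletionPair`. -/
def deletionPairDef : Exp :=
  andE (notE (eqE (var 0) (var 1)))
    (allE 2 (allE 3 (allE 4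
      (impE (avoidsE (var 0) (var 1) (var 2))
        (impE (avoidsE (var 0) (var 1) (var 3))
          (impE (avoidsE (var 0) (var 1) (var 4))
            (impE (adjE (var 2) (var 3))
              (impE (adjE (var 2) (var 4)) (eqE (var 3) (var 4))))))))))

/-- The entry `(0, 0)` is the first vertex of the least deletion pair. -/
def firstDef : Exp := leastE 2 3 (exE 4 (arr 5 (var 3) (var 4)))

/-- The entry `(0, 0)` is the second vertex of the least deletion pair. -/
def secondDef : Exp := leastE 2 3 (arr 5 uE (var 3))

end Exp

open Exp

/-- A bit of the encoding is set. -/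
def Inst.Bit (I : Inst) (j : ℕ) : Prop := I.encode.getD j false = true

/-- The arrays hold the input, the number of vertices, and its square in the form in which the
positions in the input are computed. -/
structure InputRep (I : Inst) (A : Arrays) : Prop where
  bit : ∀ j, A 0 0 j = truth (I.Bit j)
  order : A 1 0 0 = I.n
  row : A 2 I.n 0 = I.n * I.n

theorem InputRep.congr {I : Inst} {A B : Arrays} (h : InputRep I A) (hAB : ∀ l < 8, B l = A l) :
    InputRep I B where
  bit := hAB 0 (by decide) ▸ h.bit
  order := hAB 1 (by decide) ▸ h.order
  row := hAB 2 (by decide) ▸ h.row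

section Graph

variable {I : Inst} {N : ℕ} {A : Arrays}

theorem inputArrays_zero (j : ℕ) : inputArrays I.encode 0 0 j = truth (I.Bit j) := by
  simp only [inputArrays, and_self, if_true, Inst.Bit]
  cases I.encode.getD j false <;> simp [truth]

theorem order_eq (hN : I.n < N) (bit : ∀ j, A 0 0 j = truth (I.Bit j))
    (def_order : A 1 = table N A orderDef) : A 1 0 0 = I.n := by
  rw [def_order, table_of_lt (Nat.zero_lt_of_lt hN) (Nat.zero_lt_of_lt hN), orderDef,
    eval_leastE (Q := fun j => ¬ I.Bit j) (by decide) fun i j _ => by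
      simp [bit]]
  exact leastBelow_eq hN (by rw [Inst.Bit, I.getD_encode_n]; decide) fun j hj =>
    not_not.2 (I.getD_encode_of_lt hj)

theorem row_eq (hN : I.n < N) (order : A 1 0 0 = I.n) (def_row : A 2 = table N A rowDef) {i : ℕ}
    (hi : i < N) : A 2 i 0 = i * I.n := by
  have hfilter : {x ∈ range N | x < I.n} = range I.n := by
    ext x
    simp only [mem_filter, mem_range]
    omega
  calc A 2 i 0 = ∑ x ∈ range N, if x < I.n then i else 0 := by
        simp [def_row, table_of_lt hi (Nat.zero_lt_of_lt hi), rowDef, order]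
    _ = i * I.n := by rw [← sum_filter, hfilter, sum_const, card_range, smul_eq_mul, mul_comm]

theorem adj_eq (hN : I.n < N) (bit : ∀ j, A 0 0 j = truth (I.Bit j))
    (order : A 1 0 0 = I.n) (row : ∀ i < N, A 2 i 0 = i * I.n) (def_adj : A 3 = table N A adjDef)
    (i j : ℕ) : A 3 i j = truth (I.graph.Adj i j) := by
  rw [def_adj]
  refine table_eq_truth (fun h => ⟨(Inst.graph_adj_lt h).trans hN,
    (Inst.graph_adj_lt h.symm).trans hN⟩) fun hi _ => ?_
  have eval_eq : adjDef.eval N A (env i j) = truth (i < I.n ∧ j < I.n ∧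
      I.Bit (I.n + 1 + (i * I.n + j))) := by
    simp [adjDef, adjPos, bit, order, row i hi]
  rw [eval_eq, Inst.graph_adj]
  exact truth_congr ⟨fun ⟨hi, hj, h⟩ => ⟨hi, hj, (I.getD_encode_adj hi hj).1 h⟩,
    fun ⟨hi, hj, h⟩ => ⟨hi, hj, (I.getD_encode_adj hi hj).2 h⟩⟩

theorem pair_eq (hN : I.n < N) (bit : ∀ j, A 0 0 j = truth (I.Bit j))
    (order : A 1 0 0 = I.n) (row : ∀ i < N, A 2 i 0 = i * I.n) (def_pair : A 4 = table N A pairDef)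
    (i j : ℕ) : A 4 i j = truth (I.pair i j) := by
  rw [def_pair]
  refine table_eq_truth (fun h => ⟨(Inst.pair_lt h).trans hN,
    (Inst.pair_lt h.symm).trans hN⟩) fun hi hj => ?_
  have eval_eq : pairDef.eval N A (env i j) = truth (i ≠ j ∧ i < I.n ∧ j < I.n ∧
      (I.Bit (I.n + 1 + I.n * I.n + (i * I.n + j)) ∨
        I.Bit (I.n + 1 + I.n * I.n + (j * I.n + i)))) := by
    simp [pairDef, pairPos, adjPos, bit, order, row i hi, row j hj, row I.n hN]
  rw [eval_eq]
  refine truth_congr (and_congr_right fun _ => ⟨fun ⟨hi, hj, h⟩ => ⟨hi, hj, ?_⟩,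
    fun ⟨hi, hj, h⟩ => ⟨hi, hj, ?_⟩⟩)
  · exact h.imp (I.getD_encode_pair hi hj).1 (I.getD_encode_pair hj hi).1
  · exact h.imp (I.getD_encode_pair hi hj).2 (I.getD_encode_pair hj hi).2

theorem deletionPair_eq (hN : I.n < N) (adj : ∀ i j, A 3 i j = truth (I.graph.Adj i j))
    (def_deletionPair : A 5 = table N A deletionPairDef) {a b : ℕ} (ha : a < N) (hb : b < N) :
    A 5 a b = truth (I.IsDeletionPair a b) := by
  have eval_eq : deletionPairDef.eval N A (env a b) = truth (a ≠ b ∧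
      ∀ x < N, ∀ y < N, ∀ z < N, x ≠ a ∧ x ≠ b → y ≠ a ∧ y ≠ b → z ≠ a ∧ z ≠ b →
        I.graph.Adj x y → I.graph.Adj x z → y = z) := by
    simp [deletionPairDef, avoidsE, adj]
  have adj_lt {x y : ℕ} (h : I.graph.Adj x y) : x < N := (Inst.graph_adj_lt h).trans hN
  rw [def_deletionPair, table_of_lt ha hb, eval_eq]
  exact truth_congr <| and_congr_right fun _ =>
    ⟨fun h x y z hx hy hz hxy hxz =>
      h x (adj_lt hxy) y (adj_lt hxy.symm) z (adj_lt hxz.symm) hx hy hz hxy hxz,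
    fun h x _ y _ z _ => h x y z⟩

theorem first_eq (hN : 0 < N)
    (deletionPair : ∀ a < N, ∀ b < N, A 5 a b = truth (I.IsDeletionPair a b))
    (def_first : A 6 = table N A firstDef) :
    A 6 0 0 = leastBelow N fun a => ∃ b < N, I.IsDeletionPair a b := by
  rw [def_first, table_of_lt hN hN, firstDef]
  refine eval_leastE (by decide) fun i j hj => ?_
  rw [eval_exE, Ne, truth_eq_zero, not_not]
  exact exists_congr fun b => and_congr_right fun hb => by simp [deletionPair j hj b hb]

theorem second_eq (deletionPair : ∀ a < N, ∀ b < N, A 5 a b = truth (I.IsDeletionPair a b))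
    (first_lt : A 6 0 0 < N) (def_second : A 7 = table N A secondDef) :
    A 7 0 0 = leastBelow N fun b => I.IsDeletionPair (A 6 0 0) b := by
  have hN : 0 < N := Nat.zero_lt_of_lt first_lt
  rw [def_second, table_of_lt hN hN, secondDef]
  exact eval_leastE (by decide) fun i j hj => by simp [deletionPair _ first_lt j hj]

end Graph

/-- The arrays hold the graph and the pairs of an instance and its deletion set. -/
structure GraphRep (S : DeletionInst) (A : Arrays) : Prop where
  adj : ∀ i j, A 3 i j = truth (S.G.Adj i j)
  pair : ∀ i j, A 4 i j = truth (S.P i j)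
  first : A 6 0 0 = S.u
  second : A 7 0 0 = S.v

/-- The program that computes the graph and a deletion set from the input. -/
def graphProg : Stm :=
  tabs 1 orderDef [rowDef, adjDef, pairDef, deletionPairDef, firstDef, secondDef]

theorem graphProg_stratified : Stratified 1
    [orderDef, rowDef, adjDef, pairDef, deletionPairDef, firstDef, secondDef] := by
  decide

theorem run_graphProg {I : Inst} {T : Finset (Fin I.n)} (hcard : #T ≤ 2)
    (hT : IsDeletionSet I.G 2 T) {N : ℕ} (hN : I.n + 2 ≤ N) {A : Arrays}
    (hA : A 0 = inputArrays I.encode 0) :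
    InputRep I (graphProg.run N A) ∧ ∃ u v, ∃ (h : I.IsDeletionPair u v) (hu : u < N) (hv : v < N),
      GraphRep (I.deletionInst h hu hv (by omega)) (graphProg.run N A) := by
  obtain ⟨def_order, def_row, def_adj, def_pair, def_deletionPair, def_first, def_second, -⟩ :=
    defines_run_tabs N graphProg_stratified A
  rw [← graphProg] at *
  have hB : graphProg.run N A 0 = A 0 := run_tabs_of_lt one_pos _
  generalize graphProg.run N A = B at *
  have hN' : I.n < N := by omega
  have bit (j : ℕ) : B 0 0 j = truth (I.Bit j) := by
    rw [hB, hA, inputArrays_zero]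
  have order : B 1 0 0 = I.n := order_eq hN' bit def_order
  have row (i : ℕ) (hi : i < N) : B 2 i 0 = i * I.n := row_eq hN' order def_row hi
  have adj := adj_eq hN' bit order row def_adj
  have pair := pair_eq hN' bit order row def_pair
  have deletionPair (a : ℕ) (ha : a < N) (b : ℕ) (hb : b < N) :=
    deletionPair_eq hN' adj def_deletionPair ha hb
  have first := first_eq (Nat.zero_lt_of_lt hN') deletionPair def_first
  have hu := leastBelow_lt_iff.2 (Inst.exists_isDeletionPair hN hcard hT)
  have exists_second := leastBelow_spec hu
  rw [← first] at hu exists_second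
  have second := second_eq deletionPair hu def_second
  have hv := leastBelow_lt_iff.2 exists_second
  have hpair := leastBelow_spec hv
  rw [← second] at hv hpair
  exact ⟨⟨bit, order, row I.n hN'⟩, _, _, hpair, hu, hv, adj, pair, rfl, rfl⟩

/-! ### The network as a table -/

namespace Exp

/-- The relation `DeletionInst.Mate`. -/
@[simp] def mateE (a b : Exp) : Exp := arr 8 a b

/-- The property `DeletionInst.Outer`. -/
@[simp] def outerE (a : Exp) : Exp := col 9 a

/-- The property `DeletionInst.Req`. -/
@[simp] def reqE (a : Exp) : Exp := col 10 a

/-- The relation `DeletionInst.Detached`. -/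
def detachedE (a b : Exp) : Exp := andE (pairE a b) (andE (mateE a b) (notE (reqE a)))

/-- For `a` other than the vertices of the deletion set, the relation `DeletionInst.AnchoredTo` with
respect to the whole graph.  The variable `x` must not occur in `w` and `a`. -/
def anchoredE (x : ℕ) (w a : Exp) : Exp :=
  orE (adjE a w) (exE x (andE (mateE a (var x)) (adjE (var x) w)))

/-- The matrix of `DeletionInst.Mate`. -/
def mateDef : Exp :=
  andE (avoidsE uE vE (var 0)) (andE (avoidsE uE vE (var 1)) (adjE (var 0) (var 1)))

/-- The column `0` holds `DeletionInst.Outer`. -/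
def outerDef : Exp := exE 2 (andE (pairE (var 0) (var 2)) (notE (mateE (var 0) (var 2))))

/-- The column `0` holds `DeletionInst.Req`. -/
def reqDef : Exp :=
  andE (avoidsE uE vE (var 0))
    (orE (outerE (var 0))
      (exE 2 (andE (mateE (var 0) (var 2)) (andE (pairE (var 0) (var 2)) (outerE (var 2))))))

/-- The matrix of `DeletionInst.Blocked`. -/
def blockedDef : Exp :=
  orE (andE (pairE (var 0) (var 1)) (notE (detachedE (var 0) (var 1))))
    (orE
      (andE (mateE (var 0) (var 1))
        (andE (reqE (var 0))
          (andE (reqE (var 1)) (orE (notE (adjE (var 0) uE)) (notE (adjE (var 1) vE))))))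
      (orE
        (andE (eqE (var 1) vE) (andE (reqE (var 0)) (notE (anchoredE 2 uE (var 0)))))
        (andE (eqE (var 0) uE) (andE (reqE (var 1)) (notE (anchoredE 2 vE (var 1)))))))

/-- The matrix of the transpose of `DeletionInst.Extra`. -/
def extraDef : Exp :=
  andE (reqE (var 0))
    (andE (notE (adjE (var 0) (var 1)))
      (exE 2 (andE (mateE (var 0) (var 2)) (notE (reqE (var 2))))))

/-- The matrix of `DeletionInst.capacity`. -/
def capacityDef : Exp :=
  cond (arr 11 (var 0) (var 1)) size
    (orE (andE (eqE (var 1) vE) (arr 12 (var 0) uE)) (andE (eqE (var 0) uE) (arr 12 (var 1) vE)))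

end Exp

open Exp

namespace DeletionInst

variable {S : DeletionInst} {x w : ℕ}

theorem exists_lt_mate (Q : ℕ → Prop) :
    (∃ y < S.N, S.Mate x y ∧ Q y) ↔ ∃ y, S.Mate x y ∧ Q y :=
  exists_congr fun _ => and_iff_right_of_imp fun h => h.1.symm.lt

theorem anchoredTo_graph_iff (hx : S.Inner x) :
    S.AnchoredTo S.G w x ↔ S.G.Adj x w ∨ ∃ y < S.N, S.Mate x y ∧ S.G.Adj y w := by
  rw [AnchoredTo, and_iff_right hx, exists_lt_mate]
  exact or_congr_right (exists_congr fun y => and_congr_right fun h => and_iff_right h.2.2)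

theorem Blocked.lt {i j : ℕ} (h : S.Blocked i j) : i < S.N ∧ j < S.N := by
  rcases h with ⟨hp, -⟩ | ⟨hm, -⟩ | ⟨rfl, hr, -⟩ | ⟨rfl, hr, -⟩
  · exact ⟨S.pair_lt _ _ hp, S.pair_lt _ _ (S.pair_symm _ _ hp)⟩
  · exact ⟨hm.lt, hm.symm.lt⟩
  · exact ⟨hr.lt, S.v_lt⟩
  · exact ⟨S.u_lt, hr.lt⟩

end DeletionInst

/-- The arrays hold, in addition, the properties of vertices on which the formulas for the number of
edges of a Steiner forest are based. -/
structure SteinerRep (S : DeletionInst) (A : Arrays) : Prop extends GraphRep S A where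
  mate : ∀ i j, A 8 i j = truth (S.Mate i j)
  req : ∀ i, A 10 i 0 = truth (S.Req i)

theorem GraphRep.congr {S : DeletionInst} {A B : Arrays} (h : GraphRep S A)
    (hAB : ∀ l < 8, B l = A l) : GraphRep S B where
  adj := hAB 3 (by decide) ▸ h.adj
  pair := hAB 4 (by decide) ▸ h.pair
  first := hAB 6 (by decide) ▸ h.first
  second := hAB 7 (by decide) ▸ h.second

theorem SteinerRep.congr {S : DeletionInst} {A B : Arrays} (h : SteinerRep S A)
    (hAB : ∀ l < 14, B l = A l) : SteinerRep S B where
  toGraphRep := h.toGraphRep.congr fun l hl => hAB l (by omega)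
  mate := hAB 8 (by decide) ▸ h.mate
  req := hAB 10 (by decide) ▸ h.req

section Network

variable {S : DeletionInst} {A : Arrays} {v : ℕ → ℕ} {a b : Exp} {i j : ℕ}

theorem GraphRep.mate_eq (h : GraphRep S A) (def_mate : A 8 = table S.N A mateDef) (i j : ℕ) :
    A 8 i j = truth (S.Mate i j) := by
  rw [def_mate]
  refine table_eq_truth (fun hm => ⟨hm.lt, hm.symm.lt⟩) fun _ _ => ?_
  simp [mateDef, avoidsE, h.first, h.second, h.adj, DeletionInst.Mate, DeletionInst.Inner]

theorem GraphRep.outer_eq (h : GraphRep S A) (mate : ∀ i j, A 8 i j = truth (S.Mate i j))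
    (def_outer : A 9 = table S.N A outerDef) (i : ℕ) : A 9 i 0 = truth (S.Outer i) := by
  rw [def_outer]
  refine table_eq_truth (fun ⟨_, hp, _⟩ => ⟨S.pair_lt _ _ hp, Nat.zero_lt_of_lt S.u_lt⟩)
    fun _ _ => ?_
  have eval_eq : outerDef.eval S.N A (env i 0) = truth (∃ y < S.N, S.P i y ∧ ¬ S.Mate i y) := by
    simp [outerDef, h.pair, mate]
  rw [eval_eq]
  exact truth_exists_lt fun y hy => S.pair_lt _ _ (S.pair_symm _ _ hy.1)

theorem GraphRep.req_eq (h : GraphRep S A) (mate : ∀ i j, A 8 i j = truth (S.Mate i j))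
    (outer : ∀ i, A 9 i 0 = truth (S.Outer i)) (def_req : A 10 = table S.N A reqDef) (i : ℕ) :
    A 10 i 0 = truth (S.Req i) := by
  rw [def_req]
  refine table_eq_truth (fun hr => ⟨hr.lt, Nat.zero_lt_of_lt S.u_lt⟩) fun _ _ => ?_
  have eval_eq : reqDef.eval S.N A (env i 0) =
      truth (S.Inner i ∧ (S.Outer i ∨ ∃ y < S.N, S.Mate i y ∧ S.P i y ∧ S.Outer y)) := by
    simp [reqDef, avoidsE, h.first, h.second, h.pair, mate, outer, DeletionInst.Inner]
  rw [eval_eq, DeletionInst.exists_lt_mate, DeletionInst.Req]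

theorem SteinerRep.eval_detachedE (h : SteinerRep S A) :
    (detachedE a b).eval S.N A v = truth (S.Detached (a.eval S.N A v) (b.eval S.N A v)) := by
  simp [detachedE, h.pair, h.mate, h.req, DeletionInst.Detached]

theorem SteinerRep.blocked_eq (h : SteinerRep S A) (def_blocked : A 11 = table S.N A blockedDef)
    (i j : ℕ) : A 11 i j = truth (S.Blocked i j) := by
  rw [def_blocked]
  refine table_eq_truth DeletionInst.Blocked.lt fun _ _ => ?_
  have eval_eq : blockedDef.eval S.N A (env i j) = truth (S.P i j ∧ ¬ S.Detached i j ∨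
      S.Mate i j ∧ S.Req i ∧ S.Req j ∧ (¬ S.G.Adj i S.u ∨ ¬ S.G.Adj j S.v) ∨
      j = S.v ∧ S.Req i ∧ ¬ (S.G.Adj i S.u ∨ ∃ y < S.N, S.Mate i y ∧ S.G.Adj y S.u) ∨
      i = S.u ∧ S.Req j ∧ ¬ (S.G.Adj j S.v ∨ ∃ y < S.N, S.Mate j y ∧ S.G.Adj y S.v)) := by
    simp [blockedDef, anchoredE, h.eval_detachedE, h.first, h.second, h.adj, h.pair, h.mate, h.req]
  have anchored_iff {w x : ℕ} (hx : S.Req x) := DeletionInst.anchoredTo_graph_iff (w := w) hx.1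
  rw [eval_eq]
  refine truth_congr (or_congr_right (or_congr_right (or_congr ?_ ?_))) <;>
    exact and_congr_right fun _ => and_congr_right fun hr => not_congr (anchored_iff hr).symm

theorem SteinerRep.extra_eq (h : SteinerRep S A) (def_extra : A 12 = table S.N A extraDef)
    {w : ℕ} (hw : w < S.N) (i : ℕ) : A 12 i w = truth (S.Extra w i) := by
  rw [def_extra]
  refine table_eq_truth (fun he => ⟨he.lt, hw⟩) fun _ _ => ?_
  have eval_eq : extraDef.eval S.N A (env i w) =
      truth (S.Req i ∧ ¬ S.G.Adj i w ∧ ∃ y < S.N, S.Mate i y ∧ ¬ S.Req y) := by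
    simp [extraDef, h.adj, h.mate, h.req]
  rw [eval_eq, DeletionInst.exists_lt_mate, DeletionInst.Extra]

theorem SteinerRep.capacity_eq (h : SteinerRep S A)
    (blocked : ∀ i j, A 11 i j = truth (S.Blocked i j))
    (extra : ∀ w < S.N, ∀ i, A 12 i w = truth (S.Extra w i))
    (def_capacity : A 13 = table S.N A capacityDef) (hi : i < S.N) (hj : j < S.N) :
    A 13 i j = S.capacity i j := by
  classical
  rw [def_capacity, table_of_lt hi hj]
  simp [capacityDef, blocked, h.first, h.second, extra _ S.u_lt, extra _ S.v_lt,
    DeletionInst.capacity, truth_eq_ite]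

end Network

/-- The program that computes the network from the graph. -/
def networkProg : Stm := tabs 8 mateDef [outerDef, reqDef, blockedDef, extraDef, capacityDef]

theorem networkProg_stratified :
    Stratified 8 [mateDef, outerDef, reqDef, blockedDef, extraDef, capacityDef] := by
  decide

theorem GraphRep.run_networkProg {S : DeletionInst} {A : Arrays} (h : GraphRep S A) :
    SteinerRep S (networkProg.run S.N A) ∧
      ∀ i < S.N, ∀ j < S.N, networkProg.run S.N A 13 i j = S.capacity i j := by
  obtain ⟨def_mate, def_outer, def_req, def_blocked, def_extra, def_capacity, -⟩ :=
    defines_run_tabs S.N networkProg_stratified A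
  rw [← networkProg] at *
  have graph : GraphRep S (networkProg.run S.N A) := h.congr fun l hl => run_tabs_of_lt hl _
  generalize networkProg.run S.N A = B at *
  have mate := graph.mate_eq def_mate
  have outer := graph.outer_eq mate def_outer
  have steiner : SteinerRep S B := ⟨graph, mate, graph.req_eq mate outer def_req⟩
  have blocked := steiner.blocked_eq def_blocked
  have extra (w : ℕ) (hw : w < S.N) := steiner.extra_eq def_extra hw
  exact ⟨steiner, fun i hi j hj => steiner.capacity_eq blocked extra def_capacity hi hj⟩

/-! ### The minimum cut -/

namespace Exp

/-- The field `Flow.cap`. -/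
@[simp] def capE (a b : Exp) : Exp := arr 20 a b

/-- The field `Flow.lab`. -/
@[simp] def labE (a : Exp) : Exp := col 21 a

/-- The field `Flow.pos`. -/
@[simp] def posE : Exp := cell 22

/-- The field `Flow.cnt`. -/
@[simp] def cntE : Exp := cell 23

/-- The value of `Flow.pred`. -/
@[simp] def predE : Exp := cell 24

/-- The entry `(0, 0)` is `Flow.pred`. -/
def predDef : Exp := leastE 2 3 (andE (capE (var 3) posE) (ltE (labE (var 3)) (labE posE)))

/-- The field `Flow.cap` after `Flow.step`. -/
def capDef : Exp :=
  cond (eqE posE uE) (capE (var 0) (var 1))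
    (cond (ltE predE size)
      (sub (add (capE (var 0) (var 1)) (andE (eqE (var 0) posE) (eqE (var 1) predE)))
        (andE (eqE (var 0) predE) (eqE (var 1) posE)))
      (capE (var 0) (var 1)))

/-- The field `Flow.lab` after `Flow.step`. -/
def labDef : Exp :=
  cond (eqE posE uE) (labE (var 0))
    (cond (ltE predE size) (labE (var 0))
      (cond (ltE (labE posE) size) (add (labE (var 0)) (eqE (var 0) posE)) (labE (var 0))))

/-- The field `Flow.pos` after `Flow.step`. -/
def posDef : Exp := cond (eqE posE uE) vE (cond (ltE predE size) predE posE)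

/-- The field `Flow.cnt` after `Flow.step`. -/
def cntDef : Exp := cond (eqE posE uE) (add cntE (num 1)) cntE

end Exp

open Exp

/-- The arrays hold a state of the augmenting path algorithm.  Its values outside of the network are
irrelevant. -/
structure FlowRep (N s t : ℕ) (f : Flow) (A : Arrays) : Prop where
  source : A 6 0 0 = s
  sink : A 7 0 0 = t
  cap : ∀ i < N, ∀ j < N, A 20 i j = f.cap i j
  lab : ∀ x < N, A 21 x 0 = f.lab x
  pos : A 22 0 0 = f.pos
  cnt : A 23 0 0 = f.cnt

/-- The program that computes the next state of the augmenting path algorithm in new arrays. -/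
def flowCompute : Stm := tabs 24 predDef [capDef, labDef, posDef, cntDef]

/-- The program that replaces the state of the augmenting path algorithm by the next one. -/
def flowCopy : Stm :=
  .seq (.tab 20 (arr 25 (var 0) (var 1))) (.seq (.tab 21 (arr 26 (var 0) (var 1)))
    (.seq (.tab 22 (cell 27)) (.tab 23 (cell 28))))

/-- The program for one step of the augmenting path algorithm. -/
def flowStep : Stm := .seq flowCompute flowCopy

/-- The program for the initial state of the augmenting path algorithm. -/
def flowInit : Stm := tabs 20 (arr 13 (var 0) (var 1)) [num 0, vE, num 0]

/-- The program that computes the minimum capacity of a cut. -/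
def flowProg : Stm := .seq flowInit (.rep (.rep (.rep (.rep (.rep flowStep)))))

theorem flowCompute_stratified : Stratified 24 [predDef, capDef, labDef, posDef, cntDef] := by
  decide

theorem flowInit_stratified : Stratified 20 [arr 13 (var 0) (var 1), num 0, vE, num 0] := by
  decide

section Flow

variable {N s t i j : ℕ} {f : Flow} {A : Arrays}

theorem FlowRep.pred_eq (h : FlowRep N s t f A) (hpos : f.pos < N)
    (def_pred : A 24 = table N A predDef) : A 24 0 0 = f.pred N := by
  have hN : 0 < N := Nat.zero_lt_of_lt hpos
  rw [def_pred, table_of_lt hN hN, predDef]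
  exact eval_leastE (by decide) fun i j hj => by
    simp [h.pos, h.cap j hj _ hpos, h.lab j hj, h.lab _ hpos]

theorem FlowRep.eval_capDef (h : FlowRep N s t f A) (pred : A 24 0 0 = f.pred N) (hi : i < N)
    (hj : j < N) : capDef.eval N A (env i j) = (f.step N s t).cap i j := by
  rw [Flow.step]
  split_ifs with hpos hpred hlab <;>
    simp [capDef, h.source, h.pos, h.cap i hi j hj, truth_eq_ite, Flow.restart, Flow.push,
      Flow.relabel, residual, *]

theorem FlowRep.eval_labDef (h : FlowRep N s t f A) (pred : A 24 0 0 = f.pred N)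
    (hpos_lt : f.pos < N) (hi : i < N) : labDef.eval N A (env i 0) = (f.step N s t).lab i := by
  have lab_add : f.lab i + (if i = f.pos then 1 else 0) = f.relabel.lab i := by
    simp only [Flow.relabel, Function.update_apply]
    split_ifs with hi <;> simp only [hi, add_zero]
  rw [Flow.step]
  split_ifs with hpos hpred hlab <;>
    simp [labDef, h.source, h.pos, h.lab i hi, h.lab _ hpos_lt, truth_eq_ite, Flow.restart,
      Flow.push, *]

theorem FlowRep.eval_posDef (h : FlowRep N s t f A) (pred : A 24 0 0 = f.pred N) :
    posDef.eval N A (env 0 0) = (f.step N s t).pos := by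
  rw [Flow.step]
  split_ifs with hpos hpred hlab <;>
    simp [posDef, h.source, h.sink, h.pos, Flow.restart, Flow.push, Flow.relabel, *]

theorem FlowRep.eval_cntDef (h : FlowRep N s t f A) :
    cntDef.eval N A (env 0 0) = (f.step N s t).cnt := by
  rw [Flow.step]
  split_ifs with hpos hpred hlab <;>
    simp [cntDef, h.source, h.pos, h.cnt, Flow.restart, Flow.push, Flow.relabel, *]

theorem run_flowCopy (hi : i < N) (hj : j < N) : flowCopy.run N A 20 i j = A 25 i j ∧
    flowCopy.run N A 21 i j = A 26 i j ∧ flowCopy.run N A 22 i j = A 27 0 0 ∧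
      flowCopy.run N A 23 i j = A 28 0 0 := by
  simp [flowCopy, Stm.run, hi, hj]

theorem FlowRep.run_flowStep (h : FlowRep N s t f A) (hpos : f.pos < N) :
    FlowRep N s t (f.step N s t) (flowStep.run N A) := by
  have hN : 0 < N := Nat.zero_lt_of_lt hpos
  obtain ⟨def_pred, def_cap, def_lab, def_pos, def_cnt, -⟩ :=
    defines_run_tabs N flowCompute_stratified A
  rw [← flowCompute] at *
  have run_eq {l : ℕ} (hl : l < 24) : flowCompute.run N A l = A l := run_tabs_of_lt hl _
  have hB : FlowRep N s t f (flowCompute.run N A) := by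
    constructor <;> rw [run_eq (by decide)]
    exacts [h.source, h.sink, h.cap, h.lab, h.pos, h.cnt]
  rw [flowStep, Stm.run]
  generalize flowCompute.run N A = B at *
  have pred := hB.pred_eq hpos def_pred
  have copy_eq {l : ℕ} (hl : l ∉ flowCopy.writes) : flowCopy.run N B l = B l :=
    Stm.run_eq_of_notMem_writes hl _
  refine ⟨?_, ?_, fun i hi j hj => ?_, fun i hi => ?_, ?_, ?_⟩
  · rw [copy_eq (by decide), hB.source]
  · rw [copy_eq (by decide), hB.sink]
  · rw [(run_flowCopy hi hj).1, def_cap, table_of_lt hi hj, hB.eval_capDef pred hi hj]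
  · rw [(run_flowCopy hi hN).2.1, def_lab, table_of_lt hi hN, hB.eval_labDef pred hpos hi]
  · rw [(run_flowCopy hN hN).2.2.1, def_pos, table_of_lt hN hN, hB.eval_posDef pred]
  · rw [(run_flowCopy hN hN).2.2.2, def_cnt, table_of_lt hN hN, hB.eval_cntDef]

theorem FlowRep.run_iterate_flowStep {c : ℕ → ℕ → ℕ} (h : FlowRep N s t f A) (ht : t < N)
    (hst : s ≠ t) (hf : f.Inv N s t c) (m : ℕ) :
    FlowRep N s t ((Flow.step N s t)^[m] f) ((flowStep.run N)^[m] A) := by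
  induction m generalizing f A with
  | zero => exact h
  | succ _ ih => exact ih (h.run_flowStep hf.pos_lt) (hf.step ht hst).1

end Flow

theorem GraphRep.run_flowInit {S : DeletionInst} {A : Arrays} (h : GraphRep S A)
    (hcap : ∀ i < S.N, ∀ j < S.N, A 13 i j = S.capacity i j) :
    FlowRep S.N S.u S.v (Flow.init S.v S.capacity) (flowInit.run S.N A) := by
  have hN : 0 < S.N := Nat.zero_lt_of_lt S.u_lt
  obtain ⟨def_cap, def_lab, def_pos, def_cnt, -⟩ := defines_run_tabs S.N flowInit_stratified A
  rw [← flowInit] at *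
  have run_eq {l : ℕ} (hl : l < 20) : flowInit.run S.N A l = A l := run_tabs_of_lt hl _
  generalize flowInit.run S.N A = B at *
  refine ⟨?_, ?_, fun i hi j hj => ?_, fun x hx => ?_, ?_, ?_⟩
  · rw [run_eq (by decide), h.first]
  · rw [run_eq (by decide), h.second]
  · simp [def_cap, table_of_lt hi hj, run_eq, hcap i hi j hj, Flow.init]
  · simp [def_lab, table_of_lt hx hN, Flow.init]
  · simp [def_pos, table_of_lt hN hN, run_eq, h.second, Flow.init]
  · simp [def_cnt, table_of_lt hN hN, Flow.init]

theorem GraphRep.run_flowProg {S : DeletionInst} {A : Arrays} (h : GraphRep S A)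
    (hcap : ∀ i < S.N, ∀ j < S.N, A 13 i j = S.capacity i j) :
    IsMinCut S.N S.u S.v S.capacity (flowProg.run S.N A 23 0 0) := by
  have hrun := (h.run_flowInit hcap).run_iterate_flowStep S.v_lt S.u_ne_v
    (Flow.inv_init S.v_lt) (S.N ^ 5)
  have run_eq : flowProg.run S.N A = (flowStep.run S.N)^[S.N ^ 5] (flowInit.run S.N A) := by
    simp only [flowProg, Stm.run, pow_succ, pow_zero, one_mul, Function.iterate_mul]
  rw [run_eq, hrun.cnt]
  exact Flow.isMinCut_iterate_step S.u_lt S.v_lt S.u_ne_v fun i _ j _ => S.capacity_le i j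

/-! ### The bound on the number of edges -/

namespace Exp

/-- The number of binary digits of the bound that have been read. -/
@[simp] def readE : Exp := cell 31

/-- The number formed by the leading binary digits of the bound that have been read. -/
@[simp] def boundE : Exp := cell 30

/-- The position in the input of the sign of the bound. -/
def signPos : Exp := add pairPos (rowE orderE)

/-- The value of `boundE` after the next digit has been read.  Of `size` digits, of which the first
may be positions beyond the end of the input, the most significant one is read first. -/
def boundDef : Exp :=
  add (add boundE boundE)
    (bitE (add (add signPos (num 1)) (sub (sub size (num 1)) readE)))

end Exp

open Exp

/-- The program for the state in which no digit has been read. -/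
def boundInit : Stm := tabs 30 (num 0) [num 0]

/-- The program that reads the next digit of the bound. -/
def boundStep : Stm :=
  .seq (.tab 32 boundDef) (.seq (.tab 33 (add readE (num 1)))
    (.seq (.tab 30 (cell 32)) (.tab 31 (cell 33))))

/-- The program that reads the bound from the input. -/
def boundProg : Stm := .seq boundInit (.rep boundStep)

theorem boundInit_stratified : Stratified 30 [num 0, num 0] := by decide

section Bound

variable {I : Inst} {N m : ℕ} {A : Arrays}

theorem InputRep.eval_signPos (h : InputRep I A) {v : ℕ → ℕ} :
    signPos.eval N A v = I.n + 1 + I.n * I.n + I.n * I.n := by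
  simp [signPos, pairPos, adjPos, h.order, h.row]

theorem InputRep.run_boundStep (h : InputRep I A) (hN : 0 < N) :
    boundStep.run N A 30 0 0 =
        2 * A 30 0 0 + (I.k.natAbs.bits.getD (N - 1 - A 31 0 0) false).toNat ∧
      boundStep.run N A 31 0 0 = A 31 0 0 + 1 := by
  have truth_eq (b : Bool) : truth (b = true) = b.toNat := by cases b <;> simp [truth]
  have eval_eq : boundDef.eval N A (env 0 0) =
      2 * A 30 0 0 + (I.k.natAbs.bits.getD (N - 1 - A 31 0 0) false).toNat := by
    rw [← I.getD_encode_bits, ← truth_eq]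
    simp [boundDef, h.eval_signPos, h.bit, Inst.Bit, two_mul]
  constructor <;> simp [boundStep, Stm.run, hN, eval_eq]

theorem InputRep.run_iterate_boundStep (h : InputRep I A) (hN : 0 < N)
    (hlen : I.k.natAbs.bits.length ≤ N) (hbound : A 30 0 0 = 0) (hread : A 31 0 0 = 0)
    (hm : m ≤ N) : (boundStep.run N)^[m] A 30 0 0 = I.k.natAbs / 2 ^ (N - m) ∧
      (boundStep.run N)^[m] A 31 0 0 = m ∧ InputRep I ((boundStep.run N)^[m] A) := by
  induction m with
  | zero => exact ⟨by rw [Nat.sub_zero, div_two_pow_eq_zero hlen]; exact hbound, hread, h⟩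
  | succ m ih =>
    obtain ⟨bound, read, input⟩ := ih (by omega)
    obtain ⟨bound_step, read_step⟩ := input.run_boundStep hN
    have hnext : N - (m + 1) + 1 = N - m := by omega
    have hdigit : N - 1 - m = N - (m + 1) := by omega
    rw [Function.iterate_succ_apply', bound_step, read_step, bound, read, hdigit, ← hnext]
    exact ⟨(div_two_pow_eq _ _).symm, rfl, input.congr fun l hl =>
      Stm.run_eq_of_notMem_writes (by decide +revert) _⟩

theorem InputRep.run_boundProg (h : InputRep I A) (hN : 0 < N)
    (hlen : I.k.natAbs.bits.length ≤ N) : boundProg.run N A 30 0 0 = I.k.natAbs := by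
  obtain ⟨def_bound, def_read, -⟩ := defines_run_tabs N boundInit_stratified A
  rw [← boundInit] at *
  have input : InputRep I (boundInit.run N A) :=
    h.congr fun l hl => run_tabs_of_lt (by omega) _
  rw [boundProg, Stm.run]
  generalize boundInit.run N A = B at *
  have bound := (input.run_iterate_boundStep hN hlen
    (by simp [def_bound, table_of_lt hN hN]) (by simp [def_read, table_of_lt hN hN]) le_rfl).1
  rwa [Nat.sub_self, pow_zero, Nat.div_one] at bound

end Bound

/-! ### The answer -/

namespace Exp

/-- The property `DeletionInst.OnBridge` with respect to the variables `0` and `1`. -/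
def onBridgeE (a : Exp) : Exp := andE (notE (eqE a uE)) (orE (eqE a (var 0)) (eqE a (var 1)))

/-- The entry `(0, 0)` holds `DeletionInst.Attachable`. -/
def attachableDef : Exp :=
  allE 2 (impE (reqE (var 2)) (orE (anchoredE 3 uE (var 2)) (anchoredE 3 vE (var 2))))

/-- The column `0` holds `DeletionInst.Helper`. -/
def helperDef : Exp :=
  andE (notE (reqE (var 0)))
    (exE 2 (andE (mateE (var 0) (var 2))
      (andE (reqE (var 2)) (andE (notE (adjE (var 2) uE)) (notE (adjE (var 2) vE))))))

/-- The matrix of `DeletionInst.Bridge`. -/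
def bridgeDef : Exp :=
  andE (orE (eqE (var 0) uE) (adjE (var 0) uE))
    (andE (orE (eqE (var 0) (var 1)) (mateE (var 0) (var 1))) (adjE (var 1) vE))

/-- The matrix of the numbers of vertices with the property `DeletionInst.JoinVert`. -/
def joinVertDef : Exp := sum 2 (orE (reqE (var 2)) (orE (col 41 (var 2)) (onBridgeE (var 2))))

/-- The matrix of the numbers of vertices with the property `DeletionInst.JoinPair`. -/
def joinPairDef : Exp :=
  sum 2 (exE 3 (andE (ltE (var 2) (var 3)) (andE (detachedE (var 2) (var 3))
    (notE (andE (onBridgeE (var 2)) (onBridgeE (var 3)))))))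

/-- The number of vertices with the property `DeletionInst.InnerPair`. -/
def innerPairDef : Exp := sum 2 (exE 3 (andE (ltE (var 2) (var 3)) (detachedE (var 2) (var 3))))

/-- The number of vertices with the property `DeletionInst.Req`. -/
def reqCountDef : Exp := sum 2 (reqE (var 2))

/-- The entry `(0, 0)` holds the answer. -/
def answerDef : Exp :=
  andE (notE (bitE signPos))
    (orE
      (andE (cell 40) (exE 2 (exE 3 (andE (arr 42 (var 2) (var 3))
        (leE (add (add (num 1) (arr 43 (var 2) (var 3))) (arr 44 (var 2) (var 3))) boundE)))))
      (andE (ltE cntE size) (leE (add (add (cell 46) cntE) (cell 45)) boundE)))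

end Exp

open Exp

/-- The program that computes the answer from the minimum cut and the bound. -/
def answerProg : Stm :=
  tabs 40 attachableDef
    [helperDef, bridgeDef, joinVertDef, joinPairDef, innerPairDef, reqCountDef, answerDef]

theorem answerProg_stratified :
    Stratified 40 [attachableDef, helperDef, bridgeDef, joinVertDef, joinPairDef, innerPairDef,
      reqCountDef, answerDef] := by
  decide

section Answer

variable {S : DeletionInst} {A : Arrays} {v : ℕ → ℕ} {e : Exp} {a b : ℕ}

theorem SteinerRep.eval_onBridgeE (h : SteinerRep S A) :
    (onBridgeE e).eval S.N A v = truth (S.OnBridge (v 0) (v 1) (e.eval S.N A v)) := by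
  simp [onBridgeE, h.first, DeletionInst.OnBridge]

theorem SteinerRep.attachable_eq (h : SteinerRep S A)
    (def_attachable : A 40 = table S.N A attachableDef) : A 40 0 0 = truth S.Attachable := by
  have hN : 0 < S.N := Nat.zero_lt_of_lt S.u_lt
  have eval_eq : attachableDef.eval S.N A (env 0 0) = truth (∀ x < S.N, S.Req x →
      (S.G.Adj x S.u ∨ ∃ y < S.N, S.Mate x y ∧ S.G.Adj y S.u) ∨
        (S.G.Adj x S.v ∨ ∃ y < S.N, S.Mate x y ∧ S.G.Adj y S.v)) := by
    simp [attachableDef, anchoredE, h.first, h.second, h.adj, h.mate, h.req]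
  rw [def_attachable, table_of_lt hN hN, eval_eq]
  refine truth_congr (forall_congr' fun x => ⟨fun hx hr => ?_, fun hx _ hr => ?_⟩)
  · rw [DeletionInst.Anchored, DeletionInst.anchoredTo_graph_iff hr.1,
      DeletionInst.anchoredTo_graph_iff hr.1]
    exact hx hr.lt hr
  · rw [← DeletionInst.anchoredTo_graph_iff hr.1, ← DeletionInst.anchoredTo_graph_iff hr.1]
    exact hx hr

theorem SteinerRep.helper_eq (h : SteinerRep S A) (def_helper : A 41 = table S.N A helperDef)
    (i : ℕ) : A 41 i 0 = truth (S.Helper i) := by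
  rw [def_helper]
  refine table_eq_truth (fun ⟨_, _, hm, _⟩ => ⟨hm.lt, Nat.zero_lt_of_lt S.u_lt⟩) fun _ _ => ?_
  have eval_eq : helperDef.eval S.N A (env i 0) = truth (¬ S.Req i ∧
      ∃ x < S.N, S.Mate i x ∧ S.Req x ∧ ¬ S.G.Adj x S.u ∧ ¬ S.G.Adj x S.v) := by
    simp [helperDef, h.first, h.second, h.adj, h.mate, h.req]
  rw [eval_eq, DeletionInst.exists_lt_mate, DeletionInst.Helper]

theorem SteinerRep.bridge_eq (h : SteinerRep S A) (def_bridge : A 42 = table S.N A bridgeDef)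
    (ha : a < S.N) (hb : b < S.N) : A 42 a b = truth (S.Bridge a b) := by
  rw [def_bridge, table_of_lt ha hb]
  simp [bridgeDef, h.first, h.second, h.adj, h.mate, DeletionInst.Bridge]

theorem SteinerRep.joinVert_eq (h : SteinerRep S A) (helper : ∀ i, A 41 i 0 = truth (S.Helper i))
    (def_joinVert : A 43 = table S.N A joinVertDef) (ha : a < S.N) (hb : b < S.N) :
    A 43 a b = count S.N (S.JoinVert a b) := by
  rw [def_joinVert, table_of_lt ha hb, ← sum_truth]
  simp [joinVertDef, h.eval_onBridgeE, h.req, helper, DeletionInst.JoinVert]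

theorem SteinerRep.joinPair_eq (h : SteinerRep S A)
    (def_joinPair : A 44 = table S.N A joinPairDef) (ha : a < S.N) (hb : b < S.N) :
    A 44 a b = count S.N (S.JoinPair a b) := by
  have eval_eq : joinPairDef.eval S.N A (env a b) = ∑ x ∈ range S.N, truth (∃ y < S.N, x < y ∧
      S.Detached x y ∧ ¬ (S.OnBridge a b x ∧ S.OnBridge a b y)) := by
    simp [joinPairDef, h.eval_onBridgeE, h.eval_detachedE]
  rw [def_joinPair, table_of_lt ha hb, eval_eq, ← sum_truth]
  exact sum_congr rfl fun x _ => truth_exists_lt fun y hy => hy.2.1.2.1.symm.lt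

theorem SteinerRep.innerPair_eq (h : SteinerRep S A)
    (def_innerPair : A 45 = table S.N A innerPairDef) : A 45 0 0 = count S.N S.InnerPair := by
  have hN : 0 < S.N := Nat.zero_lt_of_lt S.u_lt
  have eval_eq : innerPairDef.eval S.N A (env 0 0) =
      ∑ x ∈ range S.N, truth (∃ y < S.N, x < y ∧ S.Detached x y) := by
    simp [innerPairDef, h.eval_detachedE]
  rw [def_innerPair, table_of_lt hN hN, eval_eq, ← sum_truth]
  exact sum_congr rfl fun x _ => truth_exists_lt fun y hy => hy.2.2.1.symm.lt

theorem SteinerRep.reqCount_eq (h : SteinerRep S A)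
    (def_reqCount : A 46 = table S.N A reqCountDef) : A 46 0 0 = count S.N S.Req := by
  have hN : 0 < S.N := Nat.zero_lt_of_lt S.u_lt
  rw [def_reqCount, table_of_lt hN hN, ← sum_truth]
  simp [reqCountDef, h.req]

theorem InputRep.eval_signBit {I : Inst} {N : ℕ} (h : InputRep I A) :
    (bitE signPos).eval N A v = truth (I.k < 0) := by
  rw [bitE, eval, eval, h.bit, h.eval_signPos, Inst.Bit, I.getD_encode_sign, decide_eq_true_eq]

theorem SteinerRep.run_answerProg {I : Inst} (h : SteinerRep S A) (hI : InputRep I A)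
    (hbound : A 30 0 0 = I.k.natAbs) (hcut : IsMinCut S.N S.u S.v S.capacity (A 23 0 0)) :
    answerProg.run S.N A 47 0 0 =
      truth (¬ I.k < 0 ∧ ∃ H, S.IsForest H ∧ H.edgeSet.ncard ≤ I.k.natAbs) := by
  have hN : 0 < S.N := Nat.zero_lt_of_lt S.u_lt
  obtain ⟨def_attachable, def_helper, def_bridge, def_joinVert, def_joinPair, def_innerPair,
    def_reqCount, def_answer, -⟩ := defines_run_tabs S.N answerProg_stratified A
  rw [← answerProg] at *
  have run_eq {l : ℕ} (hl : l < 40) : answerProg.run S.N A l = A l := run_tabs_of_lt hl _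
  rw [← run_eq (by decide : 30 < 40)] at hbound
  rw [← run_eq (by decide : 23 < 40)] at hcut
  have steiner : SteinerRep S (answerProg.run S.N A) := h.congr fun l hl => run_eq (by omega)
  have input : InputRep I (answerProg.run S.N A) := hI.congr fun l hl => run_eq (by omega)
  generalize answerProg.run S.N A = B at *
  have helper := steiner.helper_eq def_helper
  have eval_eq : answerDef.eval S.N B (env 0 0) = truth (¬ I.k < 0 ∧
      ((S.Attachable ∧ ∃ a < S.N, ∃ b < S.N, B 42 a b ≠ 0 ∧
          1 + B 43 a b + B 44 a b ≤ I.k.natAbs) ∨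
        B 23 0 0 < S.N ∧ count S.N S.Req + B 23 0 0 + count S.N S.InnerPair ≤ I.k.natAbs)) := by
    simp [answerDef, -bitE, input.eval_signBit, hbound, steiner.attachable_eq def_attachable,
      steiner.innerPair_eq def_innerPair, steiner.reqCount_eq def_reqCount]
  rw [def_answer, table_of_lt hN hN, eval_eq, DeletionInst.exists_isForest_iff hcut]
  refine truth_congr (and_congr_right' (or_congr_left (and_congr_right' ?_)))
  refine exists_congr fun a => and_congr_right fun ha => exists_congr fun b =>
    and_congr_right fun hb => ?_
  rw [steiner.bridge_eq def_bridge ha hb, steiner.joinVert_eq helper def_joinVert ha hb,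
    steiner.joinPair_eq def_joinPair ha hb, ne_eq, truth_eq_zero, not_not]

end Answer

/-! ### The whole program -/

/-- The program that decides the instance after the deletion set has been found. -/
def forestProg : Stm := .seq networkProg (.seq flowProg (.seq boundProg answerProg))

/-- The program that decides Steiner Forest for graphs with a deletion set of at most two
vertices. -/
def steinerProg : Stm := .seq graphProg forestProg

theorem steinerProg_wf : steinerProg.WF := by decide

theorem GraphRep.run_forestProg {I : Inst} {S : DeletionInst} {A : Arrays} (h : GraphRep S A)
    (hI : InputRep I A) (hlen : I.k.natAbs.bits.length ≤ S.N) :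
    forestProg.run S.N A 47 0 0 =
      truth (¬ I.k < 0 ∧ ∃ H, S.IsForest H ∧ H.edgeSet.ncard ≤ I.k.natAbs) := by
  obtain ⟨steiner, capacity⟩ := h.run_networkProg
  have input : InputRep I (networkProg.run S.N A) := hI.congr fun l hl => run_tabs_of_lt hl _
  rw [forestProg, Stm.run, Stm.run, Stm.run]
  generalize networkProg.run S.N A = B at *
  have flow_eq {l : ℕ} (hl : l < 14) : flowProg.run S.N B l = B l :=
    Stm.run_eq_of_notMem_writes (by decide +revert) _
  have hcut := steiner.run_flowProg capacity
  replace steiner := steiner.congr fun l hl => flow_eq hl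
  replace input := input.congr fun l hl => flow_eq (hl.trans (by decide))
  generalize flowProg.run S.N B = C at *
  have bound_eq {l : ℕ} (hl : l < 24) : boundProg.run S.N C l = C l :=
    Stm.run_eq_of_notMem_writes (by decide +revert) _
  have hbound := input.run_boundProg (Nat.zero_lt_of_lt S.u_lt) hlen
  replace steiner := steiner.congr fun l hl => bound_eq (hl.trans (by decide))
  replace input := input.congr fun l hl => bound_eq (hl.trans (by decide))
  rw [← bound_eq (by decide : 23 < 24)] at hcut
  exact steiner.run_answerProg input hbound hcut

theorem run_steinerProg {I : Inst} {T : Finset (Fin I.n)} (hcard : #T ≤ 2)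
    (hT : IsDeletionSet I.G 2 T) :
    steinerProg.run I.encode.length (inputArrays I.encode) 47 0 0 = truth I.Yes := by
  have hlen := I.length_encode
  generalize I.encode.length = N at *
  obtain ⟨input, u, v, h, hu, hv, graph⟩ :=
    run_graphProg hcard hT (by omega : I.n + 2 ≤ N) (A := inputArrays I.encode) rfl
  rw [I.yes_iff h hu hv (by omega)]
  exact graph.run_forestProg input (by rw [Inst.deletionInst_N]; omega)

end SteinerForest

theorem lemma10 :
    SteinerForest.PolyTimeSolvableOn SteinerForest.Inst.encode
      (fun I => ∃ T : Finset (Fin I.n), T.card ≤ 2 ∧ SteinerForest.IsDeletionSet I.G 2 T)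
      SteinerForest.Inst.Yes := by
  refine SteinerForest.PolyTimeSolvableOn.of_stm SteinerForest.steinerProg
    SteinerForest.steinerProg_wf 47 fun I ⟨T, hcard, hT⟩ => ?_
  rw [SteinerForest.run_steinerProg hcard hT]
  exact ⟨SteinerForest.truth_of, SteinerForest.truth_of_not⟩
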